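/- Let $\mathfrak g$ be a finite-dimensional real Lie algebra with an invariant, non-degenerate, symmetric bilinear form $B$. Let $e_a$ be a basis of $\mathfrak g$ and $e^a$ the dual basis, $B(e^a,e_b)=\delta_{ab}$. Repeated indices are summed. **Algebras and maps.** Let $\mathrm{Cl}(\mathfrak g)$ be the Clifford algebra with relations $vv'+v'v=B(v,v')$, let $U\mathfrak g$ be the enveloping algebra, and put $W\mathfrak g=S\mathfrak g\otimes\wedge\mathfrak g$ and $\mathcal W\mathfrak g=U\mathfrak g\otimes\mathrm{Cl}(\mathfrak g)$. Let $\mathrm{sym}:S\mathfrak g\to U\mathfrak g$ be symmetrization, $v_1\cdots v_k\mapsto\frac1{k!}\sum_\sigma v_{\sigma1}\cdots v_{\sigma k}$, and let $q:\wedge\mathfrak g\to\mathrm{Cl}(\mathfrak g)$ be the Clifford quantization map, $v_1\wedge\dots\wedge v_k\mapsto\frac1{k!}\sum_\sigma\mathrm{sgn}(\sigma)\,v_{\sigma1}\cdots v_{\sigma k}$. **The function $\mathcal S$.** Let $j(z)=\frac{\sinh(z/2)}{z/2}$ and $f=(\ln j)'$. For $\xi\in\mathfrak g$ near $0$ put $J(\xi)=\det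 j(\mathrm{ad}_\xi)$ and $$\mathcal S(\xi)=J^{1/2}(\xi)\,\exp\Big(\tfrac12 B\big(e_a,f(\mathrm{ad}_\xi)e_b\big)\,e^a\wedge e^b\Big)\in\wedge\mathfrak g,\qquad J^{1/2}(0)=1 .$$ For a function of $\xi=\xi^a e_a$ that is analytic near $0$, the hat denotes the infinite order differential operator on $S\mathfrak g$ (polynomials on $\mathfrak g^*$, with coordinates $\mu_a=\langle\mu,e_a\rangle$) obtained by replacing $\xi^a$ by $\partial/\partial\mu_a$ in its Taylor series at $0$. Let $\iota(\widehat{\mathcal S})$ be the operator on $W\mathfrak g$ in which the coefficients in $\wedge\mathfrak g$ of $\widehat{\mathcal S}$ act on $\wedge\mathfrak g$ by contraction: $\iota_v w=B(v,w)$ for $v,w\in\mathfrak g$, and $\iota(v_1\wedge\dots\wedge v_k)=\iota_{v_1}\cdots\iota_{v_k}$. The Duflo map is $\mathrm{sym}\circ\widehat{J^{1/2}}:S\mathfrak g\to U\mathfrak g$. **Derivations.** On $W\mathfrak g$ let $\iota_\xi=1\otimes\iota_\xi$, let $L_\xi$ be the derivation extending the adjoint action, and let $d^W$ be the Weil differential,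 i.e. the odd derivation with $d^W\circ d^W=0$ and $$d^W(1\otimes\xi)=\xi\otimes1+1\otimes\lambda(\xi),\qquad \lambda(\xi)=\tfrac12B(e_a,[\xi,e_b])\,e^a\wedge e^b .$$ On $\mathcal W\mathfrak g$, with $\mathbb Z_2$-graded commutators, let $\iota_\xi=[1\otimes\xi,\cdot\,]$, let $L_\xi$ be the derivation extending the adjoint action, and let $d^{\mathcal W}=[\mathcal D,\cdot\,]$, where $$\mathcal D=e_a\otimes e^a-1\otimes\mathcal C,\qquad \mathcal C=\tfrac16B(e_a,[e_b,e_c])\,e^ae^be^c$$ is the cubic Dirac operator. **Theorem.** The quantization map $$\mathcal Q=(\mathrm{sym}\otimes q)\circ\iota(\widehat{\mathcal S}):W\mathfrak g\to\mathcal W\mathfrak g$$ intertwines the contraction operators $\iota_\xi$ and the Lie derivatives $L_\xi$ ($\xi\in\mathfrak g$), and the differentials: $\mathcal Q\circ d^W=d^{\mathcal W}\circ\mathcal Q$. Moreover $\mathcal Q(p\otimes1)=\mathrm{sym}(\widehat{J^{1/2}}p)\otimes1$ for $p\in S\mathfrak g$, and $\mathcal Q(1\otimes\omega)=1\otimes q(\omega)$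 for $\omega\in\wedge\mathfrak g$. -/

import Mathlib

open scoped TensorProduct

noncomputable section

namespace QuadraticLie

/-! ### Quadratic Lie algebras -/

/-- An invariant, non-degenerate, symmetric bilinear form on a real Lie algebra; a quadratic Lie
algebra is a finite-dimensional Lie algebra together with such a form. -/
structure InvariantForm (g : Type*) [LieRing g] [LieAlgebra ℝ g] where
  form : LinearMap.BilinForm ℝ g
  symm : form.IsSymm
  nondegenerate : form.Nondegenerate
  invariant : ∀ x y z : g, form ⁅x, y⁆ z = form x ⁅y, z⁆

/-! ### Derivations of the symmetric algebra and of Clifford algebras -/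

section SymmetricAlgebra

variable {g : Type*} [AddCommGroup g] [Module ℝ g]

/-- Auxiliary: the algebra homomorphism `S(g) → S(g)[ε]`, `v ↦ v + ε φ(v)`. -/
def symDerivationAux (φ : g →ₗ[ℝ] SymmetricAlgebra ℝ g) : SymmetricAlgebra ℝ g →ₐ[ℝ]
    TrivSqZeroExt (SymmetricAlgebra ℝ g) (SymmetricAlgebra ℝ g) :=
  SymmetricAlgebra.lift
    ((TrivSqZeroExt.inlAlgHom ℝ (SymmetricAlgebra ℝ g) (SymmetricAlgebra ℝ g)).toLinearMap ∘ₗ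
        SymmetricAlgebra.ι ℝ g +
      (TrivSqZeroExt.inrHom (SymmetricAlgebra ℝ g) (SymmetricAlgebra ℝ g)).restrictScalars ℝ ∘ₗ φ)

theorem symDerivationAux_fst (φ : g →ₗ[ℝ] SymmetricAlgebra ℝ g) (p : SymmetricAlgebra ℝ g) :
    (symDerivationAux φ p).fst = p := by
  have h : (TrivSqZeroExt.fstHom ℝ (SymmetricAlgebra ℝ g) (SymmetricAlgebra ℝ g)).comp
      (symDerivationAux φ) = AlgHom.id ℝ _ := by
    apply SymmetricAlgebra.algHom_ext
    ext v
    simp [symDerivationAux]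
  exact DFunLike.congr_fun h p

/-- The unique derivation of `S(g)` with `v ↦ φ v` for `v ∈ g`. -/
def symDerivation (φ : g →ₗ[ℝ] SymmetricAlgebra ℝ g) :
    Derivation ℝ (SymmetricAlgebra ℝ g) (SymmetricAlgebra ℝ g) :=
  Derivation.mk'
    ((TrivSqZeroExt.sndHom (SymmetricAlgebra ℝ g) (SymmetricAlgebra ℝ g)).restrictScalars ℝ ∘ₗ
      (symDerivationAux φ).toLinearMap)
    (by
      intro a b
      simp [symDerivationAux_fst, mul_comm])

@[simp] theorem symDerivation_ι (φ : g →ₗ[ℝ] SymmetricAlgebra ℝ g) (v : g) :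
    symDerivation φ (SymmetricAlgebra.ι ℝ g v) = φ v := by
  simp [symDerivation, symDerivationAux]

theorem symDerivation_ext {D D' : Derivation ℝ (SymmetricAlgebra ℝ g) (SymmetricAlgebra ℝ g)}
    (h : ∀ v, D (SymmetricAlgebra.ι ℝ g v) = D' (SymmetricAlgebra.ι ℝ g v)) : D = D' := by
  ext p
  induction p using SymmetricAlgebra.induction with
  | algebraMap r => simp
  | ι v => exact h v
  | mul a b ha hb => simp [ha, hb]
  | add a b ha hb => simp [ha, hb]

end SymmetricAlgebra

section CliffordAlgebra

variable {g : Type*} [AddCommGroup g] [Module ℝ g] (q : QuadraticForm ℝ g)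

/-- Auxiliary: the algebra homomorphism `Cl → Cl[ε]`, `v ↦ v + ε A(v)`. -/
def cliffordDerivationAux (A : g →ₗ[ℝ] g) (hA : ∀ v, QuadraticMap.polar q v (A v) = 0) :
    CliffordAlgebra q →ₐ[ℝ] TrivSqZeroExt (CliffordAlgebra q) (CliffordAlgebra q) :=
  CliffordAlgebra.lift q
    ⟨(TrivSqZeroExt.inlAlgHom ℝ (CliffordAlgebra q) (CliffordAlgebra q)).toLinearMap ∘ₗ
        CliffordAlgebra.ι q +
      (TrivSqZeroExt.inrHom (CliffordAlgebra q) (CliffordAlgebra q)).restrictScalars ℝ ∘ₗ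
        CliffordAlgebra.ι q ∘ₗ A, by
      intro v
      have h := CliffordAlgebra.ι_mul_ι_add_swap (Q := q) v (A v)
      rw [hA, map_zero] at h
      ext
      · simp [TrivSqZeroExt.algebraMap_eq_inl']
      · simpa [TrivSqZeroExt.algebraMap_eq_inl'] using h⟩

theorem cliffordDerivationAux_fst (A : g →ₗ[ℝ] g)
    (hA : ∀ v, QuadraticMap.polar q v (A v) = 0) (x : CliffordAlgebra q) :
    (cliffordDerivationAux q A hA x).fst = x := by
  have h : (TrivSqZeroExt.fstHom ℝ (CliffordAlgebra q) (CliffordAlgebra q)).comp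
      (cliffordDerivationAux q A hA) = AlgHom.id ℝ _ := by
    apply CliffordAlgebra.hom_ext
    ext v
    simp [cliffordDerivationAux]
  exact DFunLike.congr_fun h x

/-- The unique (even) derivation of the Clifford algebra of `q` that extends an endomorphism `A` of
the underlying space which is skew for `q`. For `q = 0` this is the derivation of the exterior
algebra that extends `A`. -/
def cliffordDerivation (A : g →ₗ[ℝ] g) (hA : ∀ v, QuadraticMap.polar q v (A v) = 0) :
    CliffordAlgebra q →ₗ[ℝ] CliffordAlgebra q :=
  (TrivSqZeroExt.sndHom (CliffordAlgebra q) (CliffordAlgebra q)).restrictScalars ℝ ∘ₗ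
    (cliffordDerivationAux q A hA).toLinearMap

@[simp] theorem cliffordDerivation_ι (A : g →ₗ[ℝ] g)
    (hA : ∀ v, QuadraticMap.polar q v (A v) = 0) (v : g) :
    cliffordDerivation q A hA (CliffordAlgebra.ι q v) = CliffordAlgebra.ι q (A v) := by
  simp [cliffordDerivation, cliffordDerivationAux]

theorem cliffordDerivation_mul (A : g →ₗ[ℝ] g)
    (hA : ∀ v, QuadraticMap.polar q v (A v) = 0) (x y : CliffordAlgebra q) :
    cliffordDerivation q A hA (x * y) =
      cliffordDerivation q A hA x * y + x * cliffordDerivation q A hA y := by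
  simp [cliffordDerivation, cliffordDerivationAux_fst, add_comm]

end CliffordAlgebra

/-! ### The symmetrization map -/

section Symmetrization

variable (g : Type*) [LieRing g] [LieAlgebra ℝ g]

/-- The canonical linear map `g → U(g)`. -/
def envelopingι : g →ₗ[ℝ] UniversalEnvelopingAlgebra ℝ g :=
  (UniversalEnvelopingAlgebra.mkAlgHom ℝ g).toLinearMap ∘ₗ TensorAlgebra.ι ℝ

/-- The multilinear map `(v₁, …, vₖ) ↦ (1/k!) ∑_σ v_{σ 1} ⋯ v_{σ k}` with values in `U(g)`. -/
def symMultilinear (k : ℕ) :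
    MultilinearMap ℝ (fun _ : Fin k => g) (UniversalEnvelopingAlgebra ℝ g) :=
  ((k.factorial : ℝ)⁻¹) • ∑ σ : Equiv.Perm (Fin k),
    ((MultilinearMap.mkPiAlgebraFin ℝ k (UniversalEnvelopingAlgebra ℝ g)).compLinearMap
      fun _ => envelopingι g).domDomCongr σ

theorem symMultilinear_comp_perm (k : ℕ) (v : Fin k → g) (τ : Equiv.Perm (Fin k)) :
    symMultilinear g k (v ∘ τ) = symMultilinear g k v := by
  simp only [symMultilinear, smul_apply, sum_apply,
    MultilinearMap.domDomCongr_apply]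
  congr 1
  exact Fintype.sum_equiv (Equiv.mulLeft τ) _ _ (fun σ => rfl)

/-- Existence of the symmetrization map. -/
theorem exists_sym : ∃ s : SymmetricAlgebra ℝ g →ₗ[ℝ] UniversalEnvelopingAlgebra ℝ g,
    ∀ (k : ℕ) (v : Fin k → g), s (∏ i, SymmetricAlgebra.ι ℝ g (v i)) = symMultilinear g k v := by
  classical
  let b := Module.Free.chooseBasis ℝ g
  let F : (Module.Free.ChooseBasisIndex ℝ g →₀ ℕ) → UniversalEnvelopingAlgebra ℝ g := fun m =>
    symMultilinear g _ (fun i => b (m.toMultiset.toList.get i))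
  have key : ∀ (k : ℕ) (c : Fin k → Module.Free.ChooseBasisIndex ℝ g),
      F (∑ i, Finsupp.single (c i) 1) = symMultilinear g k (fun i => b (c i)) := by
    intro k c
    have hl : ∀ l : List (Module.Free.ChooseBasisIndex ℝ g), l.Perm (List.ofFn c) →
        symMultilinear g l.length (fun i => b (l.get i)) =
          symMultilinear g k (fun i => b (c i)) := by
      intro l hl
      have hlen : l.length = k := by simpa using hl.length_eq
      subst hlen
      have hcard : ∀ a, Nonempty ({i // c i = a} ≃ {i // l.get i = a}) := by
        intro a
        refine Fintype.card_eq.mp ?_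
        have h1 := hl.count_eq a
        have h2 : ∀ (n : ℕ) (d : Fin n → Module.Free.ChooseBasisIndex ℝ g),
            (List.ofFn d).count a = Fintype.card {i // d i = a} := by
          intro n d
          rw [Fintype.card_subtype, ← Multiset.coe_count, List.ofFn_eq_map, ← Multiset.map_coe,
            Multiset.count_map]
          simp only [Finset.card_def, Finset.filter_val]
          congr 1
          simp only [eq_comm]
          rfl
        rw [← h2, ← h2, ← h1]
        congr 1
        exact (List.ofFn_get l).symm
      let e := Equiv.ofFiberEquiv (fun a => (hcard a).some)
      have he : ∀ i, l.get (e i) = c i := fun i => Equiv.ofFiberEquiv_map _ i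
      rw [← symMultilinear_comp_perm g _ _ e]
      congr 1
      funext i
      simp only [Function.comp_apply, he]
    refine hl _ ?_
    rw [← Multiset.coe_eq_coe, Multiset.coe_toList, map_sum]
    simp only [Finsupp.toMultiset_single, one_smul]
    rw [List.ofFn_eq_map, ← Multiset.map_coe, Finset.sum_eq_multiset_sum]
    change (Multiset.map ((fun a => ({a} : Multiset (Module.Free.ChooseBasisIndex ℝ g))) ∘ c) _).sum = _
    rw [← Multiset.map_map, Multiset.sum_map_singleton]
    rfl
  let s : SymmetricAlgebra ℝ g →ₗ[ℝ] UniversalEnvelopingAlgebra ℝ g :=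
    b.symmetricAlgebra.constr ℝ F
  refine ⟨s, fun k v => ?_⟩
  have h : s.compMultilinearMap ((MultilinearMap.mkPiAlgebra ℝ (Fin k)
      (SymmetricAlgebra ℝ g)).compLinearMap fun _ => SymmetricAlgebra.ι ℝ g) =
      symMultilinear g k := by
    refine Module.Basis.ext_multilinear (fun _ => b) fun c => ?_
    rw [← key]
    have : ∏ i, SymmetricAlgebra.ι ℝ g (b (c i)) =
        b.symmetricAlgebra (∑ i, Finsupp.single (c i) 1) := by
      simp only [Module.Basis.symmetricAlgebra, Module.Basis.map_apply,
        MvPolynomial.coe_basisMonomials, MvPolynomial.monomial_sum_one, AlgEquiv.toLinearEquiv_apply,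
        map_prod]
      refine Finset.prod_congr rfl fun i _ => ?_
      exact (SymmetricAlgebra.equivMvPolynomial_symm_X b (c i)).symm
    simp [this, s]
  exact DFunLike.congr_fun h v

/-- The symmetrization map `sym : S(g) → U(g)`,
`v₁ ⋯ vₖ ↦ (1/k!) ∑_σ v_{σ 1} ⋯ v_{σ k}` (see `sym_prod`). -/
def sym : SymmetricAlgebra ℝ g →ₗ[ℝ] UniversalEnvelopingAlgebra ℝ g :=
  (exists_sym g).choose

theorem sym_prod (k : ℕ) (v : Fin k → g) :
    sym g (∏ i, SymmetricAlgebra.ι ℝ g (v i)) = symMultilinear g k v :=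
  (exists_sym g).choose_spec k v

end Symmetrization

/-! ### Infinite order constant coefficient differential operators on `S(g)` -/

section DifferentialOperators

variable {g : Type*} [AddCommGroup g] [Module ℝ g] {κ : Type*} (e : Module.Basis κ ℝ g)

/-- The partial derivative `∂/∂μ_a` on `S(g)`, regarded as the polynomial functions on the dual
space of `g` with coordinates `μ_a = ⟨μ, e_a⟩`: the derivation with `e_b ↦ δ_{ab}`. -/
def symPartial (a : κ) : Derivation ℝ (SymmetricAlgebra ℝ g) (SymmetricAlgebra ℝ g) :=
  symDerivation (Algebra.linearMap ℝ (SymmetricAlgebra ℝ g) ∘ₗ e.coord a)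

theorem symPartial_commute (a b : κ) :
    Commute ((symPartial e a : SymmetricAlgebra ℝ g →ₗ[ℝ] SymmetricAlgebra ℝ g) :
        Module.End ℝ (SymmetricAlgebra ℝ g))
      (symPartial e b : SymmetricAlgebra ℝ g →ₗ[ℝ] SymmetricAlgebra ℝ g) := by
  have h : ⁅symPartial e a, symPartial e b⁆ = 0 := by
    apply symDerivation_ext
    intro v
    simp [Derivation.commutator_apply, symPartial]
  rw [commute_iff_lie_eq]
  ext p
  have := DFunLike.congr_fun h p
  rw [Derivation.commutator_apply] at this
  simpa [Ring.lie_def] using this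

/-- Auxiliary: `p` is annihilated by all products of `n` partial derivatives. -/
def SymDegreeLT : ℕ → SymmetricAlgebra ℝ g → Prop
  | 0, p => p = 0
  | n + 1, p => ∀ a, SymDegreeLT n (symPartial e a p)

theorem SymDegreeLT.zero (n : ℕ) : SymDegreeLT e n 0 := by
  induction n with
  | zero => rfl
  | succ n ih => intro a; simpa using ih

theorem SymDegreeLT.add {n : ℕ} : ∀ {p q : SymmetricAlgebra ℝ g},
    SymDegreeLT e n p → SymDegreeLT e n q → SymDegreeLT e n (p + q) := by
  induction n with
  | zero => intro p q hp hq; simp_all [SymDegreeLT]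
  | succ n ih => intro p q hp hq a; rw [map_add]; exact ih (hp a) (hq a)

theorem SymDegreeLT.succ {n : ℕ} : ∀ {p : SymmetricAlgebra ℝ g},
    SymDegreeLT e n p → SymDegreeLT e (n + 1) p := by
  induction n with
  | zero => intro p hp a; simp_all [SymDegreeLT]
  | succ n ih => intro p hp a; exact ih (hp a)

theorem SymDegreeLT.mono {n k : ℕ} (h : n ≤ k) {p : SymmetricAlgebra ℝ g}
    (hp : SymDegreeLT e n p) : SymDegreeLT e k p := by
  induction h with
  | refl => exact hp
  | step _ ih => exact ih.succ

theorem SymDegreeLT.mul (N : ℕ) : ∀ {n k : ℕ}, n + k = N → ∀ {p q : SymmetricAlgebra ℝ g},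
    SymDegreeLT e n p → SymDegreeLT e k q → SymDegreeLT e N (p * q) := by
  induction N with
  | zero =>
    intro n k h p q hp hq
    obtain rfl : n = 0 := by omega
    simp_all [SymDegreeLT]
  | succ N ih =>
    intro n k h p q hp hq a
    rw [Derivation.leibniz, smul_eq_mul, smul_eq_mul]
    refine SymDegreeLT.add e ?_ ?_
    · cases k with
      | zero =>
        obtain rfl : q = 0 := hq
        simpa using SymDegreeLT.zero e N
      | succ k => exact ih (by omega) hp (hq a)
    · cases n with
      | zero =>
        obtain rfl : p = 0 := hp
        simpa using SymDegreeLT.zero e N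
      | succ n => exact ih (by omega) hq (hp a)

theorem exists_symDegreeLT (p : SymmetricAlgebra ℝ g) : ∃ n, SymDegreeLT e n p := by
  induction p using SymmetricAlgebra.induction with
  | algebraMap r => exact ⟨1, fun a => by simp [SymDegreeLT]⟩
  | ι v => exact ⟨2, fun a b => by simp [SymDegreeLT, symPartial]⟩
  | mul p q hp hq =>
    obtain ⟨n, hn⟩ := hp
    obtain ⟨k, hk⟩ := hq
    exact ⟨n + k, SymDegreeLT.mul e _ rfl hn hk⟩
  | add p q hp hq =>
    obtain ⟨n, hn⟩ := hp
    obtain ⟨k, hk⟩ := hq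
    exact ⟨max n k, (hn.mono e (le_max_left _ _)).add e (hk.mono e (le_max_right _ _))⟩

theorem SymDegreeLT.partial_pow {n : ℕ} (a : κ) (k : ℕ) {p : SymmetricAlgebra ℝ g}
    (hp : SymDegreeLT e n p) :
    SymDegreeLT e (n - k) ((((symPartial e a : SymmetricAlgebra ℝ g →ₗ[ℝ] SymmetricAlgebra ℝ g) :
      Module.End ℝ (SymmetricAlgebra ℝ g)) ^ k) p) := by
  induction k with
  | zero => simpa using hp
  | succ k ih =>
    rw [pow_succ', Module.End.mul_apply]
    obtain h | ⟨j, hj⟩ : n - k = 0 ∨ ∃ j, n - k = j + 1 := by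
      cases h : n - k with
      | zero => exact Or.inl rfl
      | succ j => exact Or.inr ⟨j, rfl⟩
    · rw [h] at ih
      rw [show (_ : SymmetricAlgebra ℝ g) = 0 from ih, map_zero]
      exact SymDegreeLT.zero e _
    · rw [hj] at ih
      rw [show n - (k + 1) = j by omega]
      exact ih a

theorem symPartial_pow_pairwise (m : κ →₀ ℕ) (s : Set κ) :
    s.Pairwise (Function.onFun Commute fun a =>
      ((symPartial e a : SymmetricAlgebra ℝ g →ₗ[ℝ] SymmetricAlgebra ℝ g) :
        Module.End ℝ (SymmetricAlgebra ℝ g)) ^ m a) :=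
  fun a _ b _ _ => (symPartial_commute e a b).pow_pow _ _

variable [Fintype κ]

/-- The iterated partial derivative `∂^m = ∏_a (∂/∂μ_a)^{m_a}` on `S(g)`. -/
def symPartialPow (m : κ →₀ ℕ) : Module.End ℝ (SymmetricAlgebra ℝ g) :=
  Finset.univ.noncommProd
    (fun a => ((symPartial e a : SymmetricAlgebra ℝ g →ₗ[ℝ] SymmetricAlgebra ℝ g) :
      Module.End ℝ (SymmetricAlgebra ℝ g)) ^ m a)
    (symPartial_pow_pairwise e m _)

theorem symPartialPow_apply_eq_zero {n : ℕ} {p : SymmetricAlgebra ℝ g} (hp : SymDegreeLT e n p)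
    (m : κ →₀ ℕ) (hm : n ≤ m.degree) : symPartialPow e m p = 0 := by
  have h : ∀ s : Finset κ, SymDegreeLT e (n - ∑ a ∈ s, m a) ((s.noncommProd
      (fun a => ((symPartial e a : SymmetricAlgebra ℝ g →ₗ[ℝ] SymmetricAlgebra ℝ g) :
        Module.End ℝ (SymmetricAlgebra ℝ g)) ^ m a)
      (symPartial_pow_pairwise e m _)) p) := by
    classical
    intro s
    induction s using Finset.induction_on with
    | empty => rw [Finset.noncommProd_empty]; simpa using hp
    | insert a s ha ih =>
      rw [Finset.noncommProd_insert_of_notMem _ _ _ _ ha, Module.End.mul_apply,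
        Finset.sum_insert ha, add_comm, ← Nat.sub_sub]
      exact ih.partial_pow e a _
  have h' := h Finset.univ
  rw [← Finsupp.degree_eq_sum, Nat.sub_eq_zero_of_le hm] at h'
  exact h'

theorem finite_symPartialPow_ne_zero (p : SymmetricAlgebra ℝ g) :
    {m : κ →₀ ℕ | symPartialPow e m p ≠ 0}.Finite := by
  obtain ⟨n, hn⟩ := exists_symDegreeLT e p
  refine (Finsupp.finite_of_degree_lt n).subset fun m hm => ?_
  by_contra hlt
  exact hm (symPartialPow_apply_eq_zero e hn m (not_lt.mp hlt))

/-- The infinite order differential operator `p ↦ ∑_m T_m (∂^m p)` on `S(g)`, with coefficients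
linear maps `T_m : S(g) → N`. Only finitely many terms are non-zero for each `p`. -/
def symDiffOp {N : Type*} [AddCommMonoid N] [Module ℝ N]
    (T : (κ →₀ ℕ) → SymmetricAlgebra ℝ g →ₗ[ℝ] N) : SymmetricAlgebra ℝ g →ₗ[ℝ] N where
  toFun p := ∑ᶠ m, T m (symPartialPow e m p)
  map_add' p q := by
    rw [← finsum_add_distrib]
    · simp
    · refine (finite_symPartialPow_ne_zero e p).subset fun m hm h => hm ?_
      simp [h]
    · refine (finite_symPartialPow_ne_zero e q).subset fun m hm h => hm ?_
      simp [h]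
  map_smul' r p := by
    rw [RingHom.id_apply, smul_finsum']
    · simp
    · refine (finite_symPartialPow_ne_zero e p).subset fun m hm h => hm ?_
      simp [h]

end DifferentialOperators

/-! ### Formal power series -/

section PowerSeries

/-- `φ(Y) = ∑_n φ_n Y^n` for a power series `φ` in one variable and a formal power series `Y`
without constant term, with coefficients in a (possibly non-commutative) algebra. As `Y` has no
constant term, `Y^n` has no coefficients in degrees below `n`, so that the coefficient of
`φ(Y)` at `m` is the finite sum over `n ≤ |m|`. -/
def formalEval {κ A : Type*} [Ring A] [Algebra ℝ A] (φ : PowerSeries ℝ) (Y : MvPowerSeries κ A) :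
    MvPowerSeries κ A :=
  fun m => ∑ n ∈ Finset.range (m.degree + 1), PowerSeries.coeff n φ • MvPowerSeries.coeff m (Y ^ n)

/-- The Taylor series of `j(z) = sinh(z/2)/(z/2)`, that is `∑_k z^{2k} / (4^k (2k+1)!)`. -/
def jSeries : PowerSeries ℝ :=
  PowerSeries.mk fun n => if Even n then ((2 : ℝ) ^ n * (n + 1).factorial)⁻¹ else 0

theorem hasSum_jSeries (z : ℝ) (hz : z ≠ 0) :
    HasSum (fun n => PowerSeries.coeff n jSeries * z ^ n) (Real.sinh (z / 2) / (z / 2)) := by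
  have hinj : Function.Injective fun k : ℕ => 2 * k := fun a b h => by simpa using h
  rw [← hinj.hasSum_iff]
  · have key : (fun n => PowerSeries.coeff n jSeries * z ^ n) ∘ (fun k : ℕ => 2 * k) =
        fun k => (z / 2) ^ (2 * k + 1) / ((2 * k + 1).factorial : ℝ) / (z / 2) := by
      funext k
      simp only [Function.comp_apply, jSeries, PowerSeries.coeff_mk, even_two_mul, if_true]
      have : ((2 * k + 1).factorial : ℝ) ≠ 0 := by positivity
      rw [pow_succ, div_pow]
      field_simp
    rw [key]
    exact (Real.hasSum_sinh (z / 2)).div_const (z / 2)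
  · intro n hn
    have : ¬ Even n := fun ⟨k, hk⟩ => hn ⟨k, by simp only; omega⟩
    simp [jSeries, this]

/-- The Taylor series of `f = (log j)' = j'/j`, that is of `(1/2) coth(z/2) - 1/z`. -/
def fSeries : PowerSeries ℝ :=
  PowerSeries.derivative ℝ jSeries * jSeries⁻¹

/-- The Taylor series of `z ↦ (1 + z)^{1/2}`. -/
def sqrtSeries : PowerSeries ℝ :=
  PowerSeries.binomialSeries ℝ (1 / 2 : ℝ)

end PowerSeries

section Duflo

variable {g : Type*} [LieRing g] [LieAlgebra ℝ g] {κ : Type*} [Fintype κ] [DecidableEq κ]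
  (e : Module.Basis κ ℝ g)

/-! In the following, elements of `MvPowerSeries κ A` are Taylor series at `0` of functions on `g`
with values in `A`; the variable with index `a` is the coordinate `ξ^a` of `ξ = ∑_a ξ^a e_a`. -/

/-- The function `ξ ↦ ad_ξ` on `g`, with values in the endomorphisms of `g`. -/
def adSeries : MvPowerSeries κ (Module.End ℝ g) :=
  ∑ a, MvPowerSeries.monomial (Finsupp.single a 1) (LieAlgebra.ad ℝ g (e a))

/-- The Taylor series of `J(ξ) = det(j(ad_ξ))`. -/
def JSeries : MvPowerSeries κ ℝ :=
  Matrix.det (Matrix.of fun a b : κ => (fun m =>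
    LinearMap.toMatrix e e (MvPowerSeries.coeff m (formalEval jSeries (adSeries e))) a b :
      MvPowerSeries κ ℝ))

/-- The Taylor series of `J^{1/2}`, the square root of `J` near `0` with value `1` at `0`. -/
def sqrtJSeries : MvPowerSeries κ ℝ :=
  formalEval sqrtSeries (JSeries e - 1)

/-- The infinite order differential operator on `S(g)` obtained from `J^{1/2}` by replacing `ξ` by
`∂/∂μ`. -/
def sqrtJHat : SymmetricAlgebra ℝ g →ₗ[ℝ] SymmetricAlgebra ℝ g :=
  symDiffOp e fun m => MvPowerSeries.coeff m (sqrtJSeries e) • LinearMap.id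

/-- The Duflo map. -/
def duflo : SymmetricAlgebra ℝ g →ₗ[ℝ] UniversalEnvelopingAlgebra ℝ g :=
  sym g ∘ₗ sqrtJHat e

end Duflo

/-! ### The Weil algebra -/

section Weil

variable (g : Type*) [LieRing g] [LieAlgebra ℝ g]

/-- The Weil algebra `Wg = Sg ⊗ ∧g`. -/
abbrev WeilAlgebra : Type _ := SymmetricAlgebra ℝ g ⊗[ℝ] ExteriorAlgebra ℝ g

variable {g}

/-- The Lie derivative on `S(g)`: the derivation extending `ad_ξ`. -/
def symLie (ξ : g) : SymmetricAlgebra ℝ g →ₗ[ℝ] SymmetricAlgebra ℝ g :=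
  symDerivation (SymmetricAlgebra.ι ℝ g ∘ₗ (LieAlgebra.ad ℝ g ξ : g →ₗ[ℝ] g))

/-- The Lie derivative on `∧g`: the derivation extending `ad_ξ`. -/
def extLie (ξ : g) : ExteriorAlgebra ℝ g →ₗ[ℝ] ExteriorAlgebra ℝ g :=
  cliffordDerivation 0 (LieAlgebra.ad ℝ g ξ : g →ₗ[ℝ] g) (by simp [QuadraticMap.polar])

/-- The Lie derivatives `L_ξ` on `Wg`. -/
def weilLie (ξ : g) : WeilAlgebra g →ₗ[ℝ] WeilAlgebra g :=
  TensorProduct.map (symLie ξ) LinearMap.id + TensorProduct.map LinearMap.id (extLie ξ)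

variable (B : InvariantForm g)

/-- The contraction operators on `∧g`: `ι_ξ` is the antiderivation with `ι_ξ η = B(ξ, η)`. -/
def extContr : g →ₗ[ℝ] Module.End ℝ (ExteriorAlgebra ℝ g) :=
  CliffordAlgebra.contractLeft ∘ₗ B.form

/-- The extension of the contraction operators to an algebra homomorphism `∧g → End(∧g)`. -/
def extContrHom : ExteriorAlgebra ℝ g →ₐ[ℝ] Module.End ℝ (ExteriorAlgebra ℝ g) :=
  ExteriorAlgebra.lift ℝ ⟨extContr B, fun ξ =>
    LinearMap.ext fun x => CliffordAlgebra.contractLeft_contractLeft (B.form ξ) x⟩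

/-- The contraction operators `ι_ξ = 1 ⊗ ι_ξ` on `Wg`. -/
def weilContr (ξ : g) : WeilAlgebra g →ₗ[ℝ] WeilAlgebra g :=
  TensorProduct.map LinearMap.id (extContr B ξ)

variable {κ : Type*} [Fintype κ] [DecidableEq κ] (e : Module.Basis κ ℝ g)

/-- The basis `e^a` with `B(e^a, e_b) = δ_{ab}`. -/
abbrev InvariantForm.dual : Module.Basis κ ℝ g := B.form.dualBasis B.nondegenerate e

/-- The map `λ : g → ∧²g` dual to the Lie bracket,
`λ(ξ) = (1/2) ∑_{a,b} B(e_a, [ξ, e_b]) e^a ∧ e^b`. -/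
def lambdaMap (ξ : g) : ExteriorAlgebra ℝ g :=
  (1 / 2 : ℝ) • ∑ a, ∑ b, B.form (e a) ⁅ξ, e b⁆ •
    (ExteriorAlgebra.ι ℝ (B.dual e a) * ExteriorAlgebra.ι ℝ (B.dual e b))

/-- The Lie algebra differential on `∧g ≅ ∧g^*`, `d = (1/2) ∑_a e^a ∧ L_{e_a}`. -/
def extDiff : ExteriorAlgebra ℝ g →ₗ[ℝ] ExteriorAlgebra ℝ g :=
  (1 / 2 : ℝ) • ∑ a, LinearMap.mulLeft ℝ (ExteriorAlgebra.ι ℝ (B.dual e a)) ∘ₗ extLie (e a)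

/-- The Weil differential on `Wg = Sg ⊗ ∧g`,
`d = ∑_a L_{e_a} ⊗ e^a + ∑_a e_a ⊗ ι_{e^a} + 1 ⊗ d_∧`. It is the derivation of degree one and
square zero with `d(1 ⊗ ξ) = ξ ⊗ 1 + 1 ⊗ λ(ξ)`; see `weilDiff_mul`, `weilDiff_weilDiff` and
`weilDiff_one_tmul_ι`. -/
def weilDiff : WeilAlgebra g →ₗ[ℝ] WeilAlgebra g :=
  ∑ a, TensorProduct.map (symLie (e a))
      (LinearMap.mulLeft ℝ (ExteriorAlgebra.ι ℝ (B.dual e a))) +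
    ∑ a, TensorProduct.map (LinearMap.mulLeft ℝ (SymmetricAlgebra.ι ℝ g (e a)))
      (extContr B (B.dual e a)) +
    TensorProduct.map LinearMap.id (extDiff B e)

theorem extContr_mul (ξ : g) (x y : ExteriorAlgebra ℝ g) :
    extContr B ξ (x * y) = extContr B ξ x * y + CliffordAlgebra.involute x * extContr B ξ y := by
  change CliffordAlgebra.contractLeft (B.form ξ) (x * y) =
    CliffordAlgebra.contractLeft (B.form ξ) x * y +
      CliffordAlgebra.involute x * CliffordAlgebra.contractLeft (B.form ξ) y
  induction x using CliffordAlgebra.induction generalizing y with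
  | algebraMap r => simp [CliffordAlgebra.contractLeft_algebraMap_mul]
  | ι v =>
    rw [CliffordAlgebra.contractLeft_ι_mul, CliffordAlgebra.contractLeft_ι,
      CliffordAlgebra.involute_ι, Algebra.smul_def, neg_mul, sub_eq_add_neg]
  | mul a b ha hb => rw [mul_assoc, ha, hb, ha b, map_mul]; simp only [mul_add, add_mul, mul_assoc, add_assoc]
  | add a b ha hb => simp only [add_mul, map_add, ha, hb]; abel

theorem extι_mul (v : g) (x : ExteriorAlgebra ℝ g) :
    ExteriorAlgebra.ι ℝ v * x = CliffordAlgebra.involute x * ExteriorAlgebra.ι ℝ v := by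
  induction x using CliffordAlgebra.induction with
  | algebraMap r => simpa using (Algebra.commutes r _).symm
  | ι w =>
    rw [CliffordAlgebra.involute_ι, neg_mul]
    exact eq_neg_of_add_eq_zero_left (ExteriorAlgebra.ι_add_mul_swap v w)
  | mul a b ha hb => rw [← mul_assoc, ha, mul_assoc, hb, map_mul, mul_assoc]
  | add a b ha hb => rw [mul_add, ha, hb, map_add, add_mul]

theorem extDiff_mul (x y : ExteriorAlgebra ℝ g) :
    extDiff B e (x * y) = extDiff B e x * y + CliffordAlgebra.involute x * extDiff B e y := by
  have h : ∀ ξ : g, extLie ξ (x * y) = extLie ξ x * y + x * extLie ξ y := fun ξ =>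
    cliffordDerivation_mul 0 _ _ x y
  have h2 : ∀ (ξ : g) (z : ExteriorAlgebra ℝ g), ExteriorAlgebra.ι ℝ ξ * (x * z) =
      CliffordAlgebra.involute x * (ExteriorAlgebra.ι ℝ ξ * z) := fun ξ z => by
    rw [← mul_assoc, extι_mul, mul_assoc]
  simp only [extDiff, LinearMap.smul_apply, LinearMap.sum_apply, LinearMap.comp_apply,
    LinearMap.mulLeft_apply, h, mul_add, h2, Finset.sum_add_distrib, smul_add, smul_mul_assoc,
    mul_smul_comm, Finset.sum_mul, Finset.mul_sum, mul_assoc]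

/-- The parity automorphism of `Wg`. -/
def weilParity (g : Type*) [LieRing g] [LieAlgebra ℝ g] : WeilAlgebra g →ₐ[ℝ] WeilAlgebra g :=
  Algebra.TensorProduct.map (AlgHom.id ℝ _) CliffordAlgebra.involute

theorem weilDiff_mul (x y : WeilAlgebra g) :
    weilDiff B e (x * y) = weilDiff B e x * y + weilParity g x * weilDiff B e y := by
  induction x using TensorProduct.induction_on with
  | zero => simp
  | add a b ha hb => simp only [add_mul, map_add, ha, hb]; abel
  | tmul p ω =>
  induction y using TensorProduct.induction_on with
  | zero => simp
  | add a b ha hb => simp only [mul_add, map_add, ha, hb]; abel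
  | tmul r η =>
  have hS : ∀ ξ : g, symLie ξ (p * r) = symLie ξ p * r + p * symLie ξ r := fun ξ => by
    simp [symLie, mul_comm, add_comm]
  have h2 : ∀ (ξ : g) (z : ExteriorAlgebra ℝ g), ExteriorAlgebra.ι ℝ ξ * (ω * z) =
      CliffordAlgebra.involute ω * (ExteriorAlgebra.ι ℝ ξ * z) := fun ξ z => by
    rw [← mul_assoc, extι_mul, mul_assoc]
  simp only [weilDiff, weilParity, LinearMap.add_apply, LinearMap.sum_apply, TensorProduct.map_tmul,
    Algebra.TensorProduct.tmul_mul_tmul, Algebra.TensorProduct.map_tmul, LinearMap.mulLeft_apply,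
    LinearMap.id_apply, AlgHom.id_apply, hS, extContr_mul, extDiff_mul, TensorProduct.add_tmul,
    TensorProduct.tmul_add, Finset.sum_add_distrib, add_mul, mul_add, Finset.sum_mul,
    Finset.mul_sum]
  have e1 : ∀ a, (p * symLie (e a) r) ⊗ₜ[ℝ] (ExteriorAlgebra.ι ℝ (B.dual e a) * (ω * η)) =
     (p * symLie (e a) r) ⊗ₜ[ℝ] (CliffordAlgebra.involute ω * (ExteriorAlgebra.ι ℝ (B.dual e a) * η)) := fun a => by rw [h2]
  simp only [e1, mul_assoc, mul_left_comm p]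
  abel

theorem extContr_one (ξ : g) : extContr B ξ 1 = 0 := 
  CliffordAlgebra.contractLeft_one (Q := (0 : QuadraticForm ℝ g)) (B.form ξ)

theorem extContr_ι (ξ η : g) :
    extContr B ξ (ExteriorAlgebra.ι ℝ η) = algebraMap ℝ _ (B.form ξ η) :=
  CliffordAlgebra.contractLeft_ι (Q := (0 : QuadraticForm ℝ g)) (B.form ξ) η

theorem sum_form_smul_dual (ξ : g) : ∑ a, B.form (e a) ξ • B.dual e a = ξ := by
  conv_rhs => rw [← (B.dual e).sum_repr ξ]
  refine Finset.sum_congr rfl fun a _ => ?_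
  rw [LinearMap.BilinForm.dualBasis_repr_apply]
  exact congrArg (· • _) (B.symm.eq _ _)

theorem sum_form_dual_smul (ξ : g) : ∑ a, B.form (B.dual e a) ξ • e a = ξ := by
  conv_rhs => rw [← e.sum_repr ξ]
  refine Finset.sum_congr rfl fun a _ => ?_
  congr 1
  conv_lhs => rw [← e.sum_repr ξ]
  simp only [map_sum, map_smul, LinearMap.BilinForm.apply_dualBasis_left]
  simp

theorem sum_dual_comm {M : Type*} [AddCommGroup M] [Module ℝ M] (f : g →ₗ[ℝ] g →ₗ[ℝ] M) :
    ∑ a, f (B.dual e a) (e a) = ∑ a, f (e a) (B.dual e a) := by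
  have h1 : ∀ a, f (e a) (B.dual e a) =
      ∑ b, B.form (e b) (e a) • f (B.dual e b) (B.dual e a) := fun a => by
    conv_lhs => rw [← sum_form_smul_dual B e (e a)]
    simp
  have h2 : ∀ a, f (B.dual e a) (e a) =
      ∑ b, B.form (e b) (e a) • f (B.dual e a) (B.dual e b) := fun a => by
    conv_lhs => rw [← sum_form_smul_dual B e (e a)]
    simp
  simp only [h1, h2]
  rw [Finset.sum_comm]
  refine Finset.sum_congr rfl fun a _ => Finset.sum_congr rfl fun b _ => ?_
  exact congrArg (· • _) (B.symm.eq _ _)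

theorem sum_dual_lie {M : Type*} [AddCommGroup M] [Module ℝ M] (f : g →ₗ[ℝ] g →ₗ[ℝ] M) (ξ : g) :
    ∑ a, f (B.dual e a) ⁅ξ, e a⁆ = - ∑ a, f ⁅ξ, B.dual e a⁆ (e a) := by
  have h1 : ∀ a, f (B.dual e a) ⁅ξ, e a⁆ =
      ∑ b, B.form (B.dual e b) ⁅ξ, e a⁆ • f (B.dual e a) (e b) := fun a => by
    conv_lhs => rw [← sum_form_dual_smul B e ⁅ξ, e a⁆]
    simp
  have h2 : ∀ a, f ⁅ξ, B.dual e a⁆ (e a) =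
      ∑ b, B.form (e b) ⁅ξ, B.dual e a⁆ • f (B.dual e b) (e a) := fun a => by
    conv_lhs => rw [← sum_form_smul_dual B e ⁅ξ, B.dual e a⁆]
    simp
  simp only [h1, h2]
  rw [Finset.sum_comm, ← Finset.sum_neg_distrib]
  refine Finset.sum_congr rfl fun a _ => ?_
  rw [← Finset.sum_neg_distrib]
  refine Finset.sum_congr rfl fun b _ => ?_
  rw [← neg_smul]
  congr 1
  rw [← B.invariant, ← lie_skew, map_neg, LinearMap.neg_apply]
  exact congrArg Neg.neg (B.symm.eq _ _).symm

theorem extLie_ι (x ξ : g) :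
    extLie x (ExteriorAlgebra.ι ℝ ξ) = ExteriorAlgebra.ι ℝ ⁅x, ξ⁆ :=
  cliffordDerivation_ι 0 _ _ ξ

theorem extLie_mul (x : g) (ω η : ExteriorAlgebra ℝ g) :
    extLie x (ω * η) = extLie x ω * η + ω * extLie x η :=
  cliffordDerivation_mul 0 _ _ ω η

theorem extLie_one (x : g) : extLie x (1 : ExteriorAlgebra ℝ g) = 0 := by
  have := extLie_mul x 1 1
  simpa using this

theorem extLie_algebraMap (x : g) (r : ℝ) :
    extLie x (algebraMap ℝ (ExteriorAlgebra ℝ g) r) = 0 := by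
  rw [Algebra.algebraMap_eq_smul_one, map_smul, extLie_one, smul_zero]

theorem extLie_add (x y : g) : extLie (x + y) = extLie x + extLie y := by
  refine LinearMap.ext fun ω => ?_
  rw [LinearMap.add_apply]
  induction ω using ExteriorAlgebra.induction with
  | algebraMap r => simp [extLie_algebraMap]
  | ι v => simp [extLie_ι]
  | mul a b ha hb => simp only [extLie_mul, ha, hb]; noncomm_ring
  | add a b ha hb => simp only [map_add, ha, hb]; abel

theorem extLie_smul (r : ℝ) (x : g) : extLie (r • x) = r • extLie x := by
  refine LinearMap.ext fun ω => ?_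
  rw [LinearMap.smul_apply]
  induction ω using ExteriorAlgebra.induction with
  | algebraMap r => simp [extLie_algebraMap]
  | ι v => simp [extLie_ι]
  | mul a b ha hb => simp [extLie_mul, ha, hb]
  | add a b ha hb => simp only [map_add, ha, hb, smul_add]

theorem extLie_lie (x y : g) (ω : ExteriorAlgebra ℝ g) :
    extLie ⁅x, y⁆ ω = extLie x (extLie y ω) - extLie y (extLie x ω) := by
  induction ω using ExteriorAlgebra.induction with
  | algebraMap r => simp [extLie_algebraMap]
  | ι v => simp only [extLie_ι, ← map_sub, lie_lie]
  | mul a b ha hb => simp only [extLie_mul, map_add, ha, hb]; noncomm_ring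
  | add a b ha hb => simp only [map_add, ha, hb]; abel

theorem extDiff_ι (ξ : g) : extDiff B e (ExteriorAlgebra.ι ℝ ξ) = lambdaMap B e ξ := by
  simp only [extDiff, lambdaMap, LinearMap.smul_apply, LinearMap.sum_apply, LinearMap.comp_apply,
    extLie_ι, LinearMap.mulLeft_apply]
  congr 1
  rw [Finset.sum_comm]
  refine Finset.sum_congr rfl fun b _ => ?_
  have h := congrArg (fun x => ExteriorAlgebra.ι ℝ x * ExteriorAlgebra.ι ℝ (B.dual e b))
    (sum_form_smul_dual B e ⁅ξ, e b⁆)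
  simp only [map_sum, map_smul, Finset.sum_mul, smul_mul_assoc] at h
  rw [h, ← lie_skew, map_neg, mul_neg]
  exact (eq_neg_of_add_eq_zero_left (ExteriorAlgebra.ι_add_mul_swap _ _)).symm

/-- `d(1 ⊗ ξ) = ξ ⊗ 1 + 1 ⊗ λ(ξ)`. -/
theorem weilDiff_one_tmul_ι (ξ : g) : weilDiff B e (1 ⊗ₜ ExteriorAlgebra.ι ℝ ξ) =
    SymmetricAlgebra.ι ℝ g ξ ⊗ₜ 1 + 1 ⊗ₜ lambdaMap B e ξ := by
  have h : ∀ x : g, symLie x 1 = 0 := fun x => by simp [symLie]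
  simp only [weilDiff, LinearMap.add_apply, LinearMap.sum_apply, TensorProduct.map_tmul, h,
    TensorProduct.zero_tmul, Finset.sum_const_zero, zero_add, extContr_ι, extDiff_ι,
    LinearMap.mulLeft_apply, mul_one, LinearMap.id_apply]
  congr 1
  conv_rhs => rw [← sum_form_dual_smul B e ξ]
  simp [Algebra.algebraMap_eq_smul_one, TensorProduct.sum_tmul, TensorProduct.tmul_smul,
    TensorProduct.smul_tmul']

/-- `d(ξ ⊗ 1) = ∑_a [e_a, ξ] ⊗ e^a`. -/
theorem weilDiff_ι_tmul_one (ξ : g) : weilDiff B e (SymmetricAlgebra.ι ℝ g ξ ⊗ₜ 1) =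
    ∑ a, SymmetricAlgebra.ι ℝ g ⁅e a, ξ⁆ ⊗ₜ ExteriorAlgebra.ι ℝ (B.dual e a) := by
  have h : extDiff B e 1 = 0 := by simp [extDiff, extLie_one]
  simp [weilDiff, extContr_one, h, symLie]

theorem extLie_extDiff (ξ : g) (ω : ExteriorAlgebra ℝ g) :
    extLie ξ (extDiff B e ω) = extDiff B e (extLie ξ ω) := by
  have h := sum_dual_lie B e (LinearMap.mk₂ ℝ
    (fun u v : g => ExteriorAlgebra.ι ℝ u * extLie v ω) (by intros; simp [add_mul])
    (by intros; simp) (by intros; simp [extLie_add, mul_add]) (by intros; simp [extLie_smul])) ξ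
  simp only [LinearMap.mk₂_apply, extLie_lie, mul_sub, Finset.sum_sub_distrib] at h
  simp only [extDiff, LinearMap.smul_apply, LinearMap.sum_apply, LinearMap.comp_apply,
    LinearMap.mulLeft_apply, map_smul, map_sum, extLie_mul, extLie_ι, Finset.sum_add_distrib]
  congr 1
  rw [sub_eq_iff_eq_add] at h
  rw [h]
  abel

theorem involute_extDiff_ι (ξ : g) :
    CliffordAlgebra.involute (extDiff B e (ExteriorAlgebra.ι ℝ ξ)) =
      extDiff B e (ExteriorAlgebra.ι ℝ ξ) := by
  have h : ∀ v : g, CliffordAlgebra.involute (ExteriorAlgebra.ι ℝ v) = -ExteriorAlgebra.ι ℝ v :=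
    fun v => CliffordAlgebra.involute_ι v
  simp [extDiff_ι, lambdaMap, h]

theorem extDiff_extDiff_ι (ξ : g) :
    extDiff B e (extDiff B e (ExteriorAlgebra.ι ℝ ξ)) = 0 := by
  have hinv : ∀ v : g, CliffordAlgebra.involute (ExteriorAlgebra.ι ℝ v) = -ExteriorAlgebra.ι ℝ v :=
    fun v => CliffordAlgebra.involute_ι v
  set T := extDiff B e (extDiff B e (ExteriorAlgebra.ι ℝ ξ)) with hT
  have hdef : ∀ ω, extDiff B e ω =
      (1 / 2 : ℝ) • ∑ a, ExteriorAlgebra.ι ℝ (B.dual e a) * extLie (e a) ω := fun ω => by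
    simp [extDiff]
  have h2T : ∑ a, ExteriorAlgebra.ι ℝ (B.dual e a) *
      extDiff B e (ExteriorAlgebra.ι ℝ ⁅e a, ξ⁆) = (2 : ℝ) • T := by
    rw [hT, hdef (extDiff B e _), smul_smul]
    norm_num
    exact Finset.sum_congr rfl fun a _ => by rw [extLie_extDiff, extLie_ι]
  have h1 : T = (1 / 2 : ℝ) • (∑ a, extDiff B e (ExteriorAlgebra.ι ℝ (B.dual e a)) *
      ExteriorAlgebra.ι ℝ ⁅e a, ξ⁆ - (2 : ℝ) • T) := by
    rw [← h2T, ← Finset.sum_sub_distrib, hT, hdef (ExteriorAlgebra.ι ℝ ξ), map_smul, map_sum]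
    congr 1
    refine Finset.sum_congr rfl fun a _ => ?_
    rw [extDiff_mul, extLie_ι, hinv, neg_mul, sub_eq_add_neg]
  have h3 := sum_dual_lie B e (LinearMap.mk₂ ℝ
    (fun u v : g => extDiff B e (ExteriorAlgebra.ι ℝ u) * ExteriorAlgebra.ι ℝ v)
    (by intros; simp [add_mul]) (by intros; simp) (by intros; simp [mul_add])
    (by intros; simp)) ξ
  have h4 := sum_dual_comm B e (LinearMap.mk₂ ℝ
    (fun u v : g => extDiff B e (ExteriorAlgebra.ι ℝ ⁅ξ, u⁆) * ExteriorAlgebra.ι ℝ v)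
    (by intros; simp [add_mul]) (by intros; simp) (by intros; simp [mul_add])
    (by intros; simp))
  simp only [LinearMap.mk₂_apply] at h3 h4
  have h5 : ∑ a, extDiff B e (ExteriorAlgebra.ι ℝ (B.dual e a)) * ExteriorAlgebra.ι ℝ ⁅e a, ξ⁆ =
      -((2 : ℝ) • T) := by
    have h6 : ∀ a, ExteriorAlgebra.ι ℝ ⁅e a, ξ⁆ = -ExteriorAlgebra.ι ℝ ⁅ξ, e a⁆ := fun a => by
      rw [← lie_skew, map_neg]
    rw [← h2T]
    simp only [h6, mul_neg, map_neg, Finset.sum_neg_distrib, h3, h4, neg_neg]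
    refine Finset.sum_congr rfl fun a _ => ?_
    rw [extι_mul, involute_extDiff_ι]
  rw [h5] at h1
  have h7 : (3 : ℝ) • T = 0 := by
    have : T = -((2 : ℝ) • T) := by
      conv_lhs => rw [h1]
      module
    calc (3 : ℝ) • T = T - -((2 : ℝ) • T) := by module
      _ = 0 := by rw [← this, sub_self]
  exact (smul_eq_zero.mp h7).resolve_left (by norm_num)

theorem weilDiff_weilDiff_one_tmul_ι (ξ : g) :
    weilDiff B e (weilDiff B e (1 ⊗ₜ ExteriorAlgebra.ι ℝ ξ)) = 0 := by
  have hS : ∀ x : g, symLie x 1 = 0 := fun x => by simp [symLie]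
  have hinv : ∀ v : g, CliffordAlgebra.involute (ExteriorAlgebra.ι ℝ v) = -ExteriorAlgebra.ι ℝ v :=
    fun v => CliffordAlgebra.involute_ι v
  have h1 : ∀ ω : ExteriorAlgebra ℝ g, weilDiff B e (1 ⊗ₜ ω) =
      ∑ b, SymmetricAlgebra.ι ℝ g (e b) ⊗ₜ extContr B (B.dual e b) ω + 1 ⊗ₜ extDiff B e ω :=
    fun ω => by simp [weilDiff, hS]
  have h2 : ∀ x y : g, ∑ b, SymmetricAlgebra.ι ℝ g (e b) ⊗ₜ[ℝ] extContr B (B.dual e b)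
      (ExteriorAlgebra.ι ℝ x * ExteriorAlgebra.ι ℝ y) =
      SymmetricAlgebra.ι ℝ g x ⊗ₜ ExteriorAlgebra.ι ℝ y -
        SymmetricAlgebra.ι ℝ g y ⊗ₜ ExteriorAlgebra.ι ℝ x := fun x y => by
    conv_rhs => rw [← congrArg (SymmetricAlgebra.ι ℝ g) (sum_form_dual_smul B e x),
      ← congrArg (SymmetricAlgebra.ι ℝ g) (sum_form_dual_smul B e y)]
    simp only [map_sum, map_smul, TensorProduct.sum_tmul, ← Finset.sum_sub_distrib]
    refine Finset.sum_congr rfl fun b _ => ?_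
    rw [extContr_mul, extContr_ι, extContr_ι, hinv, ← Algebra.smul_def, neg_mul,
      ← Algebra.commutes, ← Algebra.smul_def, TensorProduct.tmul_add, TensorProduct.tmul_neg,
      TensorProduct.tmul_smul, TensorProduct.tmul_smul, TensorProduct.smul_tmul',
      TensorProduct.smul_tmul', sub_eq_add_neg]
  have h3 : lambdaMap B e ξ = (1 / 2 : ℝ) • ∑ a, ExteriorAlgebra.ι ℝ (B.dual e a) *
      ExteriorAlgebra.ι ℝ ⁅e a, ξ⁆ := by
    rw [← extDiff_ι]; simp [extDiff, extLie_ι]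
  have h4 : ∑ b, SymmetricAlgebra.ι ℝ g (e b) ⊗ₜ[ℝ] extContr B (B.dual e b) (lambdaMap B e ξ) =
      (1 / 2 : ℝ) • ∑ a, (SymmetricAlgebra.ι ℝ g (B.dual e a) ⊗ₜ ExteriorAlgebra.ι ℝ ⁅e a, ξ⁆ -
        SymmetricAlgebra.ι ℝ g ⁅e a, ξ⁆ ⊗ₜ ExteriorAlgebra.ι ℝ (B.dual e a)) := by
    rw [h3]
    simp only [map_smul, map_sum, TensorProduct.tmul_smul, TensorProduct.tmul_sum,
      ← Finset.smul_sum]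
    rw [Finset.sum_comm]
    simp only [h2]
  have h5 : ∑ a, SymmetricAlgebra.ι ℝ g (B.dual e a) ⊗ₜ[ℝ] ExteriorAlgebra.ι ℝ ⁅ξ, e a⁆ =
      -∑ a, SymmetricAlgebra.ι ℝ g ⁅ξ, B.dual e a⁆ ⊗ₜ[ℝ] ExteriorAlgebra.ι ℝ (e a) := sum_dual_lie B e (LinearMap.mk₂ ℝ
    (fun u v : g => SymmetricAlgebra.ι ℝ g u ⊗ₜ[ℝ] ExteriorAlgebra.ι ℝ v)
    (by intros; simp [TensorProduct.add_tmul]) (by intros; simp [TensorProduct.smul_tmul'])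
    (by intros; simp [TensorProduct.tmul_add]) (by intros; simp)) ξ
  have h6 : ∑ a, SymmetricAlgebra.ι ℝ g ⁅ξ, B.dual e a⁆ ⊗ₜ[ℝ] ExteriorAlgebra.ι ℝ (e a) =
      ∑ a, SymmetricAlgebra.ι ℝ g ⁅ξ, e a⁆ ⊗ₜ[ℝ] ExteriorAlgebra.ι ℝ (B.dual e a) := sum_dual_comm B e (LinearMap.mk₂ ℝ
    (fun u v : g => SymmetricAlgebra.ι ℝ g ⁅ξ, u⁆ ⊗ₜ[ℝ] ExteriorAlgebra.ι ℝ v)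
    (by intros; simp [TensorProduct.add_tmul]) (by intros; simp [TensorProduct.smul_tmul'])
    (by intros; simp [TensorProduct.tmul_add]) (by intros; simp))
  have h7 : ∀ a, (⁅e a, ξ⁆ : g) = -⁅ξ, e a⁆ := fun a => (lie_skew _ _).symm
  rw [weilDiff_one_tmul_ι, map_add, weilDiff_ι_tmul_one, h1, h4, ← extDiff_ι, extDiff_extDiff_ι,
    Finset.sum_sub_distrib]
  simp only [h7, map_neg, TensorProduct.neg_tmul, TensorProduct.tmul_neg, Finset.sum_neg_distrib,
    h5, h6]
  rw [TensorProduct.tmul_zero]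
  module

theorem weilDiff_weilDiff (x : WeilAlgebra g) : weilDiff B e (weilDiff B e x) = 0 := by
  have hinv : ∀ v : g, CliffordAlgebra.involute (ExteriorAlgebra.ι ℝ v) = -ExteriorAlgebra.ι ℝ v :=
    fun v => CliffordAlgebra.involute_ι v
  have hPP : ∀ x : WeilAlgebra g, weilParity g (weilParity g x) = x := fun x => by
    induction x using TensorProduct.induction_on with
    | zero => simp
    | add a b ha hb => simp only [map_add, ha, hb]
    | tmul p ω => simp [weilParity]
  have hprod : ∀ x y : WeilAlgebra g,
      weilDiff B e (weilParity g x) = - weilParity g (weilDiff B e x) →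
      weilDiff B e (weilDiff B e (x * y)) =
        weilDiff B e (weilDiff B e x) * y + x * weilDiff B e (weilDiff B e y) := fun x y h => by
    rw [weilDiff_mul, map_add, weilDiff_mul, weilDiff_mul, hPP]
    have h' : weilParity g (weilDiff B e x) * weilDiff B e y +
        weilDiff B e (weilParity g x) * weilDiff B e y = 0 := by
      rw [← add_mul, h, add_neg_cancel, zero_mul]
    rw [add_assoc, ← add_assoc (weilParity g (weilDiff B e x) * _), h', zero_add]
  have hP1 : ∀ ξ : g, weilDiff B e (weilParity g (1 ⊗ₜ ExteriorAlgebra.ι ℝ ξ)) =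
      - weilParity g (weilDiff B e (1 ⊗ₜ ExteriorAlgebra.ι ℝ ξ)) := fun ξ => by
    rw [weilDiff_one_tmul_ι, ← extDiff_ι]
    simp only [weilParity, Algebra.TensorProduct.map_tmul, map_add, hinv, involute_extDiff_ι,
      TensorProduct.tmul_neg, map_neg, weilDiff_one_tmul_ι, map_one, AlgHom.id_apply, ← extDiff_ι]
  have hP2 : ∀ ξ : g, weilDiff B e (weilParity g (SymmetricAlgebra.ι ℝ g ξ ⊗ₜ 1)) =
      - weilParity g (weilDiff B e (SymmetricAlgebra.ι ℝ g ξ ⊗ₜ 1)) := fun ξ => by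
    simp only [weilParity, Algebra.TensorProduct.map_tmul, map_sum, hinv, TensorProduct.tmul_neg,
      weilDiff_ι_tmul_one, map_one, AlgHom.id_apply, Finset.sum_neg_distrib, neg_neg]
  have hd1 := weilDiff_weilDiff_one_tmul_ι B e
  have hω : ∀ (ω : ExteriorAlgebra ℝ g) (y : WeilAlgebra g),
      weilDiff B e (weilDiff B e y) = 0 →
      weilDiff B e (weilDiff B e ((1 ⊗ₜ ω) * y)) = 0 := fun ω => by
    induction ω using ExteriorAlgebra.induction with
    | algebraMap r =>
      intro y hy
      rw [Algebra.algebraMap_eq_smul_one, TensorProduct.tmul_smul, smul_mul_assoc,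
        ← Algebra.TensorProduct.one_def, one_mul, map_smul, map_smul, hy, smul_zero]
    | ι v => intro y hy; rw [hprod _ _ (hP1 v), hd1, hy]; simp
    | mul a b ha hb =>
      intro y hy
      have : (1 : SymmetricAlgebra ℝ g) ⊗ₜ[ℝ] (a * b) = (1 ⊗ₜ a) * (1 ⊗ₜ b) := by simp
      rw [this, mul_assoc]
      exact ha _ (hb _ hy)
    | add a b ha hb =>
      intro y hy
      rw [TensorProduct.tmul_add, add_mul, map_add, map_add, ha y hy, hb y hy, add_zero]
  have hd2 : ∀ ξ : g, weilDiff B e (weilDiff B e (SymmetricAlgebra.ι ℝ g ξ ⊗ₜ 1)) = 0 := fun ξ => by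
    have h : SymmetricAlgebra.ι ℝ g ξ ⊗ₜ 1 = weilDiff B e (1 ⊗ₜ ExteriorAlgebra.ι ℝ ξ) -
        1 ⊗ₜ lambdaMap B e ξ := by rw [weilDiff_one_tmul_ι]; abel
    have h1 := hω (lambdaMap B e ξ) 1 (by
      have := hω 1
      have h0 : weilDiff B e 1 = 0 := by
        have := weilDiff_mul B e 1 1
        simpa using this
      rw [h0, map_zero])
    rw [mul_one] at h1
    rw [h, map_sub, map_sub, h1, hd1, map_zero, sub_zero]
  have hp : ∀ (p : SymmetricAlgebra ℝ g) (y : WeilAlgebra g),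
      weilDiff B e (weilDiff B e y) = 0 →
      weilDiff B e (weilDiff B e ((p ⊗ₜ 1) * y)) = 0 := fun p => by
    induction p using SymmetricAlgebra.induction with
    | algebraMap r =>
      intro y hy
      rw [Algebra.algebraMap_eq_smul_one, ← TensorProduct.smul_tmul', smul_mul_assoc,
        ← Algebra.TensorProduct.one_def, one_mul, map_smul, map_smul, hy, smul_zero]
    | ι v => intro y hy; rw [hprod _ _ (hP2 v), hd2, hy]; simp
    | mul a b ha hb =>
      intro y hy
      have : (a * b) ⊗ₜ[ℝ] (1 : ExteriorAlgebra ℝ g) = (a ⊗ₜ 1) * (b ⊗ₜ 1) := by simp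
      rw [this, mul_assoc]
      exact ha _ (hb _ hy)
    | add a b ha hb =>
      intro y hy
      rw [TensorProduct.add_tmul, add_mul, map_add, map_add, ha y hy, hb y hy, add_zero]
  have h0 : weilDiff B e 1 = 0 := by
    have := weilDiff_mul B e 1 1
    simpa using this
  induction x using TensorProduct.induction_on with
  | zero => simp
  | add a b ha hb => simp only [map_add, ha, hb, add_zero]
  | tmul p ω =>
    have : p ⊗ₜ[ℝ] ω = (p ⊗ₜ 1) * ((1 ⊗ₜ ω) * 1) := by simp
    rw [this]
    exact hp p _ (hω ω 1 (by rw [h0, map_zero]))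

end Weil

/-! ### The non-commutative Weil algebra -/

section NoncommutativeWeil

variable {g : Type*} [LieRing g] [LieAlgebra ℝ g] (B : InvariantForm g)

/-- The quadratic form `v ↦ B(v, v)/2`; its Clifford algebra has the relations
`v w + w v = B(v, w)`. -/
def InvariantForm.quadraticForm : QuadraticForm ℝ g :=
  (1 / 2 : ℝ) • B.form.toQuadraticMap

/-- The Clifford algebra `Cl(g)`, with relations `v w + w v = B(v, w)`. -/
abbrev Cl : Type _ := CliffordAlgebra B.quadraticForm

theorem Cl.ι_mul_ι_add_swap (v w : g) :
    CliffordAlgebra.ι B.quadraticForm v * CliffordAlgebra.ι B.quadraticForm w +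
      CliffordAlgebra.ι B.quadraticForm w * CliffordAlgebra.ι B.quadraticForm v =
      algebraMap ℝ (Cl B) (B.form v w) := by
  rw [CliffordAlgebra.ι_mul_ι_add_swap]
  congr 1
  have := B.symm.eq v w
  simp only [InvariantForm.quadraticForm, QuadraticMap.polar, smul_apply,
    LinearMap.BilinMap.toQuadraticMap_apply, map_add, LinearMap.add_apply, smul_eq_mul]
  change B.form v w = B.form w v at this
  linarith

/-- The quantization map `q : ∧g → Cl(g)`,
`v₁ ∧ ⋯ ∧ vₖ ↦ (1/k!) ∑_σ sign(σ) v_{σ 1} ⋯ v_{σ k}`. -/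
def cliffordQuantization : ExteriorAlgebra ℝ g →ₗ[ℝ] Cl B :=
  ExteriorAlgebra.liftAlternating fun k => ((k.factorial : ℝ)⁻¹) •
    MultilinearMap.alternatization ((MultilinearMap.mkPiAlgebraFin ℝ k (Cl B)).compLinearMap
      fun _ => CliffordAlgebra.ι B.quadraticForm)

theorem cliffordQuantization_prod (k : ℕ) (v : Fin k → g) :
    cliffordQuantization B (ExteriorAlgebra.ιMulti ℝ k v) = ((k.factorial : ℝ)⁻¹) •
      ∑ σ : Equiv.Perm (Fin k), (Equiv.Perm.sign σ : ℤ) •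
        (List.ofFn fun i => CliffordAlgebra.ι B.quadraticForm (v (σ i))).prod := by
  simp [cliffordQuantization, MultilinearMap.alternatization_apply, Units.smul_def]

/-- The non-commutative Weil algebra `𝒲g = Ug ⊗ Cl(g)`. -/
abbrev NCWeilAlgebra : Type _ := UniversalEnvelopingAlgebra ℝ g ⊗[ℝ] Cl B

/-- The parity automorphism of `𝒲g`: it is `1` on the even part and `-1` on the odd part of the
`ℤ₂`-grading, in which `Ug` is even and `g ⊆ Cl(g)` is odd. -/
def ncParity : NCWeilAlgebra B →ₐ[ℝ] NCWeilAlgebra B :=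
  Algebra.TensorProduct.map (AlgHom.id ℝ _) CliffordAlgebra.involute

/-- The `ℤ₂`-graded commutator on `𝒲g`, `[x, y] = x y - (-1)^{|x||y|} y x` on homogeneous elements:
`[x, y] = x y - y x₀ - y' x₁` with `x₀`, `x₁` the even and the odd part of `x` and `y'` the image
of `y` under the parity automorphism. -/
def gradedCommutator (x : NCWeilAlgebra B) : NCWeilAlgebra B →ₗ[ℝ] NCWeilAlgebra B :=
  LinearMap.mulLeft ℝ x
    - LinearMap.mulRight ℝ ((1 / 2 : ℝ) • (x + ncParity B x))
    - LinearMap.mulRight ℝ ((1 / 2 : ℝ) • (x - ncParity B x)) ∘ₗ (ncParity B).toLinearMap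

/-- The contraction operators `ι_ξ = [1 ⊗ ξ, ·]` on `𝒲g`. -/
def ncContr (ξ : g) : NCWeilAlgebra B →ₗ[ℝ] NCWeilAlgebra B :=
  gradedCommutator B (1 ⊗ₜ CliffordAlgebra.ι B.quadraticForm ξ)

/-- The Lie derivative on `U(g)`: the adjoint action, which is the derivation extending `ad_ξ`. -/
def envelopingLie (ξ : g) :
    UniversalEnvelopingAlgebra ℝ g →ₗ[ℝ] UniversalEnvelopingAlgebra ℝ g :=
  LinearMap.mulLeft ℝ (envelopingι g ξ) - LinearMap.mulRight ℝ (envelopingι g ξ)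

/-- The Lie derivative on `Cl(g)`: the derivation extending `ad_ξ`. -/
def clLie (ξ : g) : Cl B →ₗ[ℝ] Cl B :=
  cliffordDerivation B.quadraticForm (LieAlgebra.ad ℝ g ξ : g →ₗ[ℝ] g) (by
    intro v
    have h1 := B.invariant v ξ v
    have h2 := B.symm.eq v ⁅v, ξ⁆
    have h3 := B.symm.eq v ⁅ξ, v⁆
    have h4 : B.form v ⁅v, ξ⁆ = - B.form v ⁅ξ, v⁆ := by rw [← lie_skew, map_neg]
    change B.form v ⁅v, ξ⁆ = B.form ⁅v, ξ⁆ v at h2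
    change B.form v ⁅ξ, v⁆ = B.form ⁅ξ, v⁆ v at h3
    simp only [InvariantForm.quadraticForm, QuadraticMap.polar, smul_apply,
      LinearMap.BilinMap.toQuadraticMap_apply, map_add, LinearMap.add_apply, smul_eq_mul,
      LieAlgebra.ad_apply]
    linarith)

/-- The Lie derivatives `L_ξ` on `𝒲g`. -/
def ncLie (ξ : g) : NCWeilAlgebra B →ₗ[ℝ] NCWeilAlgebra B :=
  TensorProduct.map (envelopingLie ξ) LinearMap.id + TensorProduct.map LinearMap.id (clLie B ξ)

variable {κ : Type*} [Fintype κ] [DecidableEq κ] (e : Module.Basis κ ℝ g)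

/-- The cubic element `𝒞 = (1/6) ∑ f_{abc} e^a e^b e^c` of `Cl(g)`, `f_{abc} = B(e_a, [e_b, e_c])`. -/
def cubicElement : Cl B :=
  (1 / 6 : ℝ) • ∑ a, ∑ b, ∑ c, B.form (e a) ⁅e b, e c⁆ •
    (CliffordAlgebra.ι B.quadraticForm (B.dual e a) *
      CliffordAlgebra.ι B.quadraticForm (B.dual e b) *
      CliffordAlgebra.ι B.quadraticForm (B.dual e c))

/-- The cubic Dirac operator `𝒟 = ∑_a e_a ⊗ e^a - 1 ⊗ 𝒞`. -/
def dirac : NCWeilAlgebra B :=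
  ∑ a, envelopingι g (e a) ⊗ₜ CliffordAlgebra.ι B.quadraticForm (B.dual e a)
    - 1 ⊗ₜ cubicElement B e

/-- The differential `d = [𝒟, ·]` on `𝒲g`. -/
def ncDiff : NCWeilAlgebra B →ₗ[ℝ] NCWeilAlgebra B :=
  gradedCommutator B (dirac B e)

end NoncommutativeWeil

/-! ### The quantization map -/

section Quantization

variable {g : Type*} [LieRing g] [LieAlgebra ℝ g] (B : InvariantForm g)
  {κ : Type*} [Fintype κ] [DecidableEq κ] (e : Module.Basis κ ℝ g)

/-- The Taylor series of `ξ ↦ (1/2) ∑_{a,b} f(ad_ξ)_{ab} e^a ∧ e^b`, where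
`f(ad_ξ)_{ab} = B(e_a, f(ad_ξ) e_b)`. -/
def exponentSeries : MvPowerSeries κ (ExteriorAlgebra ℝ g) :=
  fun m => (1 / 2 : ℝ) • ∑ a, ∑ b,
    B.form (e a) (MvPowerSeries.coeff m (formalEval fSeries (adSeries e)) (e b)) •
      (ExteriorAlgebra.ι ℝ (B.dual e a) * ExteriorAlgebra.ι ℝ (B.dual e b))

/-- The Taylor series of `𝒮(ξ) = J^{1/2}(ξ) exp((1/2) ∑_{a,b} f(ad_ξ)_{ab} e^a ∧ e^b)`. -/
def SSeries : MvPowerSeries κ (ExteriorAlgebra ℝ g) :=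
  MvPowerSeries.map (algebraMap ℝ (ExteriorAlgebra ℝ g)) (sqrtJSeries e) *
    formalEval (PowerSeries.exp ℝ) (exponentSeries B e)

/-- The operator `ι(𝒮^) = ∑_m ∂^m ⊗ ι(𝒮_m)` on `Wg`, where `𝒮_m ∈ ∧g` are the coefficients of the
Taylor series of `𝒮`: the functions on `g` act on `Sg` as infinite order differential operators
and `∧g` acts on `∧g` by contraction. -/
def contrSHat : WeilAlgebra g →ₗ[ℝ] WeilAlgebra g :=
  TensorProduct.lift (symDiffOp e fun m =>
    (LinearMap.lcomp ℝ (WeilAlgebra g) (extContrHom B (MvPowerSeries.coeff m (SSeries B e)))) ∘ₗ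
      TensorProduct.mk ℝ (SymmetricAlgebra ℝ g) (ExteriorAlgebra ℝ g))

/-- The quantization map `𝒬 = (sym ⊗ q) ∘ ι(𝒮^) : Wg → 𝒲g`. -/
def quantization : WeilAlgebra g →ₗ[ℝ] NCWeilAlgebra B :=
  TensorProduct.map (sym g) (cliffordQuantization B) ∘ₗ contrSHat B e

end Quantization

end QuadraticLie

end

/-!
The theorem holds because the quantization map is a supersymmetrization map. The Weil algebra `Wg`
is a free supercommutative algebra, not only on the generators `ξ ⊗ 1` and `1 ⊗ ξ`, but also on the
generators `1 ⊗ ξ` and `d(1 ⊗ ξ) = ξ ⊗ 1 + 1 ⊗ λ(ξ)`, which span a `g`-stable subspace that is also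
stable under the differential. The non-commutative Weil algebra contains corresponding elements
`1 ⊗ ξ` and `d(1 ⊗ ξ) = ξ ⊗ 1 + 1 ⊗ γ(ξ)`, where `γ(ξ)` generates the adjoint action of `ξ` on the
Clifford algebra. A map that symmetrizes (in the graded sense) products of such generators
intertwines all derivations which act in the same way on the generators.

Supersymmetrization is encoded by a recursion. Let `∂_a` and `δ_a` be the partial derivatives of
`Wg` for the generators `ξ ⊗ 1 + 1 ⊗ λ(ξ)` and `1 ⊗ ξ` (`weilPartial`, `weilOddPartial`), and let
`N` be the number operator (`weilNumber`). The recursion expresses `Q (N x)` through the values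
`Q (∂_a x)` and `Q (δ_a x)`, multiplied from the left with the generators of the non-commutative
Weil algebra. Since `N` has eigenvalue `n` on the products of `n` generators and the partial
derivatives lower the number of factors, a map that satisfies the homogeneous recursion and vanishes
at `1` is zero (`eq_zero_of_weil_recursion`). Applied to `Q ∘ d - d ∘ Q` and to `Q ∘ L_ξ - L_ξ ∘ Q`
this gives two of the intertwining properties (`intertwines_weilDiff`, `intertwines_weilLie`).

The recursion itself (`quantization_weilNumber`) is a statement about operators
`∑_m ∂^m ⊗ F_m` on `Sg ⊗ ∧g`, that is, about formal power series `F` in `ξ` with values in the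
endomorphisms of `∧g` (`seriesOp`). The symmetrization map satisfies the recursion of the even
variables (`sym_symEuler`), and left multiplication by `v` in `Cl(g)` corresponds under `q` to
`ω ↦ v ∧ ω + ι_v ω / 2` (`ι_mul_cliffordQuantization`). With `H = ι(𝒮(ξ))` the recursion becomes an
identity for canonical anticommutation relations (`anticommutation_identity`), which uses three
facts. Conjugation with `H` maps exterior multiplication by `w` to exterior multiplication by `w`
plus contraction with `f(ad_ξ) w` (`sOp_psiSeries`). The radial derivative of `J^{1/2}` is
`(1/2) tr(f(ad_ξ) ad_ξ) J^{1/2}`, by Jacobi's formula (`euler_sqrtJSeries`). Finally `f` solves the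
Riccati equation `f' = 1/4 - f² - 2 f / z` (`fSeries_riccati`), which determines the radial
derivative of the exponent of `𝒮`.

Contractions commute with `ι(𝒮)` because `𝒮` is even, and `q` intertwines contractions with graded
commutators (`ι_commutator_cliffordQuantization`). The restrictions of the quantization map to
`Sg ⊗ 1` and `1 ⊗ ∧g` only involve the component of `𝒮` in `∧⁰g`, which is `J^{1/2}`, and the value
of `𝒮` at `ξ = 0`, which is `1`.
-/

open scoped TensorProduct

noncomputable section

namespace QuadraticLie

/-! ### Formal power series with non-commutative coefficients -/

section FormalSeries

variable {κ A A' : Type*} [Ring A] [Ring A']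

/-- `F` and `G` have the same coefficients in all degrees below `N`. -/
def AgreeBelow (N : ℕ) (F G : MvPowerSeries κ A) : Prop :=
  ∀ m : κ →₀ ℕ, m.degree < N → MvPowerSeries.coeff m F = MvPowerSeries.coeff m G

namespace AgreeBelow

variable {N : ℕ} {F F' G G' : MvPowerSeries κ A}

theorem refl (F : MvPowerSeries κ A) : AgreeBelow N F F := fun _ _ => rfl

theorem symm (h : AgreeBelow N F G) : AgreeBelow N G F := fun m hm => (h m hm).symm

theorem trans {K : MvPowerSeries κ A} (h : AgreeBelow N F G) (h' : AgreeBelow N G K) :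
    AgreeBelow N F K := fun m hm => (h m hm).trans (h' m hm)

theorem mono {K : ℕ} (hK : K ≤ N) (h : AgreeBelow N F G) : AgreeBelow K F G :=
  fun m hm => h m (hm.trans_le hK)

theorem mul (h : AgreeBelow N F F') (h' : AgreeBelow N G G') :
    AgreeBelow N (F * G) (F' * G') := fun m hm => by
  classical
  rw [MvPowerSeries.coeff_mul, MvPowerSeries.coeff_mul]
  refine Finset.sum_congr rfl fun p hp => ?_
  have hd : p.1.degree + p.2.degree = m.degree := by
    rw [← map_add, Finset.HasAntidiagonal.mem_antidiagonal.mp hp]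
  rw [h _ (by omega), h' _ (by omega)]

theorem eq (h : ∀ N, AgreeBelow N F G) : F = G :=
  MvPowerSeries.ext fun m => h (m.degree + 1) m (Nat.lt_succ_self _)

end AgreeBelow

theorem agreeBelow_pow_zero {Y : MvPowerSeries κ A} (hY : MvPowerSeries.constantCoeff Y = 0)
    {N n : ℕ} (h : N ≤ n) : AgreeBelow N (Y ^ n) 0 := fun m hm => by
  rw [map_zero]
  refine MvPowerSeries.coeff_of_lt_order (lt_of_lt_of_le ?_
    (MvPowerSeries.le_order_pow_of_constantCoeff_eq_zero n hY))
  exact_mod_cast hm.trans_le h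

variable [Algebra ℝ A] [Algebra ℝ A']

theorem coeff_formalEval_def (φ : PowerSeries ℝ) (Y : MvPowerSeries κ A) (m : κ →₀ ℕ) :
    MvPowerSeries.coeff m (formalEval φ Y) = ∑ n ∈ Finset.range (m.degree + 1),
      PowerSeries.coeff n φ • MvPowerSeries.coeff m (Y ^ n) := rfl

theorem coeff_formalEval {Y : MvPowerSeries κ A} (hY : MvPowerSeries.constantCoeff Y = 0)
    (φ : PowerSeries ℝ) {N : ℕ} (m : κ →₀ ℕ) (hm : m.degree < N) :
    MvPowerSeries.coeff m (formalEval φ Y) =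
      ∑ n ∈ Finset.range N, PowerSeries.coeff n φ • MvPowerSeries.coeff m (Y ^ n) := by
  change ∑ n ∈ Finset.range (m.degree + 1), _ = _
  refine Finset.sum_subset (fun n hn => ?_) fun n _ hn => ?_
  · simp only [Finset.mem_range] at hn ⊢; omega
  · simp only [Finset.mem_range, not_lt] at hn
    rw [agreeBelow_pow_zero hY hn m (Nat.lt_succ_self _), map_zero, smul_zero]

theorem formalEval_agreeBelow {Y : MvPowerSeries κ A} (hY : MvPowerSeries.constantCoeff Y = 0)
    (φ : PowerSeries ℝ) (N : ℕ) :
    AgreeBelow N (formalEval φ Y) (Polynomial.aeval Y (PowerSeries.trunc N φ)) := fun m hm => by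
  obtain ⟨k, rfl⟩ : ∃ k, N = k + 1 := ⟨N - 1, by omega⟩
  rw [coeff_formalEval hY φ m hm,
    Polynomial.aeval_eq_sum_range' (PowerSeries.natDegree_trunc_lt φ k), map_sum]
  refine Finset.sum_congr rfl fun n hn => ?_
  rw [PowerSeries.coeff_trunc, if_pos (Finset.mem_range.mp hn)]
  rfl

/-- A polynomial without terms of degree below `N` has no terms of degree below `N` at `Y`. -/
theorem aeval_agreeBelow_zero {Y : MvPowerSeries κ A} (hY : MvPowerSeries.constantCoeff Y = 0)
    {N : ℕ} (p : Polynomial ℝ) (hp : ∀ n < N, p.coeff n = 0) :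
    AgreeBelow N (Polynomial.aeval Y p) 0 := fun m hm => by
  rw [Polynomial.aeval_eq_sum_range, map_sum, map_zero]
  refine Finset.sum_eq_zero fun n _ => ?_
  by_cases hn : n < N
  · rw [hp n hn, zero_smul, map_zero]
  · change p.coeff n • MvPowerSeries.coeff m (Y ^ n) = 0
    rw [agreeBelow_pow_zero hY (not_lt.mp hn) m hm, map_zero, smul_zero]

theorem aeval_agreeBelow {Y : MvPowerSeries κ A} (hY : MvPowerSeries.constantCoeff Y = 0)
    {N : ℕ} (p q : Polynomial ℝ) (h : ∀ n < N, p.coeff n = q.coeff n) :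
    AgreeBelow N (Polynomial.aeval Y p) (Polynomial.aeval Y q) := fun m hm => by
  have := aeval_agreeBelow_zero hY (p - q) (fun n hn => by rw [Polynomial.coeff_sub, h n hn, sub_self]) m hm
  rw [map_sub, map_sub, map_zero] at this
  exact sub_eq_zero.mp this

theorem formalEval_mul {Y : MvPowerSeries κ A} (hY : MvPowerSeries.constantCoeff Y = 0)
    (φ χ : PowerSeries ℝ) : formalEval (φ * χ) Y = formalEval φ Y * formalEval χ Y := by
  refine AgreeBelow.eq fun N => (formalEval_agreeBelow hY _ N).trans
    (AgreeBelow.trans ?_ ((formalEval_agreeBelow hY φ N).mul (formalEval_agreeBelow hY χ N)).symm)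
  rw [← map_mul]
  refine aeval_agreeBelow hY _ _ fun n hn => ?_
  rw [PowerSeries.coeff_trunc, if_pos hn, PowerSeries.coeff_mul, Polynomial.coeff_mul]
  refine Finset.sum_congr rfl fun p hp => ?_
  have := Finset.HasAntidiagonal.mem_antidiagonal.mp hp
  rw [PowerSeries.coeff_trunc, PowerSeries.coeff_trunc, if_pos (by omega), if_pos (by omega)]

theorem formalEval_add (Y : MvPowerSeries κ A)
    (φ χ : PowerSeries ℝ) : formalEval (φ + χ) Y = formalEval φ Y + formalEval χ Y := by
  ext m
  simp only [coeff_formalEval_def, map_add, add_smul, Finset.sum_add_distrib]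

theorem formalEval_smul (Y : MvPowerSeries κ A) (r : ℝ)
    (φ : PowerSeries ℝ) : formalEval (r • φ) Y = r • formalEval φ Y := by
  ext m
  change _ = r • MvPowerSeries.coeff m (formalEval φ Y)
  simp only [coeff_formalEval_def, PowerSeries.coeff_smul, Finset.smul_sum, mul_smul, smul_eq_mul]

theorem formalEval_X {Y : MvPowerSeries κ A} (hY : MvPowerSeries.constantCoeff Y = 0) :
    formalEval PowerSeries.X Y = Y := by
  ext m
  rw [coeff_formalEval hY _ m (show m.degree < m.degree + 2 by omega),
    Finset.sum_eq_single 1]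
  · simp
  · intro n _ hn; simp [PowerSeries.coeff_X, hn]
  · intro h; exact absurd (Finset.mem_range.mpr (by omega)) h

theorem formalEval_one {Y : MvPowerSeries κ A} (hY : MvPowerSeries.constantCoeff Y = 0) :
    formalEval 1 Y = 1 := by
  ext m
  rw [coeff_formalEval hY _ m (show m.degree < m.degree + 2 by omega),
    Finset.sum_eq_single 0]
  · simp
  · intro n _ hn; simp [PowerSeries.coeff_one, hn]
  · intro h; exact absurd (Finset.mem_range.mpr (by omega)) h

theorem constantCoeff_formalEval (φ : PowerSeries ℝ) (Y : MvPowerSeries κ A) :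
    MvPowerSeries.constantCoeff (formalEval φ Y) =
      algebraMap ℝ A (PowerSeries.constantCoeff φ) := by
  change ∑ n ∈ Finset.range ((0 : κ →₀ ℕ).degree + 1), _ = _
  simp [Algebra.algebraMap_eq_smul_one]

theorem map_formalEval (T : A →ₐ[ℝ] A') (φ : PowerSeries ℝ) (Y : MvPowerSeries κ A) :
    MvPowerSeries.map (T : A →+* A') (formalEval φ Y) =
      formalEval φ (MvPowerSeries.map (T : A →+* A') Y) := by
  ext m
  rw [MvPowerSeries.coeff_map, coeff_formalEval_def, coeff_formalEval_def, map_sum]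
  refine Finset.sum_congr rfl fun n _ => ?_
  rw [← map_pow, MvPowerSeries.coeff_map]
  exact map_smul T _ _

/-- The chain rule: a local derivation `D` of formal power series for which `D Y` commutes with `Y`
satisfies `D(φ(Y)) = φ'(Y) D(Y)`. -/
theorem derivation_formalEval {Y : MvPowerSeries κ A} (hY : MvPowerSeries.constantCoeff Y = 0)
    (D : MvPowerSeries κ A →ₗ[ℝ] MvPowerSeries κ A)
    (hD : ∀ F G, D (F * G) = D F * G + F * D G)
    (hloc : ∀ N F, AgreeBelow N F 0 → AgreeBelow N (D F) 0)
    (hcomm : Commute Y (D Y)) (φ : PowerSeries ℝ) :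
    D (formalEval φ Y) = formalEval (PowerSeries.derivative ℝ φ) Y * D Y := by
  have hD1 : D 1 = 0 := by simpa using hD 1 1
  have hpow : ∀ n : ℕ, D (Y ^ (n + 1)) = ((n : ℝ) + 1) • (Y ^ n * D Y) := fun n => by
    induction n with
    | zero => simp
    | succ n ih =>
      rw [pow_succ, hD, ih, smul_mul_assoc, mul_assoc, ← hcomm.eq, ← mul_assoc, ← pow_succ,
        Nat.cast_add, Nat.cast_one]
      module
  have hpoly : ∀ p : Polynomial ℝ, D (Polynomial.aeval Y p) =
      Polynomial.aeval Y (Polynomial.derivative p) * D Y := fun p => by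
    induction p using Polynomial.induction_on' with
    | add p q hp hq => simp only [map_add, hp, hq, add_mul]
    | monomial n a =>
      cases n with
      | zero => simp [Algebra.algebraMap_eq_smul_one, hD1]
      | succ n =>
        rw [Polynomial.aeval_monomial, Polynomial.derivative_monomial_succ, Polynomial.aeval_monomial, ← Algebra.smul_def,
          ← Algebra.smul_def, map_smul, hpow, smul_smul, smul_mul_assoc]
  have hloc' : ∀ N F G, AgreeBelow N F G → AgreeBelow N (D F) (D G) := fun N F G h m hm => by
    have := hloc N (F - G) (fun m hm => by rw [map_sub, h m hm, sub_self, map_zero]) m hm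
    rw [map_sub, map_sub, map_zero] at this
    exact sub_eq_zero.mp this
  refine AgreeBelow.eq fun N => ?_
  refine ((hloc' _ _ _ (formalEval_agreeBelow hY φ (N + 1))).mono N.le_succ).trans ?_
  rw [hpoly, ← PowerSeries.trunc_derivative]
  exact ((formalEval_agreeBelow hY _ N).symm).mul (AgreeBelow.refl _)

theorem commute_formalEval {Y Z : MvPowerSeries κ A} (hY : MvPowerSeries.constantCoeff Y = 0)
    (h : Commute Y Z) (φ : PowerSeries ℝ) : Commute (formalEval φ Y) Z := by
  refine AgreeBelow.eq fun N => ?_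
  refine ((formalEval_agreeBelow hY φ N).mul (AgreeBelow.refl Z)).trans (AgreeBelow.trans ?_
    ((AgreeBelow.refl Z).mul (formalEval_agreeBelow hY φ N).symm))
  have : Commute (Polynomial.aeval Y (PowerSeries.trunc N φ)) Z := by
    induction PowerSeries.trunc N φ using Polynomial.induction_on' with
    | add p q hp hq => rw [map_add]; exact hp.add_left hq
    | monomial n a =>
      rw [Polynomial.aeval_monomial]
      exact (Algebra.commute_algebraMap_left a Z).mul_left (h.pow_left n)
  rw [this.eq]
  exact AgreeBelow.refl _

/-- The Euler operator `∑_a ξ^a ∂/∂ξ^a` on formal power series: multiplication of the terms of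
degree `n` by `n`. -/
def euler : MvPowerSeries κ A →ₗ[ℝ] MvPowerSeries κ A where
  toFun F := fun m => (m.degree : ℝ) • MvPowerSeries.coeff m F
  map_add' F G := by ext m; exact smul_add _ _ _
  map_smul' r F := by ext m; exact smul_comm _ _ _

theorem coeff_euler (F : MvPowerSeries κ A) (m : κ →₀ ℕ) :
    MvPowerSeries.coeff m (euler F) = (m.degree : ℝ) • MvPowerSeries.coeff m F := rfl

theorem euler_C (x : A) :
    euler (MvPowerSeries.C x : MvPowerSeries κ A) = 0 := by
  classical
  ext m
  rw [coeff_euler, MvPowerSeries.coeff_C, map_zero]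
  split_ifs with h
  · simp [h]
  · simp

theorem euler_mul (F G : MvPowerSeries κ A) : euler (F * G) = euler F * G + F * euler G := by
  classical
  ext m
  simp only [coeff_euler, map_add, MvPowerSeries.coeff_mul, Finset.smul_sum,
    ← Finset.sum_add_distrib]
  refine Finset.sum_congr rfl fun p hp => ?_
  rw [← Finset.HasAntidiagonal.mem_antidiagonal.mp hp, map_add, Nat.cast_add, add_smul, smul_mul_assoc,
    mul_smul_comm]

theorem euler_map (T : A →ₐ[ℝ] A') (F : MvPowerSeries κ A) :
    euler (MvPowerSeries.map (T : A →+* A') F) = MvPowerSeries.map (T : A →+* A') (euler F) := by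
  ext m
  simp only [coeff_euler, MvPowerSeries.coeff_map]
  exact (map_smul T _ _).symm

theorem euler_formalEval {Y : MvPowerSeries κ A} (hY : MvPowerSeries.constantCoeff Y = 0)
    (hcomm : Commute Y (euler Y)) (φ : PowerSeries ℝ) :
    euler (formalEval φ Y) = formalEval (PowerSeries.derivative ℝ φ) Y * euler Y :=
  derivation_formalEval hY euler euler_mul
    (fun N F h m hm => by rw [coeff_euler, h m hm, map_zero, smul_zero]) hcomm φ

/-- If the commutator `Z = [Y, c]` with a constant `c` commutes with `Y`, then
`[φ(Y), c] = φ'(Y) Z`. -/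
theorem formalEval_commutator {Y Z : MvPowerSeries κ A} (hY : MvPowerSeries.constantCoeff Y = 0)
    (c : MvPowerSeries κ A) (hZ : Y * c - c * Y = Z) (hcomm : Commute Y Z) (φ : PowerSeries ℝ) :
    formalEval φ Y * c - c * formalEval φ Y =
      formalEval (PowerSeries.derivative ℝ φ) Y * Z := by
  have := derivation_formalEval hY (LinearMap.mulRight ℝ c - LinearMap.mulLeft ℝ c)
    (fun F G => by simp only [LinearMap.sub_apply, LinearMap.mulRight_apply,
      LinearMap.mulLeft_apply]; noncomm_ring)
    (fun N F h => by
      have h1 := h.mul (AgreeBelow.refl c)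
      have h2 := (AgreeBelow.refl c).mul h
      intro m hm
      simp only [LinearMap.sub_apply, LinearMap.mulRight_apply, LinearMap.mulLeft_apply, map_sub,
        h1 m hm, h2 m hm, zero_mul, mul_zero, sub_self, map_zero])
    (by simpa [hZ] using hcomm) φ
  simpa [hZ] using this

end FormalSeries

/-! ### The power series `j`, `f` and `(1 + z)^{1/2}` -/

section ScalarSeries

open PowerSeries

theorem constantCoeff_jSeries : PowerSeries.constantCoeff jSeries = 1 := by
  simp [← PowerSeries.coeff_zero_eq_constantCoeff_apply, jSeries]

theorem fSeries_mul_jSeries : fSeries * jSeries = PowerSeries.derivative ℝ jSeries := by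
  rw [fSeries, mul_assoc, PowerSeries.inv_mul_cancel, mul_one]
  rw [constantCoeff_jSeries]; exact one_ne_zero

theorem jSeries_ne_zero : jSeries ≠ 0 := fun h => by
  have := constantCoeff_jSeries
  rw [h, map_zero] at this
  exact zero_ne_one this

/-- `z j'' + 2 j' = z j / 4`, as `z j(z) = 2 sinh(z/2)`. -/
theorem jSeries_diffEq :
    X * PowerSeries.derivative ℝ (PowerSeries.derivative ℝ jSeries) +
      (2 : ℝ) • PowerSeries.derivative ℝ jSeries = (1 / 4 : ℝ) • (X * jSeries) := by
  ext n
  simp only [map_add, PowerSeries.coeff_smul]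
  cases n with
  | zero => simp [PowerSeries.coeff_derivative, jSeries]
  | succ n =>
    simp only [PowerSeries.coeff_succ_X_mul, PowerSeries.coeff_derivative, jSeries,
      PowerSeries.coeff_mk, smul_eq_mul]
    have h : Even (n + 1 + 1) ↔ Even n := by
      rw [add_assoc, Nat.even_add]; simp
    simp only [h]
    split_ifs with hn
    · rw [Nat.factorial_succ (n + 1 + 1), Nat.factorial_succ (n + 1)]
      have : ((n + 1).factorial : ℝ) ≠ 0 := by positivity
      push_cast
      have h2 : (n : ℝ) + 1 + 1 ≠ 0 := by positivity
      have h3 : (n : ℝ) + 1 + 1 + 1 ≠ 0 := by positivity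
      field_simp
      ring
    · simp

/-- The Riccati equation `z f' = z/4 - z f² - 2 f`. -/
theorem fSeries_riccati : X * PowerSeries.derivative ℝ fSeries =
    (1 / 4 : ℝ) • X - fSeries * fSeries * X - (2 : ℝ) • fSeries := by
  refine mul_right_cancel₀ jSeries_ne_zero ?_
  have h1 := fSeries_mul_jSeries
  have h2 : PowerSeries.derivative ℝ fSeries * jSeries = PowerSeries.derivative ℝ (PowerSeries.derivative ℝ jSeries) -
      fSeries * (fSeries * jSeries) := by
    rw [← h1, Derivation.leibniz, h1]
    simp only [smul_eq_mul]
    ring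
  have h3 := jSeries_diffEq
  rw [mul_assoc, h2, mul_sub, eq_sub_of_add_eq h3, sub_mul, sub_mul, smul_mul_assoc, smul_mul_assoc,
    ← h1]
  ring

theorem fSeries_odd (n : ℕ) (hn : Even n) : PowerSeries.coeff n fSeries = 0 := by
  have hj : PowerSeries.rescale (-1 : ℝ) jSeries = jSeries := by
    ext n
    simp only [PowerSeries.coeff_rescale, jSeries, PowerSeries.coeff_mk]
    split_ifs with h
    · rw [h.neg_one_pow, one_mul]
    · simp
  have hj' : PowerSeries.rescale (-1 : ℝ) (PowerSeries.derivative ℝ jSeries) = -PowerSeries.derivative ℝ jSeries := by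
    ext n
    simp only [PowerSeries.coeff_rescale, PowerSeries.coeff_derivative, jSeries,
      PowerSeries.coeff_mk, map_neg]
    split_ifs with h
    · have : Odd n := by
        rcases Nat.even_or_odd n with h' | h'
        · exact absurd h (by rw [Nat.even_add_one]; simpa using h')
        · exact h'
      rw [this.neg_one_pow, neg_one_mul]
    · simp
  have hf : PowerSeries.rescale (-1 : ℝ) fSeries = -fSeries := by
    refine mul_right_cancel₀ jSeries_ne_zero ?_
    conv_lhs => rw [← hj]
    rw [← map_mul, fSeries_mul_jSeries, hj', neg_mul, fSeries_mul_jSeries]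
  have := congrArg (PowerSeries.coeff n) hf
  rw [PowerSeries.coeff_rescale, hn.neg_one_pow, one_mul, map_neg] at this
  linarith

/-- `(1 + z) s' = s / 2` for `s = (1 + z)^{1/2}`. -/
theorem sqrtSeries_diffEq :
    (1 + X) * PowerSeries.derivative ℝ sqrtSeries = (1 / 2 : ℝ) • sqrtSeries := by
  have hc : ∀ n : ℕ, ((n : ℝ) + 1) * Ring.choose (1 / 2 : ℝ) (n + 1) =
      Ring.choose (1 / 2 : ℝ) n * (1 / 2 - n) := fun n => by
    have := Ring.choose_smul_choose (1 / 2 : ℝ) (Nat.le_succ n)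
    simpa [Nat.succ_sub_one] using this
  ext n
  rw [add_mul, one_mul, map_add, PowerSeries.coeff_smul, PowerSeries.coeff_derivative]
  cases n with
  | zero =>
    have := hc 0
    simp [sqrtSeries] at this ⊢
  | succ n =>
    rw [PowerSeries.coeff_succ_X_mul, PowerSeries.coeff_derivative]
    have h1 := hc n
    have h2 := hc (n + 1)
    simp only [sqrtSeries, PowerSeries.binomialSeries_coeff, smul_eq_mul, mul_one]
    push_cast at h2 ⊢
    linarith

end ScalarSeries

/-! ### The logarithmic derivative of `J^{1/2}` -/

/-- Jacobi's formula for the logarithmic derivative of a determinant. -/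
theorem det_logDerivative {R κ : Type*} [CommRing R] [Fintype κ] [DecidableEq κ] (D : R →+ R)
    (hD : ∀ a b, D (a * b) = D a * b + a * D b) (M N : Matrix κ κ R) (h : M.map D = N * M) :
    D M.det = N.trace * M.det := by
  have hD1 : D 1 = 0 := by simpa using hD 1 1
  let T : R →+* TrivSqZeroExt R R :=
    { toFun := fun a => TrivSqZeroExt.inl a + TrivSqZeroExt.inr (D a)
      map_one' := by ext <;> simp [hD1]
      map_zero' := by ext <;> simp
      map_add' := fun a b => by ext <;> simp
      map_mul' := fun a b => by ext <;> simp [hD, mul_comm, add_comm] }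
  let ι : R →+* TrivSqZeroExt R R := TrivSqZeroExt.inlHom R R
  have hT : T.mapMatrix M =
      (1 + (TrivSqZeroExt.inr 1 : TrivSqZeroExt R R) • ι.mapMatrix N) * ι.mapMatrix M := by
    rw [add_mul, one_mul, smul_mul_assoc, ← map_mul, ← h]
    ext i j <;> simp [T, ι]
  have h2 := congrArg Matrix.det hT
  rw [Matrix.det_mul, Matrix.det_one_add_smul, ← RingHom.map_det, ← RingHom.map_det,
    RingHom.mapMatrix_apply, ← AddMonoidHom.map_trace ι] at h2
  have h3 := congrArg TrivSqZeroExt.snd h2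
  simpa [T, ι, pow_two, mul_comm] using h3

section Matrices

variable {g : Type*} [LieRing g] [LieAlgebra ℝ g] {κ : Type*} [Fintype κ] [DecidableEq κ]
  (e : Module.Basis κ ℝ g)

/-- The entry `F_{ab}` of a formal power series of endomorphisms of `g`. -/
def entrySeries (F : MvPowerSeries κ (Module.End ℝ g)) (a b : κ) : MvPowerSeries κ ℝ :=
  fun m => LinearMap.toMatrix e e (MvPowerSeries.coeff m F) a b

theorem coeff_entrySeries (F : MvPowerSeries κ (Module.End ℝ g)) (a b : κ) (m : κ →₀ ℕ) :
    MvPowerSeries.coeff m (entrySeries e F a b) =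
      LinearMap.toMatrix e e (MvPowerSeries.coeff m F) a b := rfl

/-- A formal power series of endomorphisms of `g`, as a matrix of formal power series. -/
def matrixSeries : MvPowerSeries κ (Module.End ℝ g) →+* Matrix κ κ (MvPowerSeries κ ℝ) where
  toFun F := Matrix.of (entrySeries e F)
  map_one' := by
    ext a b m
    rw [Matrix.of_apply, coeff_entrySeries, MvPowerSeries.coeff_one]
    by_cases hm : m = 0 <;> by_cases hab : a = b <;>
      simp [hm, hab, Matrix.one_apply, MvPowerSeries.coeff_one, LinearMap.toMatrix_one]
  map_zero' := by ext a b m; simp [coeff_entrySeries]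
  map_add' F G := by
    ext a b m
    simp [coeff_entrySeries]
  map_mul' F G := by
    ext a b m
    rw [Matrix.of_apply, coeff_entrySeries, Matrix.mul_apply, MvPowerSeries.coeff_mul, map_sum,
      map_sum, Matrix.sum_apply]
    simp only [MvPowerSeries.coeff_mul, Matrix.of_apply, coeff_entrySeries]
    rw [Finset.sum_comm]
    refine Finset.sum_congr rfl fun p _ => ?_
    rw [LinearMap.toMatrix_mul, Matrix.mul_apply]

theorem coeff_matrixSeries (F : MvPowerSeries κ (Module.End ℝ g)) (a b : κ) (m : κ →₀ ℕ) :
    MvPowerSeries.coeff m (matrixSeries e F a b) =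
      LinearMap.toMatrix e e (MvPowerSeries.coeff m F) a b := rfl

theorem JSeries_eq_det : JSeries e = (matrixSeries e (formalEval jSeries (adSeries e))).det := rfl

theorem matrixSeries_euler (F : MvPowerSeries κ (Module.End ℝ g)) :
    matrixSeries e (euler F) = (matrixSeries e F).map euler := by
  ext a b m
  rw [coeff_matrixSeries, Matrix.map_apply, coeff_euler, coeff_euler, coeff_matrixSeries, map_smul]
  rfl

theorem coeff_adSeries (m : κ →₀ ℕ) : MvPowerSeries.coeff m (adSeries e) =
    ∑ a, if m = Finsupp.single a 1 then LieAlgebra.ad ℝ g (e a) else 0 := by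
  classical
  simp only [adSeries, map_sum, MvPowerSeries.coeff_monomial]

theorem constantCoeff_adSeries : MvPowerSeries.constantCoeff (adSeries e) = 0 := by
  rw [← MvPowerSeries.coeff_zero_eq_constantCoeff_apply, coeff_adSeries]
  refine Finset.sum_eq_zero fun a _ => if_neg fun h => ?_
  simpa using congrArg Finsupp.degree h

theorem euler_adSeries : euler (adSeries e) = adSeries e := by
  ext1 m
  rw [coeff_euler, coeff_adSeries, Finset.smul_sum]
  refine Finset.sum_congr rfl fun a _ => ?_
  split_ifs with h
  · subst h; simp
  · exact smul_zero _

theorem euler_formalEval_adSeries (φ : PowerSeries ℝ) :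
    euler (formalEval φ (adSeries e)) =
      formalEval (PowerSeries.X * PowerSeries.derivative ℝ φ) (adSeries e) := by
  have h0 := constantCoeff_adSeries e
  rw [euler_formalEval h0 (by rw [euler_adSeries]), euler_adSeries, mul_comm PowerSeries.X,
    formalEval_mul h0, formalEval_X h0]

/-- The trace `tr(f(ad_ξ) ad_ξ)`. -/
def traceSeries : MvPowerSeries κ ℝ :=
  (matrixSeries e (formalEval fSeries (adSeries e) * adSeries e)).trace

theorem euler_JSeries : euler (JSeries e) = traceSeries e * JSeries e := by
  have h0 := constantCoeff_adSeries e
  refine det_logDerivative (euler (κ := κ) (A := ℝ)).toAddMonoidHom euler_mul _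
    (matrixSeries e (formalEval fSeries (adSeries e) * adSeries e)) ?_
  refine (matrixSeries_euler e _).symm.trans ?_
  change _ = _ * matrixSeries e (formalEval jSeries (adSeries e))
  rw [← map_mul, euler_formalEval_adSeries, ← fSeries_mul_jSeries]
  congr 1
  have hX : formalEval fSeries (adSeries e) * adSeries e =
      formalEval (fSeries * PowerSeries.X) (adSeries e) := by
    rw [formalEval_mul h0, formalEval_X h0]
  rw [hX, ← formalEval_mul h0]
  congr 1
  ring

theorem constantCoeff_JSeries : MvPowerSeries.constantCoeff (JSeries e) = 1 := by
  rw [JSeries_eq_det, RingHom.map_det]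
  have : MvPowerSeries.constantCoeff.mapMatrix
      (matrixSeries e (formalEval jSeries (adSeries e))) = 1 := by
    ext a b
    change MvPowerSeries.coeff 0 (matrixSeries e (formalEval jSeries (adSeries e)) a b) = _
    rw [coeff_matrixSeries, MvPowerSeries.coeff_zero_eq_constantCoeff_apply,
      constantCoeff_formalEval, constantCoeff_jSeries, map_one, LinearMap.toMatrix_one]
  rw [this, Matrix.det_one]

theorem constantCoeff_sqrtJSeries : MvPowerSeries.constantCoeff (sqrtJSeries e) = 1 := by
  rw [sqrtJSeries, constantCoeff_formalEval]
  simp [sqrtSeries]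

theorem euler_sqrtJSeries :
    euler (sqrtJSeries e) = (1 / 2 : ℝ) • (traceSeries e * sqrtJSeries e) := by
  have h0 : MvPowerSeries.constantCoeff (JSeries e - 1) = 0 := by
    rw [map_sub, constantCoeff_JSeries, map_one, sub_self]
  have h1 : euler (1 : MvPowerSeries κ ℝ) = 0 := by simpa using euler_mul (1 : MvPowerSeries κ ℝ) 1
  have h2 : JSeries e = formalEval (1 + PowerSeries.X) (JSeries e - 1) := by
    rw [formalEval_add, formalEval_one h0, formalEval_X h0]; ring
  rw [sqrtJSeries, euler_formalEval h0 (Commute.all _ _), map_sub, h1, sub_zero, euler_JSeries,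
    mul_left_comm, ← mul_smul_comm, ← formalEval_smul, ← sqrtSeries_diffEq, mul_comm (1 + _),
    formalEval_mul h0, ← h2]

end Matrices

/-! ### An identity for canonical anticommutation relations -/

section Anticommutation

variable {R M P κ : Type*} [CommRing R] [AddCommGroup M] [Module R M] [Ring P]
  [Algebra R P] [Fintype κ] {β : M →ₗ[R] M →ₗ[R] R} {e e' : κ → M}

/-- A skew endomorphism can be moved to the other factor of the canonical tensor
`∑_a e^a ⊗ e_a`, with a sign. -/
theorem sum_skew_shift {N : Type*} [AddCommGroup N] [Module R N] (hβ : ∀ u v, β u v = β v u)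
    (h1 : ∀ v, ∑ a, β (e' a) v • e a = v)
    (h2 : ∀ v, ∑ a, β (e a) v • e' a = v) (F : M →ₗ[R] M) (hF : ∀ u v, β (F u) v = -β u (F v))
    (Φ : M →ₗ[R] M →ₗ[R] N) : ∑ a, Φ (F (e' a)) (e a) = -∑ a, Φ (e' a) (F (e a)) := by
  have h3 : ∀ a, Φ (F (e' a)) (e a) = ∑ b, β (e b) (F (e' a)) • Φ (e' b) (e a) := fun a => by
    conv_lhs => rw [← h2 (F (e' a))]
    simp
  have h4 : ∀ a, Φ (e' a) (F (e a)) = ∑ b, β (e' b) (F (e a)) • Φ (e' a) (e b) := fun a => by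
    conv_lhs => rw [← h1 (F (e a))]
    simp
  simp only [h3, h4]
  rw [Finset.sum_comm, ← Finset.sum_neg_distrib]
  refine Finset.sum_congr rfl fun a _ => ?_
  rw [← Finset.sum_neg_distrib]
  refine Finset.sum_congr rfl fun b _ => ?_
  rw [hβ, hF, neg_smul]

theorem sum_dual_swap {N : Type*} [AddCommGroup N] [Module R N] (hβ : ∀ u v, β u v = β v u)
    (h2 : ∀ v, ∑ a, β (e a) v • e' a = v) (Φ : M →ₗ[R] M →ₗ[R] N) :
    ∑ a, Φ (e a) (e' a) = ∑ a, Φ (e' a) (e a) := by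
  have h3 : ∀ a, Φ (e a) (e' a) = ∑ b, β (e b) (e a) • Φ (e' b) (e' a) := fun a => by
    conv_lhs => rw [← h2 (e a)]
    simp
  have h4 : ∀ a, Φ (e' a) (e a) = ∑ b, β (e b) (e a) • Φ (e' a) (e' b) := fun a => by
    conv_lhs => rw [← h2 (e a)]
    simp
  simp only [h3, h4]
  rw [Finset.sum_comm]
  exact Finset.sum_congr rfl fun a _ => Finset.sum_congr rfl fun b _ => by rw [hβ]

variable [Algebra ℝ R] [Module ℝ M] [IsScalarTower ℝ R M] [Algebra ℝ P] [IsScalarTower ℝ R P]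

/-- The identity behind the recursion for the quantization map. Here `ψ` and `ι` generate the
algebra of creation and annihilation operators of a quadratic module with dual bases `e_a`, `e^a`,
the endomorphism `A` plays the role of `ad_ξ`, `f` that of `f(ad_ξ)`, and `H` that of `ι(𝒮(ξ))`, with
`H'` its radial derivative. The Riccati equation for `f` enters through the formula for `H'`. -/
theorem anticommutation_identity (hβ : ∀ u v, β u v = β v u)
    (h1 : ∀ v, ∑ a, β (e' a) v • e a = v) (h2 : ∀ v, ∑ a, β (e a) v • e' a = v)
    (ψ ι : M →ₗ[R] P) (hιι : ∀ u v, ι u * ι v = -(ι v * ι u))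
    (hιψ : ∀ u v, ι u * ψ v = algebraMap R P (β u v) - ψ v * ι u)
    (A f : M →ₗ[R] M) (hA : ∀ u v, β (A u) v = -β u (A v)) (hf : ∀ u v, β (f u) v = -β u (f v))
    (hAf : ∀ v, A (f v) = f (A v)) (H H' : P) (hHψ : ∀ w, H * ψ w = (ψ w + ι (f w)) * H)
    (hHι : ∀ w, H * ι w = ι w * H)
    (hH' : H' = ((1 / 2 : ℝ) • algebraMap R P (∑ a, β (e' a) (f (A (e a)))) -
      (1 / 2 : ℝ) • ∑ a, ι (e' a) *
        ι ((1 / 4 : ℝ) • A (e a) - f (f (A (e a))) - (2 : ℝ) • f (e a))) * H) :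
    H * ((-1 / 2 : ℝ) • ∑ a, ψ (e' a) * ψ (A (e a)) +
        ∑ a, ψ (e a) * (ι (e' a) + ψ (A (e' a)))) + H' =
      ((-1 / 2 : ℝ) • ∑ a, (ψ (e' a) + (1 / 2 : ℝ) • ι (e' a)) *
        (ψ (A (e a)) + (1 / 2 : ℝ) • ι (A (e a)))) * H +
      ∑ a, (ψ (e a) + (1 / 2 : ℝ) • ι (e a)) * (H * (ι (e' a) + ψ (A (e' a)))) := by
  have shift := fun (F : M →ₗ[R] M) hF => sum_skew_shift (N := P) hβ h1 h2 F hF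
  have swap := sum_dual_swap (N := P) hβ h2
  -- the bilinear map `(u, v) ↦ x(F u) y(G v)`
  let Φ : (M →ₗ[R] P) → (M →ₗ[R] P) → (M →ₗ[R] M) → (M →ₗ[R] M) → M →ₗ[R] M →ₗ[R] P :=
    fun x y F G => (LinearMap.mul R P).compl₁₂ (x ∘ₗ F) (y ∘ₗ G)
  have hΦ : ∀ x y F G u v, Φ x y F G u v = x (F u) * y (G v) := fun _ _ _ _ _ _ => rfl
  set tr : P := algebraMap R P (∑ a, β (e' a) (f (A (e a)))) with htr
  have zero_of : ∀ x : P, x = -x → x = 0 := fun x hx => by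
    have h3 : (2 : ℝ) • x = 0 := by rw [two_smul]; nth_rewrite 1 [hx]; exact neg_add_cancel x
    exact (smul_eq_zero.mp h3).resolve_left two_ne_zero
  -- normal forms of the sums
  have trA : algebraMap R P (∑ a, β (e' a) (A (e a))) = 0 := by
    refine zero_of _ ?_
    have hs := sum_dual_swap (N := R) hβ h2 (β.compl₂ A)
    simp only [LinearMap.compl₂_apply] at hs
    nth_rewrite 1 [← hs]
    rw [← map_neg, ← Finset.sum_neg_distrib]
    congr 1
    refine Finset.sum_congr rfl fun a _ => ?_
    rw [hβ, hA]
  have ipf : ∑ a, ι (e' a) * ψ (f (A (e a))) = tr - ∑ a, ψ (e' a) * ι (f (A (e a))) := by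
    have s0 := swap (Φ ψ ι (f ∘ₗ A) LinearMap.id)
    have s1 := shift A hA (Φ ψ ι f LinearMap.id)
    have s2 := shift f hf (Φ ψ ι LinearMap.id A)
    simp only [hΦ, LinearMap.comp_apply, LinearMap.id_apply] at s0 s1 s2
    rw [s2, neg_neg] at s1
    simp only [hιψ, Finset.sum_sub_distrib, htr, map_sum]
    rw [s0, s1]
    simp only [hAf]
  have ipA : ∑ a, ι (e' a) * ψ (A (e a)) = ∑ a, ψ (e' a) * ι (A (e a)) := by
    have s0 := swap (Φ ψ ι A LinearMap.id)
    have s1 := shift A hA (Φ ψ ι LinearMap.id LinearMap.id)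
    simp only [hΦ, LinearMap.id_apply] at s0 s1
    simp only [hιψ, Finset.sum_sub_distrib, ← map_sum, trA, s0, s1]
    abel
  have ii1 : ∑ a, ι (e a) * ι (e' a) = 0 := by
    refine zero_of _ ?_
    have s0 := swap (Φ ι ι LinearMap.id LinearMap.id)
    simp only [hΦ, LinearMap.id_apply] at s0
    nth_rewrite 1 [s0]
    rw [← Finset.sum_neg_distrib]
    exact Finset.sum_congr rfl fun a _ => hιι _ _
  have iifA : ∑ a, ι (e a) * ι (f (A (e' a))) = 0 := by
    have s0 := swap (Φ ι ι LinearMap.id (f ∘ₗ A))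
    have s3 := swap (Φ ι ι (f ∘ₗ A) LinearMap.id)
    have s1 := shift A hA (Φ ι ι f LinearMap.id)
    have s2 := shift f hf (Φ ι ι LinearMap.id A)
    simp only [hΦ, LinearMap.id_apply, LinearMap.comp_apply] at s0 s1 s2 s3
    rw [s2, neg_neg] at s1
    refine zero_of _ ?_
    rw [s0]
    simp only [hAf] at s1
    nth_rewrite 1 [← s1]
    rw [← s3, ← Finset.sum_neg_distrib]
    exact Finset.sum_congr rfl fun a _ => hιι _ _
  have a1 : ∑ a, ι (f (e' a)) * ψ (A (e a)) = -∑ a, ι (e' a) * ψ (f (A (e a))) := by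
    have s1 := shift f hf (Φ ι ψ LinearMap.id A)
    simpa only [hΦ, LinearMap.id_apply, hAf] using s1
  have a2 : ∑ a, ι (f (e' a)) * ι (f (A (e a))) = -∑ a, ι (e' a) * ι (f (f (A (e a)))) := by
    have s1 := shift f hf (Φ ι ι LinearMap.id (f ∘ₗ A))
    simpa only [hΦ, LinearMap.id_apply, LinearMap.comp_apply, hAf] using s1
  have a3 : ∑ a, ι (f (e a)) * ι (e' a) = -∑ a, ι (e' a) * ι (f (e a)) := by
    have s0 := swap (Φ ι ι f LinearMap.id)
    have s1 := shift f hf (Φ ι ι LinearMap.id LinearMap.id)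
    simp only [hΦ, LinearMap.id_apply] at s0 s1
    rw [s0, s1]
  have a4 : ∑ a, ι (f (e a)) * ψ (A (e' a)) = -∑ a, ι (e' a) * ψ (f (A (e a))) := by
    have s0 := swap (Φ ι ψ f A)
    simp only [hΦ] at s0
    rw [s0, a1]
  have a5 : ∑ a, ι (f (e a)) * ι (f (A (e' a))) = -∑ a, ι (e' a) * ι (f (f (A (e a)))) := by
    have s0 := swap (Φ ι ι f (f ∘ₗ A))
    simp only [hΦ, LinearMap.comp_apply] at s0
    rw [s0, a2]
  have a6 : ∑ a, ι (e a) * ψ (A (e' a)) = ∑ a, ψ (e' a) * ι (A (e a)) := by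
    have s0 := swap (Φ ι ψ LinearMap.id A)
    simp only [hΦ, LinearMap.id_apply] at s0
    rw [s0, ipA]
  -- moving `H` to the right
  have m1 : H * ∑ a, ψ (e' a) * ψ (A (e a)) =
      (∑ a, (ψ (e' a) + ι (f (e' a))) * (ψ (A (e a)) + ι (f (A (e a))))) * H := by
    rw [Finset.mul_sum, Finset.sum_mul]
    refine Finset.sum_congr rfl fun a _ => ?_
    rw [← mul_assoc, hHψ, mul_assoc, hHψ, mul_assoc]
  have m2 : ∀ a, H * (ι (e' a) + ψ (A (e' a))) =
      (ι (e' a) + ψ (A (e' a)) + ι (f (A (e' a)))) * H := fun a => by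
    rw [mul_add, hHι, hHψ]; noncomm_ring
  have m3 : H * ∑ a, ψ (e a) * (ι (e' a) + ψ (A (e' a))) =
      (∑ a, (ψ (e a) + ι (f (e a))) * (ι (e' a) + ψ (A (e' a)) + ι (f (A (e' a))))) * H := by
    rw [Finset.mul_sum, Finset.sum_mul]
    refine Finset.sum_congr rfl fun a _ => ?_
    rw [← mul_assoc, hHψ, mul_assoc, m2, mul_assoc]
  have m4 : ∑ a, (ψ (e a) + (1 / 2 : ℝ) • ι (e a)) * (H * (ι (e' a) + ψ (A (e' a)))) =
      (∑ a, (ψ (e a) + (1 / 2 : ℝ) • ι (e a)) *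
        (ι (e' a) + ψ (A (e' a)) + ι (f (A (e' a))))) * H := by
    rw [Finset.sum_mul]
    refine Finset.sum_congr rfl fun a _ => ?_
    rw [m2, mul_assoc]
  have hsm : ∀ (r : ℝ) v, ι (r • v) = r • ι v := fun r v => LinearMap.map_smul_of_tower ι r v
  rw [mul_add, mul_smul_comm, m1, m3, m4, hH', ← smul_mul_assoc, ← add_mul, ← add_mul, ← add_mul]
  congr 1
  simp only [map_sub, hsm, mul_add, add_mul, mul_sub, mul_smul_comm, smul_mul_assoc,
    Finset.sum_add_distrib, Finset.sum_sub_distrib, ← Finset.smul_sum, a1, a2, a3, a4, a5, a6, ipf,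
    ipA, ii1, iifA]
  module

end Anticommutation

/-! ### Operator-valued power series acting on `S(g) ⊗ V` -/

section SeriesOperators

variable {g : Type*} [AddCommGroup g] [Module ℝ g] {κ : Type*} (e : Module.Basis κ ℝ g)

theorem finsupp_induction_on {P : (κ →₀ ℕ) → Prop} (m : κ →₀ ℕ) (zero : P 0)
    (add : ∀ i j, P i → P j → P (i + j)) (single : ∀ a, P (Finsupp.single a 1)) : P m := by
  induction m using Finsupp.induction_linear with
  | zero => exact zero
  | add i j hi hj => exact add i j hi hj
  | single a n =>
    induction n with
    | zero => rw [Finsupp.single_zero]; exact zero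
    | succ n ih => rw [Finsupp.single_add]; exact add _ _ ih (single a)

theorem SymDegreeLT.symPartial {n : ℕ} {p : SymmetricAlgebra ℝ g} (hp : SymDegreeLT e n p)
    (a : κ) : SymDegreeLT e n (symPartial e a p) := by
  cases n with
  | zero => rw [show p = 0 from hp, map_zero]; exact SymDegreeLT.zero e 0
  | succ n => exact (hp a).succ

theorem symPartial_ι (a : κ) (v : g) :
    symPartial e a (SymmetricAlgebra.ι ℝ g v) = algebraMap ℝ _ (e.coord a v) := by
  simp [symPartial]

theorem symPartial_comm (a b : κ) (p : SymmetricAlgebra ℝ g) :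
    symPartial e a (symPartial e b p) = symPartial e b (symPartial e a p) :=
  LinearMap.congr_fun (symPartial_commute e a b).eq p

variable {V : Type*} [AddCommGroup V] [Module ℝ V]

theorem seriesOp_ext {T T' : Module.End ℝ (SymmetricAlgebra ℝ g ⊗[ℝ] V)}
    (h : ∀ n p v, SymDegreeLT e n p → T (p ⊗ₜ v) = T' (p ⊗ₜ v)) : T = T' :=
  TensorProduct.ext' fun p v => by
    obtain ⟨n, hn⟩ := exists_symDegreeLT e p
    exact h n p v hn

variable [Fintype κ]

theorem symPartialPow_zero : symPartialPow e 0 = 1 := by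
  rw [symPartialPow, Finset.noncommProd_eq_pow_card _ _ _ 1 (fun a _ => by simp), one_pow]

theorem symPartialPow_add (i j : κ →₀ ℕ) :
    symPartialPow e (i + j) = symPartialPow e i * symPartialPow e j := by
  rw [symPartialPow, symPartialPow, symPartialPow, ← Finset.noncommProd_mul_distrib]
  · refine Finset.noncommProd_congr rfl (fun a _ => ?_) _
    rw [Finsupp.add_apply, pow_add, Pi.mul_apply]
  · exact fun a _ b _ _ => (symPartial_commute e a b).pow_pow _ _

theorem symPartialPow_single (a : κ) : symPartialPow e (Finsupp.single a 1) =
    (symPartial e a : SymmetricAlgebra ℝ g →ₗ[ℝ] SymmetricAlgebra ℝ g) := by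
  classical
  have h1 : (Finset.univ.erase a).noncommProd
      (fun b => ((symPartial e b : SymmetricAlgebra ℝ g →ₗ[ℝ] SymmetricAlgebra ℝ g) :
        Module.End ℝ (SymmetricAlgebra ℝ g)) ^ (Finsupp.single a 1 : κ →₀ ℕ) b)
      (symPartial_pow_pairwise e _ _) = 1 := by
    rw [Finset.noncommProd_eq_pow_card _ _ _ 1, one_pow]
    intro b hb
    rw [Finsupp.single_eq_of_ne (Finset.ne_of_mem_erase hb), pow_zero]
  refine (Finset.mul_noncommProd_erase _ (Finset.mem_univ a) _
    (symPartial_pow_pairwise e _ _) (symPartial_pow_pairwise e _ _)).symm.trans ?_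
  rw [h1, mul_one, Finsupp.single_eq_same, pow_one]

theorem SymDegreeLT.symPartialPow {n : ℕ} (m : κ →₀ ℕ) : ∀ {p : SymmetricAlgebra ℝ g},
    SymDegreeLT e n p → SymDegreeLT e n (symPartialPow e m p) := by
  induction m using finsupp_induction_on with
  | zero => intro p hp; rw [symPartialPow_zero]; exact hp
  | add i j hi hj => intro p hp; rw [symPartialPow_add]; exact hi (hj hp)
  | single a => intro p hp; rw [symPartialPow_single]; exact hp.symPartial e a

/-- The Euler operator `∑_a e_a ∂/∂μ_a` on `S(g)`. -/
def symEuler : Module.End ℝ (SymmetricAlgebra ℝ g) :=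
  ∑ a, LinearMap.mulLeft ℝ (SymmetricAlgebra.ι ℝ g (e a)) * (symPartial e a).toLinearMap

theorem symEuler_apply (p : SymmetricAlgebra ℝ g) :
    symEuler e p = ∑ a, SymmetricAlgebra.ι ℝ g (e a) * symPartial e a p := by
  simp [symEuler, LinearMap.sum_apply]

theorem symPartial_symEuler (a : κ) (p : SymmetricAlgebra ℝ g) :
    symPartial e a (symEuler e p) = symEuler e (symPartial e a p) + symPartial e a p := by
  classical
  simp only [symEuler_apply, map_sum, Derivation.leibniz, symPartial_ι, smul_eq_mul,
    Finset.sum_add_distrib, symPartial_comm e a]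
  congr 1
  rw [Finset.sum_eq_single a]
  · simp
  · intro b _ hb; simp [hb]
  · simp

theorem symPartialPow_symEuler (m : κ →₀ ℕ) : ∀ p : SymmetricAlgebra ℝ g,
    symPartialPow e m (symEuler e p) =
      symEuler e (symPartialPow e m p) + (m.degree : ℝ) • symPartialPow e m p := by
  induction m using finsupp_induction_on with
  | zero => intro p; simp [symPartialPow_zero]
  | add i j hi hj =>
    intro p
    rw [symPartialPow_add, Module.End.mul_apply, Module.End.mul_apply, hj, map_add, hi, map_smul,
      map_add, Nat.cast_add]
    module
  | single a =>
    intro p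
    rw [symPartialPow_single, Finsupp.degree_single]
    simpa using symPartial_symEuler e a p

/-- The operator `∑_m ∂^m ⊗ F_m` on `S(g) ⊗ V` defined by a formal power series `F` of
endomorphisms of `V`. -/
def seriesOp (F : MvPowerSeries κ (Module.End ℝ V)) :
    Module.End ℝ (SymmetricAlgebra ℝ g ⊗[ℝ] V) :=
  TensorProduct.lift (symDiffOp e fun m =>
    (LinearMap.lcomp ℝ (SymmetricAlgebra ℝ g ⊗[ℝ] V) (MvPowerSeries.coeff m F)) ∘ₗ
      TensorProduct.mk ℝ (SymmetricAlgebra ℝ g) V)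

theorem seriesOp_tmul (F : MvPowerSeries κ (Module.End ℝ V)) {n : ℕ} {p : SymmetricAlgebra ℝ g}
    (hp : SymDegreeLT e n p) (v : V) : seriesOp e F (p ⊗ₜ v) =
      ∑ m ∈ (Finsupp.finite_of_degree_lt (σ := κ) n).toFinset,
        symPartialPow e m p ⊗ₜ MvPowerSeries.coeff m F v := by
  rw [seriesOp, TensorProduct.lift.tmul]
  change (∑ᶠ m, ((LinearMap.lcomp ℝ (SymmetricAlgebra ℝ g ⊗[ℝ] V) (MvPowerSeries.coeff m F)) ∘ₗ
      TensorProduct.mk ℝ (SymmetricAlgebra ℝ g) V) (symPartialPow e m p)) v = _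
  rw [finsum_eq_sum_of_support_subset (s := (Finsupp.finite_of_degree_lt (σ := κ) n).toFinset),
    LinearMap.sum_apply]
  · rfl
  · intro m hm
    rw [Set.Finite.coe_toFinset]
    by_contra hlt
    refine hm ?_
    change (LinearMap.lcomp ℝ (SymmetricAlgebra ℝ g ⊗[ℝ] V) (MvPowerSeries.coeff m F) ∘ₗ
      TensorProduct.mk ℝ (SymmetricAlgebra ℝ g) V) (symPartialPow e m p) = 0
    rw [symPartialPow_apply_eq_zero e hp m (not_lt.mp hlt), map_zero]

theorem seriesOp_add (F G : MvPowerSeries κ (Module.End ℝ V)) :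
    seriesOp e (F + G) = seriesOp e F + seriesOp e G :=
  seriesOp_ext e fun n p v hp => by
    simp only [LinearMap.add_apply, seriesOp_tmul e _ hp, map_add, TensorProduct.tmul_add,
      Finset.sum_add_distrib]

theorem seriesOp_smul (r : ℝ) (F : MvPowerSeries κ (Module.End ℝ V)) :
    seriesOp e (r • F) = r • seriesOp e F :=
  seriesOp_ext e fun n p v hp => by
    simp only [LinearMap.smul_apply, seriesOp_tmul e _ hp, Finset.smul_sum,
      ← TensorProduct.tmul_smul]
    rfl

theorem seriesOp_mul (F G : MvPowerSeries κ (Module.End ℝ V)) :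
    seriesOp e (F * G) = seriesOp e F * seriesOp e G := by
  classical
  refine seriesOp_ext e fun n p v hp => ?_
  simp only [Module.End.mul_apply, seriesOp_tmul e _ hp, map_sum]
  simp only [seriesOp_tmul e F (hp.symPartialPow e _)]
  set s := (Finsupp.finite_of_degree_lt (σ := κ) n).toFinset with hs
  have hmem : ∀ m, m ∈ s ↔ m.degree < n := fun m => by simp [hs]
  let h : (κ →₀ ℕ) × (κ →₀ ℕ) → SymmetricAlgebra ℝ g ⊗[ℝ] V := fun x =>
    symPartialPow e (x.1 + x.2) p ⊗ₜ
      MvPowerSeries.coeff x.1 F (MvPowerSeries.coeff x.2 G v)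
  have hL : ∀ m ∈ s, symPartialPow e m p ⊗ₜ[ℝ] MvPowerSeries.coeff m (F * G) v =
      ∑ x ∈ s ×ˢ s with x.1 + x.2 = m, h x := fun m hm => by
    rw [MvPowerSeries.coeff_mul, LinearMap.sum_apply, TensorProduct.tmul_sum]
    refine Finset.sum_congr ?_ fun x hx => ?_
    · ext x
      simp only [Finset.HasAntidiagonal.mem_antidiagonal, Finset.mem_filter, Finset.mem_product,
        hmem]
      refine ⟨fun hx => ⟨?_, hx⟩, fun hx => hx.2⟩
      have : x.1.degree + x.2.degree < n := by rw [← map_add, hx]; exact (hmem m).mp hm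
      omega
    · simp only [h, (Finset.mem_filter.mp hx).2, Module.End.mul_apply]
  have hR : ∀ j ∈ s, ∑ i ∈ s, symPartialPow e i (symPartialPow e j p) ⊗ₜ[ℝ]
      MvPowerSeries.coeff i F (MvPowerSeries.coeff j G v) = ∑ i ∈ s, h (i, j) := fun j _ =>
    Finset.sum_congr rfl fun i _ => by simp only [h, symPartialPow_add, Module.End.mul_apply]
  rw [Finset.sum_congr rfl hL, Finset.sum_congr rfl hR, ← Finset.sum_product_right' s s (fun i j => h (i, j))]
  rw [Finset.sum_fiberwise_eq_sum_filter]
  refine Finset.sum_filter_of_ne fun x _ hx => ?_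
  rw [hmem]
  by_contra hlt
  refine hx ?_
  simp only [h, symPartialPow_apply_eq_zero e hp _ (not_lt.mp hlt), TensorProduct.zero_tmul]

theorem seriesOp_monomial (m : κ →₀ ℕ) (T : Module.End ℝ V) :
    seriesOp e (MvPowerSeries.monomial m T) = TensorProduct.map (symPartialPow e m) T := by
  classical
  refine seriesOp_ext e fun n p v hp => ?_
  rw [seriesOp_tmul e _ hp, TensorProduct.map_tmul]
  simp only [MvPowerSeries.coeff_monomial]
  by_cases hm : m.degree < n
  · rw [Finset.sum_eq_single m]
    · simp
    · intro b _ hb; simp [hb]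
    · intro h; exact absurd (by simpa using hm) h
  · rw [symPartialPow_apply_eq_zero e hp m (not_lt.mp hm), TensorProduct.zero_tmul]
    refine Finset.sum_eq_zero fun b hb => ?_
    have : b ≠ m := by rintro rfl; exact hm (by simpa using hb)
    simp [this]

theorem seriesOp_C (T : Module.End ℝ V) :
    seriesOp e (MvPowerSeries.C T) = TensorProduct.map LinearMap.id T := by
  rw [← MvPowerSeries.monomial_zero_eq_C_apply, seriesOp_monomial, symPartialPow_zero]
  rfl

/-- The operators of `seriesOp` form an algebra: `∑_m ∂^m ⊗ F_m` is multiplicative in `F`. -/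
def seriesOpHom : MvPowerSeries κ (Module.End ℝ V) →+*
    Module.End ℝ (SymmetricAlgebra ℝ g ⊗[ℝ] V) where
  toFun := seriesOp e
  map_one' := by
    rw [← map_one (MvPowerSeries.C (σ := κ) (R := Module.End ℝ V)), seriesOp_C]
    exact TensorProduct.map_id
  map_zero' := by simpa using seriesOp_smul e (0 : ℝ) (0 : MvPowerSeries κ (Module.End ℝ V))
  map_add' := seriesOp_add e
  map_mul' := seriesOp_mul e

/-- The Euler operator of `S(g)` acts on operators with constant coefficients through the radial
derivative of their symbols. -/
theorem seriesOp_symEuler (F : MvPowerSeries κ (Module.End ℝ V)) :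
    seriesOp e F * TensorProduct.map (symEuler e) LinearMap.id =
      TensorProduct.map (symEuler e) LinearMap.id * seriesOp e F + seriesOp e (euler F) := by
  refine TensorProduct.ext' fun p v => ?_
  obtain ⟨n₁, h₁⟩ := exists_symDegreeLT e p
  obtain ⟨n₂, h₂⟩ := exists_symDegreeLT e (symEuler e p)
  have hp := h₁.mono e (le_max_left n₁ n₂)
  have hE := h₂.mono e (le_max_right n₁ n₂)
  rw [LinearMap.add_apply, Module.End.mul_apply, Module.End.mul_apply, TensorProduct.map_tmul,
    LinearMap.id_apply, seriesOp_tmul e _ hE, seriesOp_tmul e _ hp, seriesOp_tmul e _ hp, map_sum,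
    ← Finset.sum_add_distrib]
  refine Finset.sum_congr rfl fun m _ => ?_
  rw [symPartialPow_symEuler, TensorProduct.map_tmul, coeff_euler, LinearMap.id_apply,
    TensorProduct.add_tmul, LinearMap.smul_apply, TensorProduct.tmul_smul,
    TensorProduct.smul_tmul']

end SeriesOperators

/-! ### The Weil algebra as a free supercommutative algebra -/

section WeilGenerators

variable {g : Type*} [LieRing g] [LieAlgebra ℝ g] (B : InvariantForm g)
  {κ : Type*} (e : Module.Basis κ ℝ g)

/-- The odd generators `1 ⊗ ξ` of the Weil algebra. -/
def weilOdd : g →ₗ[ℝ] WeilAlgebra g :=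
  TensorProduct.mk ℝ (SymmetricAlgebra ℝ g) (ExteriorAlgebra ℝ g) 1 ∘ₗ ExteriorAlgebra.ι ℝ

theorem weilOdd_apply (ξ : g) : weilOdd ξ = 1 ⊗ₜ ExteriorAlgebra.ι ℝ ξ := rfl

/-- `D` is a derivation of the Weil algebra, twisted by the homomorphism `σ`. -/
def IsTwistedDer (σ : WeilAlgebra g →ₐ[ℝ] WeilAlgebra g)
    (D : WeilAlgebra g →ₗ[ℝ] WeilAlgebra g) : Prop :=
  ∀ x y, D (x * y) = D x * y + σ x * D y

theorem weilParity_weilParity (x : WeilAlgebra g) : weilParity g (weilParity g x) = x := by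
  induction x using TensorProduct.induction_on with
  | zero => simp
  | add a b ha hb => simp only [map_add, ha, hb]
  | tmul p ω => simp [weilParity]

theorem weilParity_tmul (p : SymmetricAlgebra ℝ g) (ω : ExteriorAlgebra ℝ g) :
    weilParity g (p ⊗ₜ ω) = p ⊗ₜ CliffordAlgebra.involute ω := by simp [weilParity]

theorem involute_ext_ι (v : g) :
    CliffordAlgebra.involute (ExteriorAlgebra.ι ℝ v) = -ExteriorAlgebra.ι ℝ v :=
  CliffordAlgebra.involute_ι v

theorem extContr_involute (v : g) (ω : ExteriorAlgebra ℝ g) :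
    extContr B v (CliffordAlgebra.involute ω) = -CliffordAlgebra.involute (extContr B v ω) := by
  induction ω using ExteriorAlgebra.induction with
  | algebraMap r =>
    rw [Algebra.algebraMap_eq_smul_one, map_smul, map_smul, map_smul, map_one, extContr_one]; simp
  | ι w =>
    rw [involute_ext_ι, map_neg, extContr_ι, AlgHom.commutes]
  | mul a b ha hb => rw [map_mul, extContr_mul, extContr_mul, ha, hb, map_add, map_mul, map_mul]
                     simp [add_comm]
  | add a b ha hb => simp only [map_add, ha, hb, neg_add]

theorem isTwistedDer_contr (v : g) : IsTwistedDer (weilParity g)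
    (TensorProduct.map LinearMap.id (extContr B v)) := by
  intro x y
  induction x using TensorProduct.induction_on with
  | zero => simp
  | add a b ha hb => simp only [add_mul, map_add, ha, hb]; abel
  | tmul p ω =>
  induction y using TensorProduct.induction_on with
  | zero => simp
  | add a b ha hb => simp only [mul_add, map_add, ha, hb]; abel
  | tmul r η =>
    simp [weilParity_tmul, extContr_mul, TensorProduct.tmul_add]

theorem isTwistedDer_weilLie (ξ : g) : IsTwistedDer (AlgHom.id ℝ _) (weilLie ξ) := by
  intro x y
  induction x using TensorProduct.induction_on with
  | zero => simp
  | add a b ha hb => simp only [add_mul, map_add, ha, hb]; abel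
  | tmul p ω =>
  induction y using TensorProduct.induction_on with
  | zero => simp
  | add a b ha hb => simp only [mul_add, map_add, ha, hb]; abel
  | tmul r η =>
    have hS : symLie ξ (p * r) = symLie ξ p * r + p * symLie ξ r := by
      simp [symLie, mul_comm, add_comm]
    simp only [weilLie, LinearMap.add_apply, TensorProduct.map_tmul, LinearMap.id_apply,
      Algebra.TensorProduct.tmul_mul_tmul, hS, extLie_mul, TensorProduct.add_tmul,
      TensorProduct.tmul_add, AlgHom.id_apply, add_mul, mul_add]
    abel

theorem extLie_involute (v : g) (ω : ExteriorAlgebra ℝ g) :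
    extLie v (CliffordAlgebra.involute ω) = CliffordAlgebra.involute (extLie v ω) := by
  induction ω using ExteriorAlgebra.induction with
  | algebraMap r => simp [extLie_algebraMap]
  | ι w => simp only [involute_ext_ι, map_neg, extLie_ι]
  | mul a b ha hb => simp only [map_mul, extLie_mul, map_add, ha, hb]
  | add a b ha hb => simp only [map_add, ha, hb]

theorem weilLie_weilParity (v : g) (x : WeilAlgebra g) :
    weilLie v (weilParity g x) = weilParity g (weilLie v x) := by
  induction x using TensorProduct.induction_on with
  | zero => simp
  | add a b ha hb => simp only [map_add, ha, hb]
  | tmul p ω => simp [weilLie, weilParity_tmul, extLie_involute]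

theorem weilLie_odd (ζ ξ : g) : weilLie ζ (weilOdd ξ) = weilOdd ⁅ζ, ξ⁆ := by
  simp [weilLie, weilOdd_apply, extLie_ι, symLie]

/-- The derivative `∂/∂ξ̄^a` with respect to the even generators: on `S(g) ⊗ ∧g` it is
`∂/∂μ_a ⊗ 1`. -/
def weilPartial (a : κ) : WeilAlgebra g →ₗ[ℝ] WeilAlgebra g :=
  TensorProduct.map (symPartial e a).toLinearMap LinearMap.id

theorem isTwistedDer_weilPartial (a : κ) : IsTwistedDer (AlgHom.id ℝ _) (weilPartial e a) := by
  intro x y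
  induction x using TensorProduct.induction_on with
  | zero => simp
  | add a b ha hb => simp only [add_mul, map_add, ha, hb]; abel
  | tmul p ω =>
  induction y using TensorProduct.induction_on with
  | zero => simp
  | add a b ha hb => simp only [mul_add, map_add, ha, hb]; abel
  | tmul r η =>
    simp [weilPartial, TensorProduct.add_tmul, mul_comm, add_comm]

theorem isTwistedDer_partial_mul (b : κ) (v : g) : IsTwistedDer (weilParity g)
    (TensorProduct.map (symPartial e b).toLinearMap
      (LinearMap.mulLeft ℝ (ExteriorAlgebra.ι ℝ v))) := by
  intro x y
  induction x using TensorProduct.induction_on with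
  | zero => simp
  | add a b ha hb => simp only [add_mul, map_add, ha, hb]; abel
  | tmul p ω =>
  induction y using TensorProduct.induction_on with
  | zero => simp
  | add a b ha hb => simp only [mul_add, map_add, ha, hb]; abel
  | tmul r η =>
    have h2 : ExteriorAlgebra.ι ℝ v * (ω * η) =
        CliffordAlgebra.involute ω * (ExteriorAlgebra.ι ℝ v * η) := by
      rw [← mul_assoc, extι_mul, mul_assoc]
    simp only [TensorProduct.map_tmul, Algebra.TensorProduct.tmul_mul_tmul, Derivation.coeFn_coe,
      LinearMap.mulLeft_apply, weilParity_tmul, Derivation.leibniz, smul_eq_mul,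
      TensorProduct.add_tmul]
    rw [add_comm]
    congr 1
    · rw [mul_comm r, mul_assoc]
    · rw [h2]

theorem weilPartial_weilParity (a : κ) (x : WeilAlgebra g) :
    weilPartial e a (weilParity g x) = weilParity g (weilPartial e a x) := by
  induction x using TensorProduct.induction_on with
  | zero => simp
  | add a b ha hb => simp only [map_add, ha, hb]
  | tmul p ω => simp [weilPartial, weilParity_tmul]

theorem weilPartial_odd (a : κ) (ξ : g) : weilPartial e a (weilOdd ξ) = 0 := by
  simp [weilPartial, weilOdd_apply]

variable [Fintype κ] [DecidableEq κ]

/-- The even generators `d(1 ⊗ ξ) = ξ ⊗ 1 + 1 ⊗ λ(ξ)` of the Weil algebra. -/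
def weilEven : g →ₗ[ℝ] WeilAlgebra g := weilDiff B e ∘ₗ weilOdd

theorem weilEven_apply (ξ : g) : weilEven B e ξ =
    SymmetricAlgebra.ι ℝ g ξ ⊗ₜ 1 + 1 ⊗ₜ lambdaMap B e ξ := weilDiff_one_tmul_ι B e ξ

namespace IsTwistedDer

variable {B e} {σ : WeilAlgebra g →ₐ[ℝ] WeilAlgebra g} {D D' : WeilAlgebra g →ₗ[ℝ] WeilAlgebra g}

theorem map_one (h : IsTwistedDer σ D) : D 1 = 0 := by simpa using h 1 1

theorem add (h : IsTwistedDer σ D) (h' : IsTwistedDer σ D') : IsTwistedDer σ (D + D') :=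
  fun x y => by simp only [LinearMap.add_apply, h x y, h' x y, add_mul, mul_add]; abel

theorem zero : IsTwistedDer σ (0 : WeilAlgebra g →ₗ[ℝ] WeilAlgebra g) := fun x y => by simp

theorem smul (r : ℝ) (h : IsTwistedDer σ D) : IsTwistedDer σ (r • D) :=
  fun x y => by simp only [LinearMap.smul_apply, h x y, smul_add, smul_mul_assoc, mul_smul_comm]

theorem sum {ι : Type*} (s : Finset ι) {F : ι → WeilAlgebra g →ₗ[ℝ] WeilAlgebra g}
    (h : ∀ i, IsTwistedDer σ (F i)) : IsTwistedDer σ (∑ i ∈ s, F i) :=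
  Finset.sum_induction F (IsTwistedDer σ) (fun _ _ => add) zero fun i _ => h i

/-- A twisted derivation of the Weil algebra is determined by its values on the generators. -/
theorem ext (h : IsTwistedDer σ D) (h' : IsTwistedDer σ D')
    (heven : ∀ ξ, D (weilEven B e ξ) = D' (weilEven B e ξ))
    (hodd : ∀ ξ, D (weilOdd ξ) = D' (weilOdd ξ)) : D = D' := by
  have hω : ∀ ω : ExteriorAlgebra ℝ g, D (1 ⊗ₜ ω) = D' (1 ⊗ₜ ω) := fun ω => by
    induction ω using ExteriorAlgebra.induction with
    | algebraMap r =>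
      rw [Algebra.algebraMap_eq_smul_one, TensorProduct.tmul_smul, ← Algebra.TensorProduct.one_def,
        map_smul, map_smul, h.map_one, h'.map_one]
    | ι v => exact hodd v
    | mul a b ha hb =>
      have : (1 : SymmetricAlgebra ℝ g) ⊗ₜ[ℝ] (a * b) = (1 ⊗ₜ a) * (1 ⊗ₜ b) := by simp
      rw [this, h, h', ha, hb]
    | add a b ha hb => rw [TensorProduct.tmul_add, map_add, map_add, ha, hb]
  have hp : ∀ p : SymmetricAlgebra ℝ g, D (p ⊗ₜ 1) = D' (p ⊗ₜ 1) := fun p => by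
    induction p using SymmetricAlgebra.induction with
    | algebraMap r =>
      rw [Algebra.algebraMap_eq_smul_one, ← TensorProduct.smul_tmul',
        ← Algebra.TensorProduct.one_def, map_smul, map_smul, h.map_one, h'.map_one]
    | ι v =>
      have := heven v
      rw [weilEven_apply, map_add, map_add, hω] at this
      exact add_right_cancel this
    | mul a b ha hb =>
      have : (a * b) ⊗ₜ[ℝ] (1 : ExteriorAlgebra ℝ g) = (a ⊗ₜ 1) * (b ⊗ₜ 1) := by simp
      rw [this, h, h', ha, hb]
    | add a b ha hb => rw [TensorProduct.add_tmul, map_add, map_add, ha, hb]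
  refine TensorProduct.ext' fun p ω => ?_
  have : p ⊗ₜ[ℝ] ω = (p ⊗ₜ 1) * (1 ⊗ₜ ω) := by simp
  rw [this, h, h', hp, hω]

theorem comp_even_sub (h : IsTwistedDer (AlgHom.id ℝ _) D) (h' : IsTwistedDer σ D')
    (hσ : ∀ x, D (σ x) = σ (D x)) : IsTwistedDer σ (D ∘ₗ D' - D' ∘ₗ D) := fun x y => by
  simp only [LinearMap.sub_apply, LinearMap.comp_apply, h x y, h' x y, map_add, h _ _, h' _ _,
    AlgHom.id_apply, hσ, sub_mul, mul_sub]
  abel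

theorem comp_odd_add {σ : WeilAlgebra g →ₐ[ℝ] WeilAlgebra g} (h : IsTwistedDer σ D)
    (h' : IsTwistedDer σ D') (hσσ : ∀ x, σ (σ x) = x)
    (hσ : ∀ x, D (σ x) = -σ (D x)) (hσ' : ∀ x, D' (σ x) = -σ (D' x)) :
    IsTwistedDer (AlgHom.id ℝ _) (D ∘ₗ D' + D' ∘ₗ D) := fun x y => by
  have hn : ∀ a b : WeilAlgebra g, -a * b = -(a * b) := fun a b => neg_mul a b
  simp only [LinearMap.add_apply, LinearMap.comp_apply, h x y, h' x y, map_add, h _ _, h' _ _,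
    AlgHom.id_apply, hσ, hσ', hσσ, add_mul, mul_add, hn]
  abel

end IsTwistedDer

/-- The derivative with respect to the odd generators, with the even generators
`ξ ⊗ 1 + 1 ⊗ λ(ξ)` held fixed. -/
def weilOddPartial (a : κ) : WeilAlgebra g →ₗ[ℝ] WeilAlgebra g :=
  TensorProduct.map LinearMap.id (extContr B (B.dual e a)) +
    ∑ b, TensorProduct.map (symPartial e b).toLinearMap
      (LinearMap.mulLeft ℝ (ExteriorAlgebra.ι ℝ ⁅e b, B.dual e a⁆))

theorem isTwistedDer_weilOddPartial (a : κ) :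
    IsTwistedDer (weilParity g) (weilOddPartial B e a) :=
  (isTwistedDer_contr B _).add (IsTwistedDer.sum _ fun _ => isTwistedDer_partial_mul e _ _)

theorem isTwistedDer_weilDiff : IsTwistedDer (weilParity g) (weilDiff B e) := weilDiff_mul B e

theorem weilOddPartial_weilParity (a : κ) (x : WeilAlgebra g) :
    weilOddPartial B e a (weilParity g x) = -weilParity g (weilOddPartial B e a x) := by
  induction x using TensorProduct.induction_on with
  | zero => simp
  | add a b ha hb => simp only [map_add, ha, hb, neg_add]
  | tmul p ω =>
    simp [weilOddPartial, weilParity_tmul, extContr_involute, TensorProduct.tmul_neg,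
      LinearMap.sum_apply]
    abel

theorem weilDiff_weilParity (x : WeilAlgebra g) :
    weilDiff B e (weilParity g x) = -weilParity g (weilDiff B e x) := by
  induction x using TensorProduct.induction_on with
  | zero => simp
  | add a b ha hb => simp only [map_add, ha, hb, neg_add]
  | tmul p ω =>
    simp [weilDiff, extDiff, weilParity_tmul, extContr_involute, TensorProduct.tmul_neg,
      LinearMap.sum_apply, extLie_involute]
    abel

theorem weilPartial_even (a : κ) (ξ : g) :
    weilPartial e a (weilEven B e ξ) = e.coord a ξ • 1 := by
  simp [weilPartial, weilEven_apply, symPartial_ι, Algebra.algebraMap_eq_smul_one,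
    Algebra.TensorProduct.one_def, TensorProduct.smul_tmul']

theorem dual_form (a : κ) (ξ : g) : B.form (B.dual e a) ξ = e.coord a ξ := by
  conv_lhs => rw [← e.sum_repr ξ]
  simp only [map_sum, map_smul, LinearMap.BilinForm.apply_dualBasis_left]
  simp

theorem weilOddPartial_odd (a : κ) (ξ : g) :
    weilOddPartial B e a (weilOdd ξ) = e.coord a ξ • 1 := by
  simp [weilOddPartial, weilOdd_apply, extContr_ι, LinearMap.sum_apply, dual_form,
    Algebra.algebraMap_eq_smul_one, Algebra.TensorProduct.one_def]

theorem lambdaMap_eq (ξ : g) : lambdaMap B e ξ = (1 / 2 : ℝ) • ∑ a,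
    ExteriorAlgebra.ι ℝ (B.dual e a) * ExteriorAlgebra.ι ℝ ⁅e a, ξ⁆ := by
  rw [← extDiff_ι]; simp [extDiff, extLie_ι]

theorem form_skew (x y z : g) : B.form ⁅x, y⁆ z = -B.form y ⁅x, z⁆ := by
  rw [← lie_skew, map_neg, LinearMap.neg_apply, B.invariant]

theorem form_comm (x y : g) : B.form x y = B.form y x := B.symm.eq x y

/-- `ι_v λ(ξ) = [v, ξ]`. -/
theorem extContr_lambdaMap (v ξ : g) :
    extContr B v (lambdaMap B e ξ) = ExteriorAlgebra.ι ℝ ⁅v, ξ⁆ := by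
  have h1 : ∑ a, B.form v (B.dual e a) • ExteriorAlgebra.ι ℝ ⁅e a, ξ⁆ =
      ExteriorAlgebra.ι ℝ ⁅v, ξ⁆ := by
    conv_rhs => rw [← sum_form_dual_smul B e v]
    simp only [sum_lie, smul_lie, map_sum, map_smul]
    exact Finset.sum_congr rfl fun a _ => by rw [form_comm]
  have h2 : ∑ a, B.form v ⁅e a, ξ⁆ • ExteriorAlgebra.ι ℝ (B.dual e a) =
      -ExteriorAlgebra.ι ℝ ⁅v, ξ⁆ := by
    conv_rhs => rw [← sum_form_smul_dual B e ⁅v, ξ⁆]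
    simp only [map_sum, map_smul, ← Finset.sum_neg_distrib, ← neg_smul]
    refine Finset.sum_congr rfl fun a _ => ?_
    rw [← lie_skew, map_neg, ← lie_skew v ξ, map_neg, form_comm, form_skew B ξ (e a) v]
  have h3 : ∀ x y : g, extContr B v (ExteriorAlgebra.ι ℝ x * ExteriorAlgebra.ι ℝ y) =
      B.form v x • ExteriorAlgebra.ι ℝ y - B.form v y • ExteriorAlgebra.ι ℝ x := fun x y => by
    rw [extContr_mul, extContr_ι, extContr_ι, involute_ext_ι, ← Algebra.commutes, mul_neg,
      ← Algebra.smul_def, ← Algebra.smul_def, sub_eq_add_neg]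
  rw [lambdaMap_eq]
  simp only [map_smul, map_sum, h3, Finset.sum_sub_distrib, h1, h2]
  module

theorem weilOddPartial_even (a : κ) (ξ : g) : weilOddPartial B e a (weilEven B e ξ) = 0 := by
  have h1 : ∑ b, (e.coord b ξ) • ExteriorAlgebra.ι ℝ ⁅e b, B.dual e a⁆ =
      ExteriorAlgebra.ι ℝ ⁅ξ, B.dual e a⁆ := by
    conv_rhs => rw [← e.sum_repr ξ]
    simp only [sum_lie, smul_lie, map_sum, map_smul]
    rfl
  have h2 : ∑ b, (algebraMap ℝ (SymmetricAlgebra ℝ g) (e.coord b ξ)) ⊗ₜ[ℝ]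
      ExteriorAlgebra.ι ℝ ⁅e b, B.dual e a⁆ = 1 ⊗ₜ ExteriorAlgebra.ι ℝ ⁅ξ, B.dual e a⁆ := by
    rw [← h1, TensorProduct.tmul_sum]
    exact Finset.sum_congr rfl fun b _ => by
      rw [Algebra.algebraMap_eq_smul_one, TensorProduct.smul_tmul]
  simp only [weilOddPartial, weilEven_apply, map_add, LinearMap.add_apply, LinearMap.sum_apply,
    TensorProduct.map_tmul, LinearMap.id_apply, extContr_one, Derivation.coeFn_coe,
    symPartial_ι, LinearMap.mulLeft_apply, mul_one, extContr_lambdaMap, h2,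
    Derivation.map_one_eq_zero, TensorProduct.zero_tmul, TensorProduct.tmul_zero,
    Finset.sum_const_zero, zero_add, add_zero]
  rw [← TensorProduct.tmul_add, ← map_add, ← lie_skew, neg_add_cancel, map_zero,
    TensorProduct.tmul_zero]

theorem weilDiff_even (ξ : g) : weilDiff B e (weilEven B e ξ) = 0 := weilDiff_weilDiff B e _

theorem weilDiff_odd (ξ : g) : weilDiff B e (weilOdd ξ) = weilEven B e ξ := rfl

theorem weilLie_even (ζ ξ : g) : weilLie ζ (weilEven B e ξ) = weilEven B e ⁅ζ, ξ⁆ := by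
  simp [weilLie, weilEven_apply, extLie_one, symLie, ← extDiff_ι, extLie_extDiff, extLie_ι]

theorem weilPartial_weilLie (B : InvariantForm g) (a : κ) (ζ : g) (x : WeilAlgebra g) :
    weilPartial e a (weilLie ζ x) =
      weilLie ζ (weilPartial e a x) + ∑ b, e.coord a ⁅ζ, e b⁆ • weilPartial e b x := by
  have h : weilPartial e a ∘ₗ weilLie ζ - weilLie ζ ∘ₗ weilPartial e a =
      ∑ b, e.coord a ⁅ζ, e b⁆ • weilPartial e b := by
    refine IsTwistedDer.ext (B := B) (e := e) ((isTwistedDer_weilPartial e a).comp_even_sub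
      (isTwistedDer_weilLie ζ) fun x => rfl)
      (IsTwistedDer.sum _ fun b => (isTwistedDer_weilPartial e b).smul _) (fun ξ => ?_) fun ξ => ?_
    · simp only [LinearMap.sub_apply, LinearMap.comp_apply, weilLie_even, weilPartial_even,
        map_smul, (isTwistedDer_weilLie ζ).map_one, smul_zero, sub_zero, LinearMap.sum_apply,
        LinearMap.smul_apply, smul_smul, ← Finset.sum_smul]
      congr 1
      conv_lhs => rw [← e.sum_repr ξ]
      simp only [lie_sum, map_sum, lie_smul, map_smul, smul_eq_mul]
      exact Finset.sum_congr rfl fun b _ => mul_comm _ _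
    · simp [weilLie_odd, weilPartial_odd, LinearMap.sum_apply]
  rw [add_comm, ← sub_eq_iff_eq_add]
  simpa [LinearMap.sum_apply] using LinearMap.congr_fun h x

theorem weilOddPartial_weilLie (a : κ) (ζ : g) (x : WeilAlgebra g) :
    weilOddPartial B e a (weilLie ζ x) =
      weilLie ζ (weilOddPartial B e a x) + ∑ b, e.coord a ⁅ζ, e b⁆ • weilOddPartial B e b x := by
  have h : weilLie ζ ∘ₗ weilOddPartial B e a - weilOddPartial B e a ∘ₗ weilLie ζ =
      ∑ b, (-e.coord a ⁅ζ, e b⁆) • weilOddPartial B e b := by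
    refine IsTwistedDer.ext (B := B) (e := e) ((isTwistedDer_weilLie ζ).comp_even_sub
      (isTwistedDer_weilOddPartial B e a) (weilLie_weilParity ζ))
      (IsTwistedDer.sum _ fun b => (isTwistedDer_weilOddPartial B e b).smul _)
      (fun ξ => ?_) fun ξ => ?_
    · simp [weilLie_even, weilOddPartial_even, LinearMap.sum_apply]
    · simp only [LinearMap.sub_apply, LinearMap.comp_apply, weilLie_odd, weilOddPartial_odd,
        map_smul, (isTwistedDer_weilLie ζ).map_one, smul_zero, zero_sub, LinearMap.sum_apply,
        LinearMap.smul_apply, smul_smul, ← Finset.sum_smul, neg_mul, Finset.sum_neg_distrib,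
        neg_smul]
      congr 2
      conv_lhs => rw [← e.sum_repr ξ]
      simp only [lie_sum, map_sum, lie_smul, map_smul, smul_eq_mul]
      exact Finset.sum_congr rfl fun b _ => mul_comm _ _
  have := LinearMap.congr_fun h x
  simp only [LinearMap.sub_apply, LinearMap.comp_apply, LinearMap.sum_apply, LinearMap.smul_apply,
    neg_smul, Finset.sum_neg_distrib] at this
  rw [sub_eq_iff_eq_add] at this
  rw [this]
  abel

theorem weilPartial_weilDiff (a : κ) (x : WeilAlgebra g) :
    weilPartial e a (weilDiff B e x) =
      weilDiff B e (weilPartial e a x) + weilOddPartial B e a x := by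
  have h : weilPartial e a ∘ₗ weilDiff B e - weilDiff B e ∘ₗ weilPartial e a =
      weilOddPartial B e a := by
    refine IsTwistedDer.ext (B := B) (e := e) ((isTwistedDer_weilPartial e a).comp_even_sub
      (isTwistedDer_weilDiff B e) (weilPartial_weilParity e a))
      (isTwistedDer_weilOddPartial B e a) (fun ξ => ?_) fun ξ => ?_
    · simp [weilDiff_even, weilPartial_even, weilOddPartial_even,
        (isTwistedDer_weilDiff B e).map_one]
    · simp [weilDiff_odd, weilPartial_even, weilOddPartial_odd, weilPartial_odd]
  rw [add_comm, ← sub_eq_iff_eq_add]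
  exact LinearMap.congr_fun h x

theorem weilOddPartial_weilDiff (a : κ) (x : WeilAlgebra g) :
    weilOddPartial B e a (weilDiff B e x) = -weilDiff B e (weilOddPartial B e a x) := by
  have h : weilOddPartial B e a ∘ₗ weilDiff B e + weilDiff B e ∘ₗ weilOddPartial B e a = 0 := by
    refine IsTwistedDer.ext (B := B) (e := e) ((isTwistedDer_weilOddPartial B e a).comp_odd_add
      (isTwistedDer_weilDiff B e) weilParity_weilParity (weilOddPartial_weilParity B e a)
      (weilDiff_weilParity B e)) IsTwistedDer.zero (fun ξ => ?_) fun ξ => ?_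
    · simp [weilDiff_even, weilOddPartial_even]
    · simp [weilDiff_odd, weilOddPartial_even, weilOddPartial_odd,
        (isTwistedDer_weilDiff B e).map_one]
  exact eq_neg_of_add_eq_zero_left (LinearMap.congr_fun h x)

end WeilGenerators

/-! ### Recursive characterization of maps out of the Weil algebra -/

section WeilRecursion

theorem sum_coord_smul {g κ : Type*} [AddCommGroup g] [Module ℝ g] [Fintype κ]
    (e : Module.Basis κ ℝ g) {M : Type*} [AddCommGroup M] [Module ℝ M] (φ : g →ₗ[ℝ] M) (v : g) :
    ∑ a, e.coord a v • φ (e a) = φ v := by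
  conv_rhs => rw [← e.sum_repr v]
  simp only [map_sum, map_smul]
  rfl

variable {g : Type*} [LieRing g] [LieAlgebra ℝ g] (B : InvariantForm g)
  {κ : Type*} [Fintype κ] [DecidableEq κ] (e : Module.Basis κ ℝ g)

/-- The number operator of the Weil algebra for the generators `weilEven` and `weilOdd`. -/
def weilNumber : WeilAlgebra g →ₗ[ℝ] WeilAlgebra g :=
  ∑ a, LinearMap.mulLeft ℝ (weilEven B e (e a)) ∘ₗ weilPartial e a +
    ∑ a, LinearMap.mulLeft ℝ (weilOdd (e a)) ∘ₗ weilOddPartial B e a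

theorem weilNumber_apply (x : WeilAlgebra g) : weilNumber B e x =
    ∑ a, weilEven B e (e a) * weilPartial e a x +
      ∑ a, weilOdd (e a) * weilOddPartial B e a x := by
  simp [weilNumber, LinearMap.sum_apply]

/-- The space spanned by the generators. -/
def weilGen : Submodule ℝ (WeilAlgebra g) :=
  LinearMap.range (weilEven B e) ⊔ LinearMap.range (weilOdd (g := g))

theorem exists_of_mem_weilGen {s : WeilAlgebra g} (hs : s ∈ weilGen B e) :
    ∃ ξ η : g, s = weilEven B e ξ + weilOdd η := by
  obtain ⟨_, ⟨ξ, rfl⟩, _, ⟨η, rfl⟩, rfl⟩ := Submodule.mem_sup.mp hs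
  exact ⟨ξ, η, rfl⟩

/-- The space spanned by the products of `n` generators. -/
def weilPow : ℕ → Submodule ℝ (WeilAlgebra g)
  | 0 => Submodule.span ℝ {1}
  | n + 1 => Submodule.span ℝ {x | ∃ s ∈ weilGen B e, ∃ w ∈ weilPow n, x = s * w}

theorem one_mem_weilPow : (1 : WeilAlgebra g) ∈ weilPow B e 0 :=
  Submodule.mem_span_singleton_self 1

theorem mul_mem_weilPow {n : ℕ} {s w : WeilAlgebra g} (hs : s ∈ weilGen B e)
    (hw : w ∈ weilPow B e n) : s * w ∈ weilPow B e (n + 1) :=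
  Submodule.subset_span ⟨s, hs, w, hw, rfl⟩

/-- Linear induction over `weilPow (n + 1)`. -/
theorem weilPow_succ_induction {n : ℕ} {N : Type*} [AddCommGroup N] [Module ℝ N]
    (K : Submodule ℝ N) (T : WeilAlgebra g →ₗ[ℝ] N)
    (h : ∀ s ∈ weilGen B e, ∀ w ∈ weilPow B e n, T (s * w) ∈ K) :
    ∀ x ∈ weilPow B e (n + 1), T x ∈ K := by
  change Submodule.span ℝ _ ≤ K.comap T
  rw [Submodule.span_le]
  rintro _ ⟨s, hs, w, hw, rfl⟩
  exact h s hs w hw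

theorem weilEven_mem (ξ : g) : weilEven B e ξ ∈ weilGen B e :=
  Submodule.mem_sup_left ⟨ξ, rfl⟩

theorem weilOdd_mem (ξ : g) : weilOdd ξ ∈ weilGen B e :=
  Submodule.mem_sup_right ⟨ξ, rfl⟩

theorem weilOdd_mul_comm (ξ : g) (x : WeilAlgebra g) :
    weilOdd ξ * x = weilParity g x * weilOdd ξ := by
  induction x using TensorProduct.induction_on with
  | zero => simp
  | add a b ha hb => simp only [mul_add, ha, hb, map_add, add_mul]
  | tmul p ω => simp [weilOdd_apply, weilParity_tmul, extι_mul ξ ω]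

theorem lambdaMap_mul_comm (ξ : g) (ω : ExteriorAlgebra ℝ g) :
    lambdaMap B e ξ * ω = ω * lambdaMap B e ξ := by
  have h : ∀ v w : g, ExteriorAlgebra.ι ℝ v * ExteriorAlgebra.ι ℝ w * ω =
      ω * (ExteriorAlgebra.ι ℝ v * ExteriorAlgebra.ι ℝ w) := fun v w => by
    rw [mul_assoc, extι_mul w, ← mul_assoc, extι_mul v, CliffordAlgebra.involute_involute,
      mul_assoc]
  simp only [lambdaMap, smul_mul_assoc, mul_smul_comm, Finset.sum_mul, Finset.mul_sum, h]

theorem weilEven_mul_comm (ξ : g) (x : WeilAlgebra g) :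
    weilEven B e ξ * x = x * weilEven B e ξ := by
  induction x using TensorProduct.induction_on with
  | zero => simp
  | add a b ha hb => simp only [mul_add, ha, hb, add_mul]
  | tmul p ω =>
    simp [weilEven_apply, add_mul, mul_add, lambdaMap_mul_comm, mul_comm p]

theorem weilParity_even (ξ : g) : weilParity g (weilEven B e ξ) = weilEven B e ξ := by
  rw [weilEven_apply, map_add, weilParity_tmul, weilParity_tmul, map_one, ← extDiff_ι,
    involute_extDiff_ι]

theorem weilParity_odd (ξ : g) : weilParity g (weilOdd ξ) = -weilOdd ξ := by
  rw [weilOdd_apply, weilParity_tmul, involute_ext_ι, TensorProduct.tmul_neg]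

theorem mem_iSup_weilPow (x : WeilAlgebra g) : x ∈ ⨆ n : ℕ, weilPow B e n := by
  set T : Submodule ℝ (WeilAlgebra g) := ⨆ n : ℕ, weilPow B e n with hT
  have hgen : ∀ s ∈ weilGen B e, ∀ w ∈ T, s * w ∈ T := fun s hs w hw => by
    induction hw using Submodule.iSup_induction' with
    | mem n w hw =>
      exact Submodule.mem_iSup_of_mem (n + 1) (mul_mem_weilPow B e hs hw)
    | zero => rw [mul_zero]; exact T.zero_mem
    | add v w _ _ hv hw => rw [mul_add]; exact T.add_mem hv hw
  have hω : ∀ ω : ExteriorAlgebra ℝ g, ∀ w ∈ T, ((1 : SymmetricAlgebra ℝ g) ⊗ₜ[ℝ] ω) * w ∈ T :=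
    fun ω => by
      induction ω using ExteriorAlgebra.induction with
      | algebraMap r =>
        intro w hw
        rw [Algebra.algebraMap_eq_smul_one, TensorProduct.tmul_smul, smul_mul_assoc,
          ← Algebra.TensorProduct.one_def, one_mul]
        exact T.smul_mem r hw
      | ι v => exact fun w hw => hgen _ (weilOdd_mem B e v) w hw
      | mul a b ha hb =>
        intro w hw
        have : (1 : SymmetricAlgebra ℝ g) ⊗ₜ[ℝ] (a * b) = (1 ⊗ₜ a) * (1 ⊗ₜ b) := by simp
        rw [this, mul_assoc]
        exact ha _ (hb _ hw)
      | add a b ha hb =>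
        intro w hw
        rw [TensorProduct.tmul_add, add_mul]
        exact T.add_mem (ha w hw) (hb w hw)
  have hp : ∀ p : SymmetricAlgebra ℝ g, ∀ w ∈ T, (p ⊗ₜ[ℝ] (1 : ExteriorAlgebra ℝ g)) * w ∈ T :=
    fun p => by
      induction p using SymmetricAlgebra.induction with
      | algebraMap r =>
        intro w hw
        rw [Algebra.algebraMap_eq_smul_one, ← TensorProduct.smul_tmul', smul_mul_assoc,
          ← Algebra.TensorProduct.one_def, one_mul]
        exact T.smul_mem r hw
      | ι v =>
        intro w hw
        have : SymmetricAlgebra.ι ℝ g v ⊗ₜ[ℝ] (1 : ExteriorAlgebra ℝ g) =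
            weilEven B e v - 1 ⊗ₜ lambdaMap B e v := by rw [weilEven_apply]; abel
        rw [this, sub_mul]
        exact T.sub_mem (hgen _ (weilEven_mem B e v) w hw) (hω _ w hw)
      | mul a b ha hb =>
        intro w hw
        have : (a * b) ⊗ₜ[ℝ] (1 : ExteriorAlgebra ℝ g) = (a ⊗ₜ 1) * (b ⊗ₜ 1) := by simp
        rw [this, mul_assoc]
        exact ha _ (hb _ hw)
      | add a b ha hb =>
        intro w hw
        rw [TensorProduct.add_tmul, add_mul]
        exact T.add_mem (ha w hw) (hb w hw)
  have h1 : (1 : WeilAlgebra g) ∈ T :=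
    Submodule.mem_iSup_of_mem 0 (one_mem_weilPow B e)
  induction x using TensorProduct.induction_on with
  | zero => exact T.zero_mem
  | add a b ha hb => exact T.add_mem ha hb
  | tmul p ω =>
    have : p ⊗ₜ[ℝ] ω = (p ⊗ₜ 1) * ((1 ⊗ₜ ω) * 1) := by simp
    rw [this]
    exact hp p _ (hω ω 1 h1)

/-- Operators that satisfy a (twisted) Leibniz rule and map the generators to scalars lower the
degree in the generators by one. -/
theorem map_weilPow (D : WeilAlgebra g →ₗ[ℝ] WeilAlgebra g) (h1 : D 1 = 0)
    (hD : ∀ s ∈ weilGen B e, ∃ c : ℝ, ∃ s' ∈ weilGen B e, ∀ w, D (s * w) = c • w + s' * D w)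
    (n : ℕ) : ∀ x ∈ weilPow B e (n + 1), D x ∈ weilPow B e n := by
  induction n with
  | zero =>
    refine weilPow_succ_induction B e _ D fun s hs w hw => ?_
    obtain ⟨c, s', _, h⟩ := hD s hs
    obtain ⟨r, rfl⟩ := Submodule.mem_span_singleton.mp hw
    rw [h, map_smul, h1, smul_zero, mul_zero, add_zero]
    exact Submodule.smul_mem _ c hw
  | succ n ih =>
    refine weilPow_succ_induction B e _ D fun s hs w hw => ?_
    obtain ⟨c, s', hs', h⟩ := hD s hs
    rw [h]
    exact Submodule.add_mem _ (Submodule.smul_mem _ c hw) (mul_mem_weilPow B e hs' (ih w hw))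

theorem weilPartial_gen_mul (a : κ) (ξ η : g) (w : WeilAlgebra g) :
    weilPartial e a ((weilEven B e ξ + weilOdd η) * w) =
      e.coord a ξ • w + (weilEven B e ξ + weilOdd η) * weilPartial e a w := by
  rw [isTwistedDer_weilPartial e a, map_add, weilPartial_even, weilPartial_odd, add_zero,
    smul_mul_assoc, one_mul]
  rfl

theorem weilOddPartial_gen_mul (a : κ) (ξ η : g) (w : WeilAlgebra g) :
    weilOddPartial B e a ((weilEven B e ξ + weilOdd η) * w) =
      e.coord a η • w + (weilEven B e ξ - weilOdd η) * weilOddPartial B e a w := by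
  rw [isTwistedDer_weilOddPartial B e a, map_add, weilOddPartial_even, weilOddPartial_odd,
    zero_add, smul_mul_assoc, one_mul, map_add, weilParity_even, weilParity_odd, sub_eq_add_neg]

theorem weilPartial_mem (a : κ) (n : ℕ) (x : WeilAlgebra g) (hx : x ∈ weilPow B e (n + 1)) :
    weilPartial e a x ∈ weilPow B e n := by
  refine map_weilPow B e _ (isTwistedDer_weilPartial e a).map_one (fun s hs => ?_) n x hx
  obtain ⟨ξ, η, rfl⟩ := exists_of_mem_weilGen B e hs
  exact ⟨_, _, hs, weilPartial_gen_mul B e a ξ η⟩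

theorem weilOddPartial_mem (a : κ) (n : ℕ) (x : WeilAlgebra g)
    (hx : x ∈ weilPow B e (n + 1)) : weilOddPartial B e a x ∈ weilPow B e n := by
  refine map_weilPow B e _ (isTwistedDer_weilOddPartial B e a).map_one (fun s hs => ?_) n x hx
  obtain ⟨ξ, η, rfl⟩ := exists_of_mem_weilGen B e hs
  exact ⟨_, _, Submodule.sub_mem _ (weilEven_mem B e ξ) (weilOdd_mem B e η),
    weilOddPartial_gen_mul B e a ξ η⟩

theorem weilNumber_eq (n : ℕ) : ∀ x ∈ weilPow B e n, weilNumber B e x = (n : ℝ) • x := by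
  have hmul : ∀ (ξ η : g) (w : WeilAlgebra g),
      weilNumber B e ((weilEven B e ξ + weilOdd η) * w) =
        (weilEven B e ξ + weilOdd η) * w +
          (weilEven B e ξ + weilOdd η) * weilNumber B e w := fun ξ η w => by
    have h1 : ∑ a, e.coord a ξ • weilEven B e (e a) = weilEven B e ξ := by
      conv_rhs => rw [← e.sum_repr ξ]
      simp only [map_sum, map_smul]
      rfl
    have h2 : ∑ a, e.coord a η • weilOdd (e a) = weilOdd η := by
      conv_rhs => rw [← e.sum_repr η]
      simp only [map_sum, map_smul]
      rfl
    have h3 : ∀ (a : κ) (y : WeilAlgebra g), weilEven B e (e a) * ((weilEven B e ξ + weilOdd η) * y) =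
        (weilEven B e ξ + weilOdd η) * (weilEven B e (e a) * y) := fun a y => by
      rw [← mul_assoc, weilEven_mul_comm, mul_assoc]
    have h4 : ∀ (a : κ) (y : WeilAlgebra g), weilOdd (e a) * ((weilEven B e ξ - weilOdd η) * y) =
        (weilEven B e ξ + weilOdd η) * (weilOdd (e a) * y) := fun a y => by
      rw [← mul_assoc, weilOdd_mul_comm, map_sub, weilParity_even, weilParity_odd, sub_neg_eq_add,
        mul_assoc]
    simp only [weilNumber_apply, weilPartial_gen_mul, weilOddPartial_gen_mul, mul_add, h3, h4,
      mul_smul_comm, Finset.sum_add_distrib, ← smul_mul_assoc, ← Finset.sum_mul, h1, h2,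
      ← Finset.mul_sum]
    rw [add_mul _ _ w]
    abel
  induction n with
  | zero =>
    intro x hx
    obtain ⟨r, rfl⟩ := Submodule.mem_span_singleton.mp hx
    rw [map_smul, weilNumber_apply]
    simp only [(isTwistedDer_weilPartial e _).map_one, (isTwistedDer_weilOddPartial B e _).map_one]
    simp
  | succ n ih =>
    intro x hx
    have := weilPow_succ_induction B e ⊥ (weilNumber B e - ((n + 1 : ℕ) : ℝ) • LinearMap.id)
      (fun s hs w hw => ?_) x hx
    · exact sub_eq_zero.mp ((Submodule.mem_bot ℝ).mp this)
    · obtain ⟨ξ, η, rfl⟩ := exists_of_mem_weilGen B e hs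
      rw [Submodule.mem_bot, LinearMap.sub_apply, LinearMap.smul_apply, LinearMap.id_apply, hmul,
        ih w hw, mul_smul_comm, Nat.cast_succ]
      module

/-- A linear map that satisfies a homogeneous recursion along the generators and vanishes on `1`
is zero. -/
theorem eq_zero_of_weil_recursion {N : Type*} [AddCommGroup N] [Module ℝ N]
    (Z : WeilAlgebra g →ₗ[ℝ] N) (T T' : κ → N →ₗ[ℝ] N) (h1 : Z 1 = 0)
    (h : ∀ x, Z (weilNumber B e x) =
      ∑ a, T a (Z (weilPartial e a x)) + ∑ a, T' a (Z (weilOddPartial B e a x))) : Z = 0 := by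
  have key : ∀ n : ℕ, ∀ x ∈ weilPow B e n, Z x = 0 := fun n => by
    induction n with
    | zero =>
      intro x hx
      obtain ⟨r, rfl⟩ := Submodule.mem_span_singleton.mp hx
      rw [map_smul, h1, smul_zero]
    | succ n ih =>
      intro x hx
      have := h x
      rw [weilNumber_eq B e _ x hx, map_smul] at this
      simp only [ih _ (weilPartial_mem B e _ n x hx), ih _ (weilOddPartial_mem B e _ n x hx),
        map_zero, Finset.sum_const_zero, add_zero] at this
      exact (smul_eq_zero.mp this).resolve_left (by positivity)
  refine LinearMap.ext fun x => ?_
  have hx := mem_iSup_weilPow B e x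
  rw [LinearMap.zero_apply]
  induction hx using Submodule.iSup_induction' with
  | mem n x hx => exact key n x hx
  | zero => exact map_zero Z
  | add x y _ _ hx hy => rw [map_add, hx, hy, add_zero]

theorem weilNumber_weilLie (ζ : g) (x : WeilAlgebra g) :
    weilNumber B e (weilLie ζ x) = weilLie ζ (weilNumber B e x) := by
  have hd : ∀ x y : WeilAlgebra g, weilLie ζ (x * y) = weilLie ζ x * y + x * weilLie ζ y :=
    isTwistedDer_weilLie ζ
  simp only [weilNumber_apply, weilPartial_weilLie e B, weilOddPartial_weilLie, map_add, map_sum, hd,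
    weilLie_even, weilLie_odd, mul_add, Finset.sum_add_distrib, Finset.mul_sum, mul_smul_comm]
  rw [Finset.sum_comm (γ := κ) (f := fun a b => e.coord a ⁅ζ, e b⁆ •
    (weilEven B e (e a) * weilPartial e b x)), Finset.sum_comm (γ := κ) (f := fun a b =>
    e.coord a ⁅ζ, e b⁆ • (weilOdd (e a) * weilOddPartial B e b x))]
  simp only [← smul_mul_assoc, ← Finset.sum_mul, sum_coord_smul]
  abel

theorem weilNumber_weilDiff (x : WeilAlgebra g) :
    weilNumber B e (weilDiff B e x) = weilDiff B e (weilNumber B e x) := by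
  simp only [weilNumber_apply, weilPartial_weilDiff, weilOddPartial_weilDiff, map_add, map_sum,
    weilDiff_mul, weilDiff_even, weilDiff_odd, weilParity_even, weilParity_odd, mul_add,
    Finset.sum_add_distrib, zero_mul, zero_add]
  have hn : ∀ a b : WeilAlgebra g, -a * b = -(a * b) := fun a b => neg_mul a b
  have hn' : ∀ a b : WeilAlgebra g, a * -b = -(a * b) := fun a b => mul_neg a b
  simp only [hn, hn', Finset.sum_neg_distrib]
  abel

variable {A : Type*} [Ring A] [Algebra ℝ A] {Q : WeilAlgebra g →ₗ[ℝ] A} {φ₀ φ₁ : g →ₗ[ℝ] A}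

/-- A supersymmetrization map `Q : Wg → A`, with `φ₀` and `φ₁` its values on the generators,
intertwines `L_ζ` with every derivation of `A` that acts in the same way on generators. -/
theorem intertwines_weilLie
    (hQ : ∀ x, Q (weilNumber B e x) = ∑ a, φ₀ (e a) * Q (weilPartial e a x) +
      ∑ a, φ₁ (e a) * Q (weilOddPartial B e a x)) (ζ : g) (D : A →ₗ[ℝ] A) (h1 : D (Q 1) = 0)
    (h₀ : ∀ ξ y, D (φ₀ ξ * y) = φ₀ ⁅ζ, ξ⁆ * y + φ₀ ξ * D y)
    (h₁ : ∀ ξ y, D (φ₁ ξ * y) = φ₁ ⁅ζ, ξ⁆ * y + φ₁ ξ * D y) : Q ∘ₗ weilLie ζ = D ∘ₗ Q := by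
  refine sub_eq_zero.mp (eq_zero_of_weil_recursion B e _ (fun a => LinearMap.mulLeft ℝ (φ₀ (e a)))
    (fun a => LinearMap.mulLeft ℝ (φ₁ (e a))) ?_ fun x => ?_)
  · simp [(isTwistedDer_weilLie ζ).map_one, h1]
  · simp only [LinearMap.sub_apply, LinearMap.comp_apply, LinearMap.mulLeft_apply]
    rw [← weilNumber_weilLie, hQ, hQ]
    simp only [weilPartial_weilLie e B, weilOddPartial_weilLie, map_add, map_sum, map_smul, h₀, h₁,
      mul_add, mul_sub, Finset.sum_add_distrib, Finset.mul_sum, mul_smul_comm,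
      Finset.sum_sub_distrib]
    rw [Finset.sum_comm (γ := κ) (f := fun a b => e.coord a ⁅ζ, e b⁆ •
      (φ₀ (e a) * Q (weilPartial e b x))), Finset.sum_comm (γ := κ) (f := fun a b =>
      e.coord a ⁅ζ, e b⁆ • (φ₁ (e a) * Q (weilOddPartial B e b x)))]
    simp only [← smul_mul_assoc, ← Finset.sum_mul, sum_coord_smul]
    abel

/-- A supersymmetrization map `Q : Wg → A`, with `φ₀` and `φ₁` its values on the generators,
intertwines the Weil differential with every odd derivation of `A` that acts in the same way on
generators. -/
theorem intertwines_weilDiff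
    (hQ : ∀ x, Q (weilNumber B e x) = ∑ a, φ₀ (e a) * Q (weilPartial e a x) +
      ∑ a, φ₁ (e a) * Q (weilOddPartial B e a x)) (D : A →ₗ[ℝ] A) (h1 : D (Q 1) = 0)
    (h₀ : ∀ ξ y, D (φ₀ ξ * y) = φ₀ ξ * D y)
    (h₁ : ∀ ξ y, D (φ₁ ξ * y) = φ₀ ξ * y - φ₁ ξ * D y) : Q ∘ₗ weilDiff B e = D ∘ₗ Q := by
  refine sub_eq_zero.mp (eq_zero_of_weil_recursion B e _ (fun a => LinearMap.mulLeft ℝ (φ₀ (e a)))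
    (fun a => LinearMap.mulLeft ℝ (-φ₁ (e a))) ?_ fun x => ?_)
  · simp [(isTwistedDer_weilDiff B e).map_one, h1]
  · simp only [LinearMap.sub_apply, LinearMap.comp_apply, LinearMap.mulLeft_apply]
    rw [← weilNumber_weilDiff, hQ, hQ]
    simp only [weilPartial_weilDiff, weilOddPartial_weilDiff, map_add, map_sum, map_neg, h₀, h₁,
      mul_add, mul_sub, Finset.sum_add_distrib, mul_neg, neg_mul, Finset.sum_neg_distrib,
      Finset.sum_sub_distrib]
    abel

end WeilRecursion

/-! ### The symmetrization map -/

section SymRecursion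

variable {g : Type*} [LieRing g] [LieAlgebra ℝ g] {κ : Type*} [Fintype κ]
  (e : Module.Basis κ ℝ g)

theorem prod_swap_succ {M : Type*} [CommMonoid M] {k : ℕ} (F : Fin (k + 1) → M)
    (p : Fin (k + 1)) :
    ∏ j : Fin k, F (Equiv.swap 0 p j.succ) = ∏ j : Fin k, F (p.succAbove j) := by
  classical
  have h1 : ∏ j : Fin k, F (p.succAbove j) = ∏ i ∈ ({p}ᶜ : Finset (Fin (k + 1))), F i := by
    rw [← Fin.image_succAbove_univ, Finset.prod_image]
    exact fun x _ y _ h => Fin.succAbove_right_injective h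
  have h2 : ∏ j : Fin k, F (Equiv.swap 0 p j.succ) =
      ∏ i ∈ ({p}ᶜ : Finset (Fin (k + 1))), F i := by
    have : ({p}ᶜ : Finset (Fin (k + 1))) = Finset.univ.image fun j : Fin k =>
        Equiv.swap 0 p j.succ := by
      ext i
      simp only [Finset.mem_compl, Finset.mem_singleton, Finset.mem_image, Finset.mem_univ,
        true_and]
      constructor
      · intro hi
        have h0 : Equiv.swap 0 p i ≠ 0 := fun h => hi (by
          rw [← Equiv.swap_apply_self 0 p i, h, Equiv.swap_apply_left])
        obtain ⟨j, hj⟩ := Fin.exists_succ_eq.mpr h0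
        exact ⟨j, by rw [hj, Equiv.swap_apply_self]⟩
      · rintro ⟨j, rfl⟩ h
        have := (Equiv.swap 0 p).injective (h.trans (Equiv.swap_apply_left 0 p).symm)
        exact Fin.succ_ne_zero j this
    rw [this, Finset.prod_image]
    exact fun x _ y _ h => Fin.succ_injective _ ((Equiv.swap 0 p).injective h)
  rw [h1, h2]

theorem sym_prod_succ {k : ℕ} (v : Fin (k + 1) → g) :
    ((k : ℝ) + 1) • sym g (∏ i, SymmetricAlgebra.ι ℝ g (v i)) =
      ∑ p, envelopingι g (v p) * sym g (∏ j : Fin k, SymmetricAlgebra.ι ℝ g (v (p.succAbove j))) := by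
  have h1 : ∀ p : Fin (k + 1), sym g (∏ j : Fin k, SymmetricAlgebra.ι ℝ g (v (p.succAbove j))) =
      symMultilinear g k fun j => v (Equiv.swap 0 p j.succ) := fun p => by
    rw [← sym_prod, prod_swap_succ fun i => SymmetricAlgebra.ι ℝ g (v i)]
  have hdef : ∀ (n : ℕ) (w : Fin n → g), symMultilinear g n w = ((n.factorial : ℝ)⁻¹) •
      ∑ σ : Equiv.Perm (Fin n), (List.ofFn fun i => envelopingι g (w (σ i))).prod := fun n w => by
    simp [symMultilinear, MultilinearMap.domDomCongr_apply]
  have hk : ((k.factorial : ℝ)) ≠ 0 := by positivity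
  have hk1 : (k : ℝ) + 1 ≠ 0 := by positivity
  simp only [h1]
  rw [sym_prod, hdef, ← (Equiv.Perm.decomposeFin (n := k)).symm.sum_comp, Fintype.sum_prod_type,
    smul_smul, Finset.smul_sum]
  refine Finset.sum_congr rfl fun p _ => ?_
  rw [hdef, mul_smul_comm, Finset.mul_sum, Nat.factorial_succ]
  push_cast
  rw [mul_inv, mul_inv_cancel_left₀ hk1]
  congr 1
  refine Finset.sum_congr rfl fun τ _ => ?_
  rw [List.ofFn_succ, List.prod_cons, Equiv.Perm.decomposeFin_symm_apply_zero]
  simp only [Equiv.Perm.decomposeFin_symm_apply_succ]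

theorem derivation_prod {A : Type*} [CommRing A] [Algebra ℝ A] (D : Derivation ℝ A A) {k : ℕ}
    (x : Fin (k + 1) → A) : D (∏ i, x i) = ∑ p, D (x p) * ∏ j : Fin k, x (p.succAbove j) := by
  induction k with
  | zero => simp
  | succ k ih =>
    rw [Fin.prod_univ_succ, Derivation.leibniz, ih,
      Fin.sum_univ_succ fun p => D (x p) * ∏ j : Fin (k + 1), x (p.succAbove j)]
    rw [add_comm, smul_eq_mul, smul_eq_mul, mul_comm, Finset.mul_sum]
    congr 1
    refine Finset.sum_congr rfl fun p _ => ?_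
    rw [Fin.prod_univ_succ, Fin.succ_succAbove_zero]
    simp only [Fin.succ_succAbove_succ]
    ring

theorem symmetricAlgebra_lhom_ext {N : Type*} [AddCommGroup N] [Module ℝ N]
    {T T' : SymmetricAlgebra ℝ g →ₗ[ℝ] N}
    (h : ∀ (k : ℕ) (v : Fin k → g), T (∏ i, SymmetricAlgebra.ι ℝ g (v i)) =
      T' (∏ i, SymmetricAlgebra.ι ℝ g (v i))) : T = T' := by
  let s : Submonoid (SymmetricAlgebra ℝ g) :=
    { carrier := {x | ∃ (k : ℕ) (v : Fin k → g), x = ∏ i, SymmetricAlgebra.ι ℝ g (v i)}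
      one_mem' := ⟨0, Fin.elim0, by simp⟩
      mul_mem' := by
        rintro _ _ ⟨k, v, rfl⟩ ⟨l, w, rfl⟩
        exact ⟨k + l, Fin.append v w, by simp [Fin.prod_univ_add]⟩ }
  have htop : Submodule.span ℝ (s : Set (SymmetricAlgebra ℝ g)) = ⊤ := by
    have hs : Algebra.adjoin ℝ (s : Set (SymmetricAlgebra ℝ g)) = ⊤ := by
      rw [eq_top_iff]
      rintro p -
      induction p using SymmetricAlgebra.induction with
      | algebraMap r => exact Subalgebra.algebraMap_mem _ r
      | ι v => exact Algebra.subset_adjoin ⟨1, fun _ => v, by simp⟩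
      | mul a b ha hb => exact Subalgebra.mul_mem _ ha hb
      | add a b ha hb => exact Subalgebra.add_mem _ ha hb
    have := Algebra.adjoin_eq_span (R := ℝ) (s : Set (SymmetricAlgebra ℝ g))
    rw [hs, Submonoid.closure_eq] at this
    simpa using this.symm
  exact LinearMap.ext_on htop fun x ⟨k, v, hx⟩ => by rw [hx, h]

/-- The symmetrization map is determined recursively by `sym ∘ N = ∑_a e_a · (sym ∘ ∂_a)`, with `N`
the Euler operator. -/
theorem sym_symEuler (p : SymmetricAlgebra ℝ g) :
    sym g (symEuler e p) = ∑ a, envelopingι g (e a) * sym g (symPartial e a p) := by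
  have h : sym g ∘ₗ symEuler e = ∑ a, LinearMap.mulLeft ℝ (envelopingι g (e a)) ∘ₗ sym g ∘ₗ
      (symPartial e a).toLinearMap := by
    refine symmetricAlgebra_lhom_ext fun k v => ?_
    simp only [LinearMap.sum_apply, LinearMap.comp_apply, LinearMap.mulLeft_apply,
      Derivation.coeFn_coe, symEuler_apply]
    cases k with
    | zero => simp
    | succ k =>
      have h1 : ∀ w : g, ∑ a, e.coord a w • SymmetricAlgebra.ι ℝ g (e a) =
          SymmetricAlgebra.ι ℝ g w := fun w => sum_coord_smul e _ w
      have h2 : ∀ w : g, ∑ a, e.coord a w • envelopingι g (e a) = envelopingι g w :=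
        fun w => sum_coord_smul e _ w
      simp only [derivation_prod, symPartial_ι, ← Algebra.smul_def, map_sum, map_smul,
        Finset.mul_sum, mul_smul_comm]
      rw [Finset.sum_comm, Finset.sum_comm (γ := κ)]
      simp only [← smul_mul_assoc, ← Finset.sum_mul, h2]
      rw [← sym_prod_succ]
      have h3 : ∀ p : Fin (k + 1), ∑ a, e.coord a (v p) • sym g (SymmetricAlgebra.ι ℝ g (e a) *
          ∏ j, SymmetricAlgebra.ι ℝ g (v (p.succAbove j))) =
          sym g (∏ i, SymmetricAlgebra.ι ℝ g (v i)) := fun p => by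
        simp only [← map_smul, ← map_sum]
        simp only [← smul_mul_assoc, ← Finset.sum_mul, h1]
        rw [← Fin.prod_univ_succAbove fun i => SymmetricAlgebra.ι ℝ g (v i)]
      simp only [h3]
      simp [Finset.sum_const, ← Nat.cast_smul_eq_nsmul ℝ]
  simpa [LinearMap.sum_apply] using LinearMap.congr_fun h p

theorem sym_one : sym g 1 = 1 := by
  have := sym_prod g 0 Fin.elim0
  simpa [symMultilinear, MultilinearMap.domDomCongr_apply] using this

end SymRecursion

/-! ### The Clifford quantization map -/

section CliffordQuantization

variable {g : Type*} [LieRing g] [LieAlgebra ℝ g] (B : InvariantForm g)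

theorem half_form_toQuadraticMap : ((1 / 2 : ℝ) • B.form).toQuadraticMap =
    B.quadraticForm - (0 : QuadraticForm ℝ g) := by
  ext v
  simp [InvariantForm.quadraticForm]

/-- The quantization map `∧g → Cl(g)` defined by iterated contractions. -/
def clChangeForm : ExteriorAlgebra ℝ g →ₗ[ℝ] Cl B :=
  CliffordAlgebra.changeForm (half_form_toQuadraticMap B)

theorem clChangeForm_ι_mul (v : g) (ω : ExteriorAlgebra ℝ g) :
    clChangeForm B (ExteriorAlgebra.ι ℝ v * ω) = CliffordAlgebra.ι B.quadraticForm v *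
      clChangeForm B ω - (1 / 2 : ℝ) • clChangeForm B (extContr B v ω) := by
  refine (CliffordAlgebra.changeForm_ι_mul (half_form_toQuadraticMap B) v ω).trans ?_
  congr 1
  rw [← CliffordAlgebra.changeForm_contractLeft, LinearMap.smul_apply, map_smul,
    LinearMap.smul_apply, map_smul]
  rfl

theorem extContr_ιMulti_eq_zero (x : g) (k : ℕ) (v : Fin k → g) (h : ∀ i, B.form x (v i) = 0) :
    extContr B x (ExteriorAlgebra.ιMulti ℝ k v) = 0 := by
  induction k with
  | zero => rw [ExteriorAlgebra.ιMulti_zero_apply, extContr_one]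
  | succ k ih =>
    rw [ExteriorAlgebra.ιMulti_succ_apply, extContr_mul, extContr_ι, h, map_zero, zero_mul,
      ih (Matrix.vecTail v) fun i => h _, mul_zero, add_zero]

theorem clChangeForm_ιMulti (k : ℕ) (v : Fin k → g) (h : ∀ i j, i ≠ j → B.form (v i) (v j) = 0) :
    clChangeForm B (ExteriorAlgebra.ιMulti ℝ k v) =
      (List.ofFn fun i => CliffordAlgebra.ι B.quadraticForm (v i)).prod := by
  induction k with
  | zero =>
    rw [ExteriorAlgebra.ιMulti_zero_apply, List.ofFn_zero, List.prod_nil]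
    exact CliffordAlgebra.changeForm_one _
  | succ k ih =>
    rw [ExteriorAlgebra.ιMulti_succ_apply, clChangeForm_ι_mul, extContr_ιMulti_eq_zero, map_zero,
      smul_zero, sub_zero, ih (Matrix.vecTail v) fun i j hij => h _ _ fun h' =>
        hij (Fin.succ_injective _ h'), List.ofFn_succ, List.prod_cons]
    · rfl
    · exact fun i => h 0 i.succ (Fin.succ_ne_zero i).symm

/-- It is enough to compare the two maps on products of vectors of an orthogonal basis, which
anticommute in the Clifford algebra. -/
theorem cliffordQuantization_eq [FiniteDimensional ℝ g] :
    cliffordQuantization B = clChangeForm B := by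
  obtain ⟨b, hb⟩ := LinearMap.BilinForm.exists_orthogonal_basis ⟨fun x y => B.symm.eq x y⟩
  refine ExteriorAlgebra.lhom_ext fun k => Module.Basis.ext_alternating b fun c hc => ?_
  have hort : ∀ σ : Equiv.Perm (Fin k), ∀ i j, i ≠ j →
      B.form (b (c (σ i))) (b (c (σ j))) = 0 := fun σ i j hij =>
    hb fun h => hij (σ.injective (hc h))
  change cliffordQuantization B (ExteriorAlgebra.ιMulti ℝ k fun i => b (c i)) =
    clChangeForm B (ExteriorAlgebra.ιMulti ℝ k fun i => b (c i))
  rw [cliffordQuantization_prod]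
  have h1 : ∀ σ : Equiv.Perm (Fin k), (Equiv.Perm.sign σ : ℤ) •
      (List.ofFn fun i => CliffordAlgebra.ι B.quadraticForm (b (c (σ i)))).prod =
      clChangeForm B (ExteriorAlgebra.ιMulti ℝ k fun i => b (c i)) := fun σ => by
    rw [← clChangeForm_ιMulti B k (fun i => b (c (σ i))) (hort σ)]
    have := (ExteriorAlgebra.ιMulti ℝ k).map_perm (fun i => b (c i)) σ
    change ExteriorAlgebra.ιMulti ℝ k (fun i => b (c (σ i))) = _ at this
    rw [this, Units.smul_def, map_zsmul, smul_smul, ← Units.val_mul, Int.units_mul_self,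
      Units.val_one, one_smul]
  simp only [h1, Finset.sum_const, Finset.card_univ, Fintype.card_perm, Fintype.card_fin]
  have hk : ((k.factorial : ℝ)) ≠ 0 := by positivity
  rw [← Nat.cast_smul_eq_nsmul ℝ, smul_smul, inv_mul_cancel₀ hk, one_smul]

/-- Left multiplication by a vector in the Clifford algebra, `v · q(ω) = q(v ∧ ω + ι_v ω / 2)`. -/
theorem ι_mul_cliffordQuantization [FiniteDimensional ℝ g] (v : g) (ω : ExteriorAlgebra ℝ g) :
    CliffordAlgebra.ι B.quadraticForm v * cliffordQuantization B ω =
      cliffordQuantization B (ExteriorAlgebra.ι ℝ v * ω + (1 / 2 : ℝ) • extContr B v ω) := by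
  rw [cliffordQuantization_eq, map_add, clChangeForm_ι_mul, map_smul]
  abel

theorem cliffordQuantization_one [FiniteDimensional ℝ g] : cliffordQuantization B 1 = 1 := by
  rw [cliffordQuantization_eq]
  exact CliffordAlgebra.changeForm_one _

/-- The Clifford quantization map intertwines contractions with graded commutators:
`[v, q(ω)] = q(ι_v ω)`. -/
theorem ι_commutator_cliffordQuantization [FiniteDimensional ℝ g] (v : g)
    (ω : ExteriorAlgebra ℝ g) :
    CliffordAlgebra.ι B.quadraticForm v * cliffordQuantization B ω -
      CliffordAlgebra.involute (cliffordQuantization B ω) * CliffordAlgebra.ι B.quadraticForm v =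
      cliffordQuantization B (extContr B v ω) := by
  rw [cliffordQuantization_eq]
  have h : ∀ x : Cl B, CliffordAlgebra.ι B.quadraticForm v * x - CliffordAlgebra.involute x * CliffordAlgebra.ι B.quadraticForm v = CliffordAlgebra.contractLeft (B.form v) x := fun x => by
    induction x using CliffordAlgebra.left_induction with
    | algebraMap r =>
      rw [CliffordAlgebra.contractLeft_algebraMap, AlgHom.commutes, Algebra.commutes, sub_self]
    | add x y hx hy => rw [map_add, map_add, ← hx, ← hy]; noncomm_ring
    | ι_mul x w hx =>
      rw [CliffordAlgebra.contractLeft_ι_mul, ← hx, map_mul, CliffordAlgebra.involute_ι,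
        Algebra.smul_def, ← Cl.ι_mul_ι_add_swap]
      noncomm_ring
  rw [h]
  exact (CliffordAlgebra.changeForm_contractLeft (half_form_toQuadraticMap B) (B.form v) ω).symm

end CliffordQuantization

/-! ### The non-commutative Weil algebra -/

section NCWeil

variable {g : Type*} [LieRing g] [LieAlgebra ℝ g] (B : InvariantForm g)
  {κ : Type*} [Fintype κ] [DecidableEq κ] (e : Module.Basis κ ℝ g)

/-- The element `γ(ξ) = (1/2) ∑_a e^a [e_a, ξ]` of `Cl(g)`, which generates the adjoint action of
`ξ` on `Cl(g)`; it is the image of `λ(ξ)` under the quantization map. -/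
def spinAd : g →ₗ[ℝ] Cl B :=
  (1 / 2 : ℝ) • ∑ a, LinearMap.mulLeft ℝ (CliffordAlgebra.ι B.quadraticForm (B.dual e a)) ∘ₗ
    CliffordAlgebra.ι B.quadraticForm ∘ₗ (LieAlgebra.ad ℝ g (e a) : g →ₗ[ℝ] g)

theorem spinAd_apply (ξ : g) : spinAd B e ξ = (1 / 2 : ℝ) • ∑ a,
    CliffordAlgebra.ι B.quadraticForm (B.dual e a) *
      CliffordAlgebra.ι B.quadraticForm ⁅e a, ξ⁆ := by
  simp [spinAd]

/-- The odd generators `1 ⊗ ξ` of the non-commutative Weil algebra. -/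
def ncOdd : g →ₗ[ℝ] NCWeilAlgebra B :=
  TensorProduct.mk ℝ (UniversalEnvelopingAlgebra ℝ g) (Cl B) 1 ∘ₗ CliffordAlgebra.ι B.quadraticForm

/-- The even generators `ξ ⊗ 1 + 1 ⊗ γ(ξ)` of the non-commutative Weil algebra. -/
def ncEven : g →ₗ[ℝ] NCWeilAlgebra B :=
  (TensorProduct.mk ℝ (UniversalEnvelopingAlgebra ℝ g) (Cl B)).flip 1 ∘ₗ envelopingι g +
    TensorProduct.mk ℝ (UniversalEnvelopingAlgebra ℝ g) (Cl B) 1 ∘ₗ spinAd B e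

theorem ncOdd_apply (ξ : g) : ncOdd B ξ = 1 ⊗ₜ CliffordAlgebra.ι B.quadraticForm ξ := rfl

theorem ncEven_apply (ξ : g) :
    ncEven B e ξ = envelopingι g ξ ⊗ₜ 1 + 1 ⊗ₜ spinAd B e ξ := rfl

theorem spinAd_commutator_ι (ξ v : g) :
    spinAd B e ξ * CliffordAlgebra.ι B.quadraticForm v -
      CliffordAlgebra.ι B.quadraticForm v * spinAd B e ξ =
        CliffordAlgebra.ι B.quadraticForm ⁅ξ, v⁆ := by
  set c := CliffordAlgebra.ι B.quadraticForm with hc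
  have h : ∀ a, c (B.dual e a) * c ⁅e a, ξ⁆ * c v - c v * (c (B.dual e a) * c ⁅e a, ξ⁆) =
      B.form (e a) ⁅ξ, v⁆ • c (B.dual e a) - B.form (B.dual e a) v • c ⁅e a, ξ⁆ := fun a => by
    have h1 := Cl.ι_mul_ι_add_swap B ⁅e a, ξ⁆ v
    have h2 := Cl.ι_mul_ι_add_swap B (B.dual e a) v
    rw [B.invariant] at h1
    rw [Algebra.smul_def, Algebra.smul_def, Algebra.commutes, ← h1, ← h2]
    noncomm_ring
  have h3 : ∑ a, B.form (e a) ⁅ξ, v⁆ • c (B.dual e a) = c ⁅ξ, v⁆ := by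
    rw [← congrArg c (sum_form_smul_dual B e ⁅ξ, v⁆), map_sum]
    simp only [map_smul]
  have h4 : ∑ a, B.form (B.dual e a) v • c ⁅e a, ξ⁆ = c ⁅v, ξ⁆ := by
    have := congrArg (fun x => c ⁅x, ξ⁆) (sum_form_dual_smul B e v)
    simpa [sum_lie] using this
  rw [spinAd_apply, smul_mul_assoc, mul_smul_comm, ← smul_sub, Finset.sum_mul, Finset.mul_sum,
    ← Finset.sum_sub_distrib]
  simp only [← hc, h, Finset.sum_sub_distrib, h3, h4]
  rw [← lie_skew ξ v, map_neg]
  module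

theorem clLie_ι (ζ ξ : g) : clLie B ζ (CliffordAlgebra.ι B.quadraticForm ξ) =
    CliffordAlgebra.ι B.quadraticForm ⁅ζ, ξ⁆ :=
  cliffordDerivation_ι _ _ _ ξ

theorem clLie_mul (ζ : g) (x y : Cl B) : clLie B ζ (x * y) = clLie B ζ x * y + x * clLie B ζ y :=
  cliffordDerivation_mul _ _ _ x y

theorem clLie_eq (ξ : g) (x : Cl B) : clLie B ξ x = spinAd B e ξ * x - x * spinAd B e ξ := by
  induction x using CliffordAlgebra.induction with
  | algebraMap r =>
    have h : clLie B ξ 1 = 0 := by simpa using clLie_mul B ξ 1 1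
    rw [Algebra.commutes, sub_self, Algebra.algebraMap_eq_smul_one, map_smul, h, smul_zero]
  | ι v => rw [clLie_ι, spinAd_commutator_ι]
  | mul x y hx hy => rw [clLie_mul, hx, hy]; noncomm_ring
  | add x y hx hy => rw [map_add, hx, hy]; noncomm_ring

theorem ncLie_eq (ξ : g) (y : NCWeilAlgebra B) :
    ncLie B ξ y = ncEven B e ξ * y - y * ncEven B e ξ := by
  induction y using TensorProduct.induction_on with
  | zero => simp
  | add x y hx hy => rw [map_add, hx, hy, mul_add, add_mul]; abel
  | tmul u x =>
    simp only [ncLie, ncEven_apply, LinearMap.add_apply, TensorProduct.map_tmul, LinearMap.id_apply,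
      clLie_eq B e, envelopingLie, LinearMap.sub_apply, LinearMap.mulLeft_apply,
      LinearMap.mulRight_apply, add_mul, mul_add, Algebra.TensorProduct.tmul_mul_tmul, one_mul,
      mul_one, TensorProduct.sub_tmul, TensorProduct.tmul_sub]
    abel

theorem ncLie_mul (ζ : g) (x y : NCWeilAlgebra B) :
    ncLie B ζ (x * y) = ncLie B ζ x * y + x * ncLie B ζ y := by
  have hU : ∀ u u' : UniversalEnvelopingAlgebra ℝ g, envelopingLie ζ (u * u') =
      envelopingLie ζ u * u' + u * envelopingLie ζ u' := fun u u' => by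
    simp only [envelopingLie, LinearMap.sub_apply, LinearMap.mulLeft_apply,
      LinearMap.mulRight_apply]
    noncomm_ring
  induction x using TensorProduct.induction_on with
  | zero => simp
  | add a b ha hb => simp only [add_mul, map_add, ha, hb]; abel
  | tmul u a =>
    induction y using TensorProduct.induction_on with
    | zero => simp
    | add a b ha hb => simp only [mul_add, map_add, ha, hb]; abel
    | tmul u' b =>
      simp only [ncLie, LinearMap.add_apply, TensorProduct.map_tmul, LinearMap.id_apply,
        Algebra.TensorProduct.tmul_mul_tmul, hU, clLie_mul, TensorProduct.add_tmul,
        TensorProduct.tmul_add, add_mul, mul_add]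
      abel

theorem envelopingι_lie (ζ ξ : g) : envelopingι g ⁅ζ, ξ⁆ =
    envelopingι g ζ * envelopingι g ξ - envelopingι g ξ * envelopingι g ζ := by
  let _ : LieRing (UniversalEnvelopingAlgebra ℝ g) := LieRing.ofAssociativeRing
  exact (UniversalEnvelopingAlgebra.ι ℝ : g →ₗ⁅ℝ⁆ UniversalEnvelopingAlgebra ℝ g).map_lie ζ ξ

theorem ncLie_ncOdd (ζ ξ : g) : ncLie B ζ (ncOdd B ξ) = ncOdd B ⁅ζ, ξ⁆ := by
  simp [ncLie, ncOdd_apply, clLie_ι, envelopingLie]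

theorem clLie_spinAd (ζ ξ : g) : clLie B ζ (spinAd B e ξ) = spinAd B e ⁅ζ, ξ⁆ := by
  have h := sum_dual_lie B e (LinearMap.mk₂ ℝ (fun u v : g =>
    CliffordAlgebra.ι B.quadraticForm u * CliffordAlgebra.ι B.quadraticForm ⁅v, ξ⁆)
    (by intros; simp [add_mul]) (by intros; simp) (by intros; simp [mul_add])
    (by intros; simp)) ζ
  simp only [LinearMap.mk₂_apply] at h
  rw [spinAd_apply, spinAd_apply, map_smul, map_sum]
  simp only [clLie_mul, clLie_ι, Finset.sum_add_distrib]
  rw [← neg_eq_iff_eq_neg.mpr h, neg_add_eq_sub, ← Finset.sum_sub_distrib]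
  congr 1
  refine Finset.sum_congr rfl fun a _ => ?_
  rw [leibniz_lie ζ, map_add, ← mul_sub, add_sub_cancel_left]

theorem ncLie_ncEven (ζ ξ : g) : ncLie B ζ (ncEven B e ξ) = ncEven B e ⁅ζ, ξ⁆ := by
  have h1 : clLie B ζ 1 = 0 := by simpa using clLie_mul B ζ 1 1
  simp [ncLie, ncEven_apply, clLie_spinAd, envelopingLie, envelopingι_lie, h1,
    TensorProduct.sub_tmul]

theorem cubicElement_eq : cubicElement B e = (1 / 6 : ℝ) • ∑ b, ∑ c,
    CliffordAlgebra.ι B.quadraticForm ⁅e b, e c⁆ *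
      CliffordAlgebra.ι B.quadraticForm (B.dual e b) *
      CliffordAlgebra.ι B.quadraticForm (B.dual e c) := by
  rw [cubicElement, Finset.sum_comm]
  congr 1
  refine Finset.sum_congr rfl fun b _ => ?_
  rw [Finset.sum_comm]
  refine Finset.sum_congr rfl fun c _ => ?_
  conv_rhs => rw [← sum_form_smul_dual B e ⁅e b, e c⁆]
  simp only [map_sum, map_smul, Finset.sum_mul, smul_mul_assoc]

theorem clLie_cubicElement (ξ : g) : clLie B ξ (cubicElement B e) = 0 := by
  set c := CliffordAlgebra.ι B.quadraticForm with hc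
  have h1 : ∀ v w : g, ∑ a, c ⁅⁅ξ, e a⁆, v⁆ * c (B.dual e a) * c w =
      -∑ a, c ⁅e a, v⁆ * c ⁅ξ, B.dual e a⁆ * c w := fun v w => by
    have h := sum_dual_lie B e (LinearMap.mk₂ ℝ (fun x y : g => c ⁅y, v⁆ * c x * c w)
      (by intros; simp [add_mul, mul_add]) (by intros; simp) (by intros; simp [add_mul])
      (by intros; simp)) ξ
    simpa only [LinearMap.mk₂_apply] using h
  have h2 : ∀ v w : g, ∑ a, c ⁅v, ⁅ξ, e a⁆⁆ * c w * c (B.dual e a) =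
      -∑ a, c ⁅v, e a⁆ * c w * c ⁅ξ, B.dual e a⁆ := fun v w => by
    have h := sum_dual_lie B e (LinearMap.mk₂ ℝ (fun x y : g => c ⁅v, y⁆ * c w * c x)
      (by intros; simp [mul_add]) (by intros; simp) (by intros; simp [add_mul])
      (by intros; simp)) ξ
    simpa only [LinearMap.mk₂_apply] using h
  have h3 : ∑ a, ∑ b, c ⁅⁅ξ, e a⁆, e b⁆ * c (B.dual e a) * c (B.dual e b) =
      -∑ a, ∑ b, c ⁅e a, e b⁆ * c ⁅ξ, B.dual e a⁆ * c (B.dual e b) := by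
    rw [Finset.sum_comm, Finset.sum_comm (f := fun a b => c ⁅e a, e b⁆ * _ * _)]
    simp only [h1, Finset.sum_neg_distrib]
  have h4 : ∑ a, ∑ b, c ⁅e a, ⁅ξ, e b⁆⁆ * c (B.dual e a) * c (B.dual e b) =
      -∑ a, ∑ b, c ⁅e a, e b⁆ * c (B.dual e a) * c ⁅ξ, B.dual e b⁆ := by
    simp only [h2, Finset.sum_neg_distrib]
  rw [cubicElement_eq, map_smul, map_sum]
  simp only [map_sum, clLie_mul, ← hc]
  simp only [hc, clLie_ι]
  simp only [← hc, leibniz_lie ξ, map_add, add_mul, Finset.sum_add_distrib, h3, h4]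
  rw [show ∀ x y : Cl B, -x + -y + x + y = 0 from fun x y => by abel, smul_zero]

theorem cubicElement_anticommutator_ι (ξ : g) :
    cubicElement B e * CliffordAlgebra.ι B.quadraticForm ξ +
      CliffordAlgebra.ι B.quadraticForm ξ * cubicElement B e = -spinAd B e ξ := by
  set c := CliffordAlgebra.ι B.quadraticForm with hc
  have hcc : ∀ x y : g, c x * c y = algebraMap ℝ (Cl B) (B.form x y) - c y * c x := fun x y =>
    eq_sub_of_add_eq (Cl.ι_mul_ι_add_swap B x y)
  have h : ∀ x y z : g, c x * c y * c z * c ξ + c ξ * (c x * c y * c z) =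
      B.form z ξ • (c x * c y) - B.form y ξ • (c x * c z) + B.form x ξ • (c y * c z) := by
    intro x y z
    have hs : ∀ (w : g) (u : Cl B), B.form w ξ • u = (c w * c ξ + c ξ * c w) * u := fun w u => by
      rw [Algebra.smul_def, ← Cl.ι_mul_ι_add_swap]
    have hz := (Algebra.commutes (B.form z ξ) (c x * c y)).symm
    have hy := (Algebra.commutes (B.form y ξ) (c x)).symm
    rw [← Cl.ι_mul_ι_add_swap] at hz hy
    rw [hs, hs, hs, ← hz, ← mul_assoc (c y * c ξ + c ξ * c y), ← hy]
    noncomm_ring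
  have hS : ∑ b, c (B.dual e b) * c ⁅e b, ξ⁆ = (2 : ℝ) • spinAd B e ξ := by
    rw [spinAd_apply, smul_smul]; norm_num [hc]
  -- invariance makes the trace of the adjoint action of `ξ` vanish
  have htr : ∑ b, B.form ⁅e b, ξ⁆ (B.dual e b) = 0 := by
    have t1 := sum_dual_lie B e B.form ξ
    have t2 := sum_dual_comm B e (LinearMap.mk₂ ℝ (fun x y : g => B.form ⁅ξ, x⁆ y)
      (by intros; simp) (by intros; simp) (by intros; simp) (by intros; simp))
    simp only [LinearMap.mk₂_apply] at t2
    have t3 : ∀ b, B.form (B.dual e b) ⁅ξ, e b⁆ = B.form ⁅ξ, e b⁆ (B.dual e b) := fun b =>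
      form_comm B _ _
    have t4 : ∀ b, B.form ⁅e b, ξ⁆ (B.dual e b) = -B.form ⁅ξ, e b⁆ (B.dual e b) := fun b => by
      rw [← lie_skew, map_neg, LinearMap.neg_apply]
    simp only [t3] at t1
    simp only [t4, Finset.sum_neg_distrib]
    linarith
  have hT : ∑ b, c ⁅e b, ξ⁆ * c (B.dual e b) = -((2 : ℝ) • spinAd B e ξ) := by
    simp only [hcc ⁅e _, ξ⁆, Finset.sum_sub_distrib, ← map_sum, htr, hS, map_zero, zero_sub]
  have hU : ∑ b, c ⁅ξ, e b⁆ * c (B.dual e b) = (2 : ℝ) • spinAd B e ξ := by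
    have : ∀ b, c ⁅ξ, e b⁆ = -c ⁅e b, ξ⁆ := fun b => by rw [← lie_skew, map_neg]
    simp only [this, neg_mul, Finset.sum_neg_distrib, hT, neg_neg]
  have s1 : ∀ b, ∑ a, B.form (B.dual e a) ξ • (c ⁅e b, e a⁆ * c (B.dual e b)) =
      c ⁅e b, ξ⁆ * c (B.dual e b) := fun b => by
    conv_rhs => rw [← sum_form_dual_smul B e ξ]
    simp [lie_sum, Finset.sum_mul]
  have s2 : ∀ a, ∑ b, B.form (B.dual e b) ξ • (c ⁅e b, e a⁆ * c (B.dual e a)) =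
      c ⁅ξ, e a⁆ * c (B.dual e a) := fun a => by
    conv_rhs => rw [← sum_form_dual_smul B e ξ]
    simp [sum_lie, Finset.sum_mul]
  have s3 : ∀ b, ∑ a, B.form ⁅e b, e a⁆ ξ • (c (B.dual e b) * c (B.dual e a)) =
      -(c (B.dual e b) * c ⁅e b, ξ⁆) := fun b => by
    have : ∀ a, B.form ⁅e b, e a⁆ ξ = -B.form (e a) ⁅e b, ξ⁆ := fun a => form_skew B _ _ _
    simp only [this, neg_smul, Finset.sum_neg_distrib]
    conv_rhs => rw [← sum_form_smul_dual B e ⁅e b, ξ⁆]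
    simp [Finset.mul_sum]
  rw [cubicElement_eq, smul_mul_assoc, mul_smul_comm, ← smul_add]
  simp only [Finset.sum_mul, Finset.mul_sum, ← Finset.sum_add_distrib, ← hc, h]
  simp only [Finset.sum_add_distrib, Finset.sum_sub_distrib, s1, s3]
  rw [Finset.sum_comm (f := fun b a => B.form (B.dual e b) ξ • _)]
  simp only [s2, hT, hU, Finset.sum_neg_distrib, hS]
  module

theorem involute_cubicElement :
    CliffordAlgebra.involute (cubicElement B e) = -cubicElement B e := by
  simp [cubicElement_eq]

theorem ncParity_ncOdd (ξ : g) : ncParity B (ncOdd B ξ) = -ncOdd B ξ := by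
  simp [ncParity, ncOdd_apply, TensorProduct.tmul_neg]

theorem ncParity_ncEven (ξ : g) : ncParity B (ncEven B e ξ) = ncEven B e ξ := by
  simp [ncParity, ncEven_apply, spinAd_apply]

theorem ncParity_dirac : ncParity B (dirac B e) = -dirac B e := by
  simp only [ncParity, dirac, map_sub, map_sum, Algebra.TensorProduct.map_tmul, map_one,
    AlgHom.id_apply, CliffordAlgebra.involute_ι, TensorProduct.tmul_neg, involute_cubicElement,
    Finset.sum_neg_distrib]
  abel

theorem gradedCommutator_of_odd {x : NCWeilAlgebra B} (hx : ncParity B x = -x)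
    (y : NCWeilAlgebra B) : gradedCommutator B x y = x * y - ncParity B y * x := by
  simp only [gradedCommutator, hx, LinearMap.sub_apply, LinearMap.mulLeft_apply,
    LinearMap.comp_apply, LinearMap.mulRight_apply, add_neg_cancel, smul_zero, mul_zero, sub_zero,
    sub_neg_eq_add, AlgHom.toLinearMap_apply]
  rw [← two_smul ℝ x, smul_smul]
  norm_num

theorem ncLie_dirac (ξ : g) : ncLie B ξ (dirac B e) = 0 := by
  have h : ∑ a, envelopingι g ⁅ξ, e a⁆ ⊗ₜ[ℝ] CliffordAlgebra.ι B.quadraticForm (B.dual e a) =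
      -∑ a, envelopingι g (e a) ⊗ₜ[ℝ] CliffordAlgebra.ι B.quadraticForm ⁅ξ, B.dual e a⁆ :=
    sum_dual_lie B e ((TensorProduct.mk ℝ (UniversalEnvelopingAlgebra ℝ g) (Cl B)).compl₁₂
      (envelopingι g) (CliffordAlgebra.ι B.quadraticForm)).flip ξ
  have h1 : ∀ v : g, envelopingLie ξ (envelopingι g v) = envelopingι g ⁅ξ, v⁆ := fun v => by
    simp [envelopingLie, envelopingι_lie]
  have h2 : envelopingLie ξ 1 = 0 := by simp [envelopingLie]
  simp only [ncLie, dirac, map_sub, map_sum, LinearMap.add_apply, TensorProduct.map_tmul,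
    LinearMap.id_apply, h1, h2, clLie_ι, clLie_cubicElement, TensorProduct.zero_tmul,
    TensorProduct.tmul_zero, add_zero, sub_zero, Finset.sum_add_distrib, h, neg_add_cancel]

theorem dirac_anticommutator_ncOdd (ξ : g) :
    dirac B e * ncOdd B ξ + ncOdd B ξ * dirac B e = ncEven B e ξ := by
  have h1 : ∑ a, envelopingι g (e a) ⊗ₜ[ℝ]
      (CliffordAlgebra.ι B.quadraticForm (B.dual e a) * CliffordAlgebra.ι B.quadraticForm ξ +
        CliffordAlgebra.ι B.quadraticForm ξ * CliffordAlgebra.ι B.quadraticForm (B.dual e a)) =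
      envelopingι g ξ ⊗ₜ[ℝ] 1 := by
    conv_rhs => rw [← sum_form_dual_smul B e ξ]
    simp only [Cl.ι_mul_ι_add_swap, Algebra.algebraMap_eq_smul_one, TensorProduct.tmul_smul,
      map_sum, map_smul, TensorProduct.sum_tmul, TensorProduct.smul_tmul']
  have h2 := congrArg (fun x => (1 : UniversalEnvelopingAlgebra ℝ g) ⊗ₜ[ℝ] x)
    (cubicElement_anticommutator_ι B e ξ)
  simp only [TensorProduct.tmul_add, TensorProduct.tmul_neg] at h2
  simp only [TensorProduct.tmul_add, Finset.sum_add_distrib] at h1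
  simp only [dirac, ncOdd_apply, ncEven_apply, sub_mul, mul_sub, Finset.sum_mul, Finset.mul_sum,
    Algebra.TensorProduct.tmul_mul_tmul, one_mul, mul_one]
  rw [← h1, ← neg_eq_iff_eq_neg.mpr h2]
  abel

theorem ncDiff_eq (y : NCWeilAlgebra B) :
    ncDiff B e y = dirac B e * y - ncParity B y * dirac B e :=
  gradedCommutator_of_odd B (ncParity_dirac B e) y

theorem ncDiff_ncOdd_mul (ξ : g) (y : NCWeilAlgebra B) :
    ncDiff B e (ncOdd B ξ * y) = ncEven B e ξ * y - ncOdd B ξ * ncDiff B e y := by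
  rw [ncDiff_eq, ncDiff_eq, map_mul, ncParity_ncOdd, ← dirac_anticommutator_ncOdd B e]
  rw [show ∀ a b : NCWeilAlgebra B, -a * b = -(a * b) from fun a b => neg_mul a b]
  simp only [mul_sub, add_mul, mul_assoc]
  rw [show ∀ a b : NCWeilAlgebra B, -a * b = -(a * b) from fun a b => neg_mul a b]
  simp only [mul_assoc]
  abel

theorem ncDiff_ncEven_mul (ξ : g) (y : NCWeilAlgebra B) :
    ncDiff B e (ncEven B e ξ * y) = ncEven B e ξ * ncDiff B e y := by
  have h := ncLie_dirac B e ξ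
  rw [ncLie_eq B e, sub_eq_zero] at h
  rw [ncDiff_eq, ncDiff_eq, map_mul, ncParity_ncEven, mul_sub, ← mul_assoc, ← h]
  simp only [mul_assoc]

theorem ncDiff_one : ncDiff B e 1 = 0 := by
  rw [ncDiff_eq, map_one, one_mul, mul_one, sub_self]

theorem ncLie_one (ξ : g) : ncLie B ξ 1 = 0 := by
  have h1 : clLie B ξ 1 = 0 := by simpa using clLie_mul B ξ 1 1
  simp [ncLie, Algebra.TensorProduct.one_def, h1, envelopingLie]

theorem ncContr_tmul (ξ : g) (u : UniversalEnvelopingAlgebra ℝ g) (x : Cl B) :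
    ncContr B ξ (u ⊗ₜ x) = u ⊗ₜ (CliffordAlgebra.ι B.quadraticForm ξ * x -
      CliffordAlgebra.involute x * CliffordAlgebra.ι B.quadraticForm ξ) := by
  refine (gradedCommutator_of_odd B (ncParity_ncOdd B ξ) _).trans ?_
  simp [ncParity, ncOdd_apply, TensorProduct.tmul_sub]

end NCWeil

/-! ### Creation and annihilation operators over formal power series -/

section SeriesModule

variable {g : Type*} [LieRing g] [LieAlgebra ℝ g] (B : InvariantForm g)
  {κ : Type*} {V : Type*} [AddCommGroup V] [Module ℝ V]

/-- Power series of endomorphisms form an algebra over the scalar power series. -/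
instance seriesAlgebra : Algebra (MvPowerSeries κ ℝ) (MvPowerSeries κ (Module.End ℝ V)) :=
  RingHom.toAlgebra' (MvPowerSeries.map (algebraMap ℝ (Module.End ℝ V))) fun r F => by
    classical
    ext1 m
    rw [MvPowerSeries.coeff_mul, MvPowerSeries.coeff_mul]
    have hs : ∀ p ∈ Finset.HasAntidiagonal.antidiagonal m, p.swap ∈ Finset.HasAntidiagonal.antidiagonal m := fun p hp => by
      rw [Finset.HasAntidiagonal.mem_antidiagonal] at hp ⊢
      exact (add_comm _ _).trans hp
    refine Finset.sum_nbij' Prod.swap Prod.swap hs hs (fun _ _ => rfl) (fun _ _ => rfl)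
      fun p _ => ?_
    rw [MvPowerSeries.coeff_map, MvPowerSeries.coeff_map]
    exact Algebra.commutes _ _

theorem algebraMap_seriesAlgebra (r : MvPowerSeries κ ℝ) :
    algebraMap (MvPowerSeries κ ℝ) (MvPowerSeries κ (Module.End ℝ V)) r =
      MvPowerSeries.map (algebraMap ℝ (Module.End ℝ V)) r := rfl

instance seriesAlgebra_isScalarTower :
    IsScalarTower ℝ (MvPowerSeries κ ℝ) (MvPowerSeries κ (Module.End ℝ V)) :=
  IsScalarTower.of_algebraMap_eq fun r => by
    classical
    rw [algebraMap_seriesAlgebra]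
    ext1 m
    simp only [MvPowerSeries.algebraMap_apply, MvPowerSeries.coeff_map, MvPowerSeries.coeff_C]
    split_ifs <;> simp

theorem coeff_smul_C (r : MvPowerSeries κ ℝ) (T : Module.End ℝ V) (m : κ →₀ ℕ) :
    MvPowerSeries.coeff m (r • (MvPowerSeries.C T : MvPowerSeries κ (Module.End ℝ V))) =
      MvPowerSeries.coeff m r • T := by
  rw [Algebra.smul_def, algebraMap_seriesAlgebra, MvPowerSeries.coeff_mul_C,
    MvPowerSeries.coeff_map, Algebra.smul_def]

variable (κ) in
/-- The extension of a linear map `g → End V` to formal power series with values in `g`. -/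
def seriesLift (T : g →ₗ[ℝ] Module.End ℝ V) :
    MvPowerSeries κ ℝ ⊗[ℝ] g →ₗ[MvPowerSeries κ ℝ] MvPowerSeries κ (Module.End ℝ V) :=
  LinearMap.liftBaseChange (MvPowerSeries κ ℝ)
    ((MvPowerSeries.monomial (0 : κ →₀ ℕ)).restrictScalars ℝ ∘ₗ T)

theorem seriesLift_one_tmul (T : g →ₗ[ℝ] Module.End ℝ V) (v : g) :
    seriesLift κ T (1 ⊗ₜ v) = MvPowerSeries.C (T v) := by
  rw [seriesLift, LinearMap.liftBaseChange_tmul, one_smul]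
  rfl

variable (κ) in
/-- The invariant form, extended to formal power series with values in `g`. -/
def seriesForm : LinearMap.BilinForm (MvPowerSeries κ ℝ) (MvPowerSeries κ ℝ ⊗[ℝ] g) :=
  B.form.baseChange (MvPowerSeries κ ℝ)

theorem seriesForm_one_tmul (u v : g) :
    seriesForm B κ (1 ⊗ₜ u) (1 ⊗ₜ v) = MvPowerSeries.C (B.form u v) := by
  rw [seriesForm, LinearMap.BilinForm.baseChange_tmul, one_mul, MvPowerSeries.smul_eq_C_mul,
    mul_one]

theorem seriesForm_comm (x y : MvPowerSeries κ ℝ ⊗[ℝ] g) :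
    seriesForm B κ x y = seriesForm B κ y x :=
  (LinearMap.BilinForm.IsSymm.baseChange (MvPowerSeries κ ℝ) (B₂ := B.form)
    ⟨fun u v => B.symm.eq u v⟩).eq x y

/-- Bilinear relations between lifts can be checked on `g`. -/
theorem seriesLift_relation {T T' T'' T''' : g →ₗ[ℝ] Module.End ℝ V}
    {β : LinearMap.BilinForm ℝ g} (h : ∀ u v, T u * T' v = algebraMap ℝ _ (β u v) - T'' v * T''' u)
    (x y : MvPowerSeries κ ℝ ⊗[ℝ] g) : seriesLift κ T x * seriesLift κ T' y =
      algebraMap (MvPowerSeries κ ℝ) _ (β.baseChange (MvPowerSeries κ ℝ) x y) -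
        seriesLift κ T'' y * seriesLift κ T''' x := by
  have hr : ∀ (r : MvPowerSeries κ ℝ) (u : g), r ⊗ₜ[ℝ] u = r • (1 ⊗ₜ u) := fun r u => by
    rw [TensorProduct.smul_tmul', smul_eq_mul, mul_one]
  have h1 : ∀ u v : g, seriesLift κ T (1 ⊗ₜ u) * seriesLift κ T' (1 ⊗ₜ v) =
      algebraMap (MvPowerSeries κ ℝ) _ (β.baseChange (MvPowerSeries κ ℝ) (1 ⊗ₜ u) (1 ⊗ₜ v)) -
        seriesLift κ T'' (1 ⊗ₜ v) * seriesLift κ T''' (1 ⊗ₜ u) := fun u v => by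
    simp only [seriesLift_one_tmul]
    rw [← map_mul, h, map_sub, map_mul, LinearMap.BilinForm.baseChange_tmul, one_mul,
      MvPowerSeries.smul_eq_C_mul, mul_one, algebraMap_seriesAlgebra, MvPowerSeries.map_C]
  induction x using TensorProduct.induction_on with
  | zero => simp
  | add x x' hx hx' => simp only [map_add, LinearMap.add_apply, hx, hx', add_mul, mul_add]; abel
  | tmul r u =>
    induction y using TensorProduct.induction_on with
    | zero => simp
    | add y y' hy hy' => simp only [map_add, hy, hy', add_mul, mul_add]; abel
    | tmul s v =>
      rw [hr r, hr s]
      simp only [map_smul, LinearMap.smul_apply, smul_mul_assoc, mul_smul_comm, h1, smul_eq_mul,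
        map_mul, ← Algebra.smul_def, smul_sub, smul_comm r s]

variable [Fintype κ] [DecidableEq κ] (e : Module.Basis κ ℝ g)

/-- A formal power series of endomorphisms of `g` acts on formal power series with values in
`g`. -/
def seriesAct : MvPowerSeries κ (Module.End ℝ g) →+*
    Module.End (MvPowerSeries κ ℝ) (MvPowerSeries κ ℝ ⊗[ℝ] g) :=
  ((Matrix.toLinAlgEquiv (Algebra.TensorProduct.basis (MvPowerSeries κ ℝ) e)).toRingEquiv :
    Matrix κ κ (MvPowerSeries κ ℝ) →+* _).comp (matrixSeries e)

theorem seriesAct_basis (F : MvPowerSeries κ (Module.End ℝ g)) (b : κ) :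
    seriesAct e F (1 ⊗ₜ e b) = ∑ a, matrixSeries e F a b • (1 ⊗ₜ[ℝ] e a) := by
  have h := Matrix.toLinAlgEquiv_self (Algebra.TensorProduct.basis (MvPowerSeries κ ℝ) e)
    (matrixSeries e F) b
  simp only [Algebra.TensorProduct.basis_apply] at h
  exact h

theorem sum_toMatrix_smul (T : Module.End ℝ g) (b : κ) :
    ∑ a, LinearMap.toMatrix e e T a b • e a = T (e b) := by
  simp only [LinearMap.toMatrix_apply]
  exact e.sum_repr (T (e b))

theorem coeff_seriesLift (T : g →ₗ[ℝ] Module.End ℝ V) (F : MvPowerSeries κ (Module.End ℝ g))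
    (v : g) (m : κ →₀ ℕ) : MvPowerSeries.coeff m (seriesLift κ T (seriesAct e F (1 ⊗ₜ v))) =
      T (MvPowerSeries.coeff m F v) := by
  have h : ∀ b, MvPowerSeries.coeff m (seriesLift κ T (seriesAct e F (1 ⊗ₜ e b))) =
      T (MvPowerSeries.coeff m F (e b)) := fun b => by
    rw [seriesAct_basis, map_sum, map_sum, ← sum_toMatrix_smul e, map_sum]
    refine Finset.sum_congr rfl fun a _ => ?_
    rw [map_smul, seriesLift_one_tmul, coeff_smul_C, map_smul, coeff_matrixSeries]
  have h2 : ((MvPowerSeries.coeff m).restrictScalars ℝ ∘ₗ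
      (seriesLift κ T ∘ₗ seriesAct e F).restrictScalars ℝ ∘ₗ
        TensorProduct.mk ℝ (MvPowerSeries κ ℝ) g 1 : g →ₗ[ℝ] Module.End ℝ V) =
      T ∘ₗ MvPowerSeries.coeff m F := e.ext h
  exact LinearMap.congr_fun h2 v

theorem coeff_seriesForm (F : MvPowerSeries κ (Module.End ℝ g)) (u v : g) (m : κ →₀ ℕ) :
    MvPowerSeries.coeff m (seriesForm B κ (seriesAct e F (1 ⊗ₜ u)) (1 ⊗ₜ v)) =
      B.form (MvPowerSeries.coeff m F u) v := by
  have h : ∀ b, MvPowerSeries.coeff m (seriesForm B κ (seriesAct e F (1 ⊗ₜ e b)) (1 ⊗ₜ v)) =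
      B.form (MvPowerSeries.coeff m F (e b)) v := fun b => by
    rw [seriesAct_basis, map_sum, LinearMap.sum_apply, map_sum, ← sum_toMatrix_smul e, map_sum,
      LinearMap.sum_apply]
    refine Finset.sum_congr rfl fun a _ => ?_
    rw [map_smul, LinearMap.smul_apply, seriesForm_one_tmul, smul_eq_mul,
      MvPowerSeries.coeff_mul_C, map_smul, LinearMap.smul_apply, coeff_matrixSeries, smul_eq_mul]
  have h2 : ((MvPowerSeries.coeff m).restrictScalars ℝ ∘ₗ
      ((seriesForm B κ).flip (1 ⊗ₜ v) ∘ₗ seriesAct e F).restrictScalars ℝ ∘ₗ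
        TensorProduct.mk ℝ (MvPowerSeries κ ℝ) g 1 : g →ₗ[ℝ] ℝ) =
      B.form.flip v ∘ₗ MvPowerSeries.coeff m F := e.ext h
  exact LinearMap.congr_fun h2 u

theorem sum_seriesForm_dual_smul (x : MvPowerSeries κ ℝ ⊗[ℝ] g) :
    ∑ a, seriesForm B κ (1 ⊗ₜ B.dual e a) x • ((1 : MvPowerSeries κ ℝ) ⊗ₜ[ℝ] e a) = x := by
  induction x using TensorProduct.induction_on with
  | zero => simp
  | add x y hx hy => simp only [map_add, add_smul, Finset.sum_add_distrib, hx, hy]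
  | tmul r v =>
    conv_rhs => rw [← sum_form_dual_smul B e v, TensorProduct.tmul_sum]
    refine Finset.sum_congr rfl fun a _ => ?_
    rw [seriesForm, LinearMap.BilinForm.baseChange_tmul, one_mul, TensorProduct.tmul_smul,
      TensorProduct.smul_tmul', TensorProduct.smul_tmul', smul_eq_mul, mul_one]

theorem sum_seriesForm_smul_dual (x : MvPowerSeries κ ℝ ⊗[ℝ] g) :
    ∑ a, seriesForm B κ (1 ⊗ₜ e a) x • ((1 : MvPowerSeries κ ℝ) ⊗ₜ[ℝ] B.dual e a) = x := by
  induction x using TensorProduct.induction_on with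
  | zero => simp
  | add x y hx hy => simp only [map_add, add_smul, Finset.sum_add_distrib, hx, hy]
  | tmul r v =>
    conv_rhs => rw [← sum_form_smul_dual B e v, TensorProduct.tmul_sum]
    refine Finset.sum_congr rfl fun a _ => ?_
    rw [seriesForm, LinearMap.BilinForm.baseChange_tmul, one_mul, TensorProduct.tmul_smul,
      TensorProduct.smul_tmul', TensorProduct.smul_tmul', smul_eq_mul, mul_one]

/-- Skewness can be checked on coefficients. -/
theorem seriesAct_skew {F : MvPowerSeries κ (Module.End ℝ g)}
    (hF : ∀ m u v, B.form (MvPowerSeries.coeff m F u) v = -B.form u (MvPowerSeries.coeff m F v))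
    (x y : MvPowerSeries κ ℝ ⊗[ℝ] g) :
    seriesForm B κ (seriesAct e F x) y = -seriesForm B κ x (seriesAct e F y) := by
  have h : ∀ u v : g, seriesForm B κ (seriesAct e F (1 ⊗ₜ u)) (1 ⊗ₜ v) =
      -seriesForm B κ (1 ⊗ₜ u) (seriesAct e F (1 ⊗ₜ v)) := fun u v => by
    ext m
    rw [seriesForm_comm B (1 ⊗ₜ u), map_neg, coeff_seriesForm, coeff_seriesForm, hF,
      form_comm B u]
  have hr : ∀ (r : MvPowerSeries κ ℝ) (u : g), r ⊗ₜ[ℝ] u = r • (1 ⊗ₜ u) := fun r u => by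
    rw [TensorProduct.smul_tmul', smul_eq_mul, mul_one]
  induction x using TensorProduct.induction_on with
  | zero => simp
  | add x x' hx hx' => simp only [map_add, LinearMap.add_apply, hx, hx', neg_add]
  | tmul r u =>
    induction y using TensorProduct.induction_on with
    | zero => simp
    | add y y' hy hy' => simp only [map_add, hy, hy', neg_add]
    | tmul s v =>
      rw [hr r, hr s]
      simp only [map_smul, LinearMap.smul_apply, h, smul_neg]

end SeriesModule

/-! ### The operator `ι(𝒮)` -/

section SOperator

variable {g : Type*} [LieRing g] [LieAlgebra ℝ g] (B : InvariantForm g)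
  {κ : Type*}

/-- Exterior multiplication by vectors. -/
def extMul : g →ₗ[ℝ] Module.End ℝ (ExteriorAlgebra ℝ g) :=
  LinearMap.mul ℝ (ExteriorAlgebra ℝ g) ∘ₗ ExteriorAlgebra.ι ℝ

theorem extMul_apply (v : g) (ω : ExteriorAlgebra ℝ g) :
    extMul v ω = ExteriorAlgebra.ι ℝ v * ω := rfl

variable (g κ) in
/-- The operators of exterior multiplication, over the formal power series. -/
def psiSeries : MvPowerSeries κ ℝ ⊗[ℝ] g →ₗ[MvPowerSeries κ ℝ]
    MvPowerSeries κ (Module.End ℝ (ExteriorAlgebra ℝ g)) :=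
  seriesLift κ extMul

variable (κ) in
/-- The contraction operators, over the formal power series. -/
def iotaSeries : MvPowerSeries κ ℝ ⊗[ℝ] g →ₗ[MvPowerSeries κ ℝ]
    MvPowerSeries κ (Module.End ℝ (ExteriorAlgebra ℝ g)) :=
  seriesLift κ (extContr B)

theorem extContr_anticommute (u v : g) :
    extContr B u * extContr B v = -(extContr B v * extContr B u) :=
  LinearMap.ext fun x => CliffordAlgebra.contractLeft_comm (B.form u) (B.form v) x

theorem iotaSeries_anticommute (x y : MvPowerSeries κ ℝ ⊗[ℝ] g) :
    iotaSeries B κ x * iotaSeries B κ y = -(iotaSeries B κ y * iotaSeries B κ x) := by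
  have h := seriesLift_relation (κ := κ) (β := (0 : LinearMap.BilinForm ℝ g))
    (T := extContr B) (T' := extContr B) (T'' := extContr B) (T''' := extContr B)
    (fun u v => by simp [extContr_anticommute B u v]) x y
  rw [LinearMap.BilinForm.baseChange_zero] at h
  simpa [iotaSeries] using h

theorem iotaSeries_psiSeries (x y : MvPowerSeries κ ℝ ⊗[ℝ] g) :
    iotaSeries B κ x * psiSeries g κ y =
      algebraMap (MvPowerSeries κ ℝ) _ (seriesForm B κ x y) -
        psiSeries g κ y * iotaSeries B κ x :=
  seriesLift_relation (κ := κ) (β := B.form)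
    (T := extContr B) (T' := extMul) (T'' := extMul) (T''' := extContr B)
    (fun u v => LinearMap.ext fun ω => by
      change extContr B u (ExteriorAlgebra.ι ℝ v * ω) = algebraMap ℝ
        (Module.End ℝ (ExteriorAlgebra ℝ g)) (B.form u v) ω - ExteriorAlgebra.ι ℝ v * extContr B u ω
      rw [extContr_mul, extContr_ι, involute_ext_ι, Module.algebraMap_end_apply, Algebra.smul_def,
        neg_mul, sub_eq_add_neg]) x y

variable [Fintype κ] [DecidableEq κ] (e : Module.Basis κ ℝ g)

theorem form_coeff_ad_pow (n : ℕ) (m : κ →₀ ℕ) (u v : g) :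
    B.form (MvPowerSeries.coeff m (adSeries e ^ n) u) v =
      (-1) ^ n * B.form u (MvPowerSeries.coeff m (adSeries e ^ n) v) := by
  induction n generalizing m u v with
  | zero =>
    rw [pow_zero, MvPowerSeries.coeff_one]
    split_ifs <;> simp
  | succ n ih =>
    have h1 : ∀ m u v, B.form (MvPowerSeries.coeff m (adSeries e) u) v =
        -B.form u (MvPowerSeries.coeff m (adSeries e) v) := fun m u v => by
      simp only [coeff_adSeries, LinearMap.sum_apply, map_sum, ← Finset.sum_neg_distrib]
      refine Finset.sum_congr rfl fun a _ => ?_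
      split_ifs
      · exact form_skew B _ _ _
      · simp
    have hs : ∀ p ∈ Finset.HasAntidiagonal.antidiagonal m,
        p.swap ∈ Finset.HasAntidiagonal.antidiagonal m := fun p hp => by
      rw [Finset.HasAntidiagonal.mem_antidiagonal] at hp ⊢
      exact (add_comm _ _).trans hp
    conv_lhs => rw [pow_succ, MvPowerSeries.coeff_mul]
    conv_rhs => rw [pow_succ' (adSeries e), MvPowerSeries.coeff_mul]
    simp only [LinearMap.sum_apply, map_sum, Module.End.mul_apply, Finset.mul_sum]
    refine Finset.sum_nbij' Prod.swap Prod.swap hs hs (fun _ _ => rfl) (fun _ _ => rfl)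
      fun p _ => ?_
    rw [ih, h1, Prod.fst_swap, Prod.snd_swap]
    ring

theorem form_coeff_formalEval_ad {φ : PowerSeries ℝ} (hφ : ∀ n, Even n → PowerSeries.coeff n φ = 0)
    (m : κ →₀ ℕ) (u v : g) :
    B.form (MvPowerSeries.coeff m (formalEval φ (adSeries e)) u) v =
      -B.form u (MvPowerSeries.coeff m (formalEval φ (adSeries e)) v) := by
  simp only [coeff_formalEval_def, LinearMap.sum_apply, map_sum, LinearMap.smul_apply, map_smul,
    form_coeff_ad_pow, ← Finset.sum_neg_distrib]
  refine Finset.sum_congr rfl fun n _ => ?_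
  by_cases hn : Even n
  · simp [hφ n hn]
  · rw [(Nat.not_even_iff_odd.mp hn).neg_one_pow]
    simp

variable (κ) in
/-- The constant formal power series with value `v ∈ g`. -/
abbrev constVec (v : g) : MvPowerSeries κ ℝ ⊗[ℝ] g := 1 ⊗ₜ v

/-- The action of `ad_ξ`. -/
def adAct : Module.End (MvPowerSeries κ ℝ) (MvPowerSeries κ ℝ ⊗[ℝ] g) := seriesAct e (adSeries e)

/-- The action of `f(ad_ξ)`. -/
def fAct : Module.End (MvPowerSeries κ ℝ) (MvPowerSeries κ ℝ ⊗[ℝ] g) :=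
  seriesAct e (formalEval fSeries (adSeries e))

theorem adAct_skew (x y : MvPowerSeries κ ℝ ⊗[ℝ] g) :
    seriesForm B κ (adAct e x) y = -seriesForm B κ x (adAct e y) :=
  seriesAct_skew B e (fun m u v => by simpa using form_coeff_ad_pow B e 1 m u v) x y

theorem fAct_skew (x y : MvPowerSeries κ ℝ ⊗[ℝ] g) :
    seriesForm B κ (fAct e x) y = -seriesForm B κ x (fAct e y) :=
  seriesAct_skew B e (form_coeff_formalEval_ad B e fSeries_odd) x y

theorem adAct_fAct (x : MvPowerSeries κ ℝ ⊗[ℝ] g) : adAct e (fAct e x) = fAct e (adAct e x) := by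
  rw [adAct, fAct, ← Module.End.mul_apply, ← Module.End.mul_apply, ← map_mul, ← map_mul,
    (commute_formalEval (constantCoeff_adSeries e) (Commute.refl _) fSeries).eq]

/-- The operator of contraction with `(1/2) ∑_{a,b} f(ad_ξ)_{ab} e^a ∧ e^b`. -/
def exponentOp : MvPowerSeries κ (Module.End ℝ (ExteriorAlgebra ℝ g)) :=
  MvPowerSeries.map (extContrHom B : ExteriorAlgebra ℝ g →+* _) (exponentSeries B e)

theorem extContrHom_ι (v : g) : extContrHom B (ExteriorAlgebra.ι ℝ v) = extContr B v :=
  ExteriorAlgebra.lift_ι_apply ℝ _ _ v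

theorem coeff_exponentSeries (m : κ →₀ ℕ) : MvPowerSeries.coeff m (exponentSeries B e) =
    (1 / 2 : ℝ) • ∑ b, ExteriorAlgebra.ι ℝ
      (MvPowerSeries.coeff m (formalEval fSeries (adSeries e)) (e b)) *
        ExteriorAlgebra.ι ℝ (B.dual e b) := by
  have h : MvPowerSeries.coeff m (exponentSeries B e) = (1 / 2 : ℝ) • ∑ a, ∑ b,
      B.form (e a) (MvPowerSeries.coeff m (formalEval fSeries (adSeries e)) (e b)) •
        (ExteriorAlgebra.ι ℝ (B.dual e a) * ExteriorAlgebra.ι ℝ (B.dual e b)) := rfl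
  rw [h, Finset.sum_comm]
  congr 1
  refine Finset.sum_congr rfl fun b _ => ?_
  conv_rhs => rw [← sum_form_smul_dual B e
    (MvPowerSeries.coeff m (formalEval fSeries (adSeries e)) (e b))]
  simp only [map_sum, map_smul, Finset.sum_mul, smul_mul_assoc]

theorem exponentOp_eq : exponentOp B e = (1 / 2 : ℝ) • ∑ b,
    iotaSeries B κ (fAct e (constVec κ (e b))) * iotaSeries B κ (constVec κ (B.dual e b)) := by
  ext1 m
  change _ = (1 / 2 : ℝ) • MvPowerSeries.coeff m (∑ b,
    iotaSeries B κ (fAct e (constVec κ (e b))) * iotaSeries B κ (constVec κ (B.dual e b)))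
  rw [exponentOp, MvPowerSeries.coeff_map, coeff_exponentSeries, RingHom.coe_coe, map_smul, map_sum,
    map_sum]
  congr 1
  refine Finset.sum_congr rfl fun b _ => ?_
  rw [map_mul, extContrHom_ι, extContrHom_ι, iotaSeries, constVec, constVec, seriesLift_one_tmul,
    MvPowerSeries.coeff_mul_C, fAct, coeff_seriesLift]

/-- The operator `ι(𝒮)`, as a formal power series. -/
def sOp : MvPowerSeries κ (Module.End ℝ (ExteriorAlgebra ℝ g)) :=
  MvPowerSeries.map (extContrHom B : ExteriorAlgebra ℝ g →+* _) (SSeries B e)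

theorem sOp_eq : sOp B e =
    algebraMap (MvPowerSeries κ ℝ) _ (sqrtJSeries e) *
      formalEval (PowerSeries.exp ℝ) (exponentOp B e) := by
  rw [sOp, SSeries, map_mul, map_formalEval (extContrHom B), exponentOp]
  congr 1
  rw [algebraMap_seriesAlgebra, ← RingHom.comp_apply, ← MvPowerSeries.map_comp,
    AlgHom.comp_algebraMap]

end SOperator

/-! ### Commutation relations of `ι(𝒮)` -/

section CommutationRelations

variable {R M P κ : Type*} [CommRing R] [AddCommGroup M] [Module R M] [Ring P]
  [Algebra R P] [Fintype κ] {β : M →ₗ[R] M →ₗ[R] R} {e e' : κ → M}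

/-- Products of two anticommuting elements commute with everything they are built from. -/
theorem commute_mul_of_anticommute {ι : M →ₗ[R] P} (hιι : ∀ u v, ι u * ι v = -(ι v * ι u))
    (u v w : M) : Commute (ι u * ι v) (ι w) := by
  rw [commute_iff_eq, mul_assoc, hιι v w, mul_neg, ← mul_assoc, hιι u w, neg_mul, neg_neg,
    mul_assoc]

variable [Algebra ℝ P]

/-- Contraction with the bivector of a skew endomorphism `f` generates the transformation
`ψ(w) ↦ ψ(w) + ι(f w)`. -/
theorem bivector_commutator (h1 : ∀ v, ∑ a, β (e' a) v • e a = v)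
    (h2 : ∀ v, ∑ a, β (e a) v • e' a = v)
    (ψ ι : M →ₗ[R] P) (hιψ : ∀ u v, ι u * ψ v = algebraMap R P (β u v) - ψ v * ι u)
    (f : M →ₗ[R] M) (hf : ∀ u v, β (f u) v = -β u (f v)) (w : M) :
    ((1 / 2 : ℝ) • ∑ a, ι (f (e a)) * ι (e' a)) * ψ w -
      ψ w * ((1 / 2 : ℝ) • ∑ a, ι (f (e a)) * ι (e' a)) = ι (f w) := by
  have h : ∀ a, ι (f (e a)) * ι (e' a) * ψ w - ψ w * (ι (f (e a)) * ι (e' a)) =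
      β (e' a) w • ι (f (e a)) + β (e a) (f w) • ι (e' a) := fun a => by
    have h3 : β (e a) (f w) = -β (f (e a)) w := by rw [hf, neg_neg]
    rw [mul_assoc, hιψ, mul_sub, ← mul_assoc _ (ψ w), hιψ, h3, neg_smul, Algebra.smul_def,
      Algebra.smul_def, Algebra.commutes (β (e' a) w)]
    noncomm_ring
  have h4 : ∑ a, β (e' a) w • ι (f (e a)) = ι (f w) := by
    conv_rhs => rw [← h1 w]
    simp only [map_sum, map_smul]
  have h5 : ∑ a, β (e a) (f w) • ι (e' a) = ι (f w) := by
    conv_rhs => rw [← h2 (f w)]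
    simp only [map_sum, map_smul]
  rw [smul_mul_assoc, mul_smul_comm, ← smul_sub, Finset.sum_mul, Finset.mul_sum,
    ← Finset.sum_sub_distrib]
  simp only [h, Finset.sum_add_distrib, h4, h5]
  module

end CommutationRelations

section SOperator

variable {g : Type*} [LieRing g] [LieAlgebra ℝ g] (B : InvariantForm g)
  {κ : Type*} [Fintype κ] [DecidableEq κ] (e : Module.Basis κ ℝ g)

theorem exponentOp_psiSeries (w : MvPowerSeries κ ℝ ⊗[ℝ] g) :
    exponentOp B e * psiSeries g κ w - psiSeries g κ w * exponentOp B e =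
      iotaSeries B κ (fAct e w) := by
  rw [exponentOp_eq]
  exact bivector_commutator (sum_seriesForm_dual_smul B e) (sum_seriesForm_smul_dual B e) _ _
    (iotaSeries_psiSeries B) _ (fAct_skew B e) w

theorem commute_exponentOp_iotaSeries (w : MvPowerSeries κ ℝ ⊗[ℝ] g) :
    Commute (exponentOp B e) (iotaSeries B κ w) := by
  rw [exponentOp_eq]
  exact ((Commute.sum_left _ _ _ fun a _ =>
    commute_mul_of_anticommute (iotaSeries_anticommute B) _ _ w)).smul_left _

theorem constantCoeff_exponentOp : MvPowerSeries.constantCoeff (exponentOp B e) = 0 := by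
  have h : MvPowerSeries.constantCoeff (formalEval fSeries (adSeries e)) = 0 := by
    rw [constantCoeff_formalEval, ← PowerSeries.coeff_zero_eq_constantCoeff_apply,
      fSeries_odd 0 Even.zero, map_zero]
  rw [exponentOp, ← MvPowerSeries.coeff_zero_eq_constantCoeff_apply, MvPowerSeries.coeff_map,
    coeff_exponentSeries, MvPowerSeries.coeff_zero_eq_constantCoeff_apply, h]
  simp

theorem sOp_psiSeries (w : MvPowerSeries κ ℝ ⊗[ℝ] g) :
    sOp B e * psiSeries g κ w = (psiSeries g κ w + iotaSeries B κ (fAct e w)) * sOp B e := by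
  have h0 := constantCoeff_exponentOp B e
  have h := formalEval_commutator h0 _ (exponentOp_psiSeries B e w)
    (commute_exponentOp_iotaSeries B e _) (PowerSeries.exp ℝ)
  rw [PowerSeries.derivative_exp, (commute_formalEval h0 (commute_exponentOp_iotaSeries B e _)
    (PowerSeries.exp ℝ)).eq, sub_eq_iff_eq_add] at h
  rw [sOp_eq, mul_assoc, h, add_comm (iotaSeries B κ _ * _), ← add_mul, ← mul_assoc,
    Algebra.commutes, mul_assoc]

theorem sOp_iotaSeries (w : MvPowerSeries κ ℝ ⊗[ℝ] g) :
    sOp B e * iotaSeries B κ w = iotaSeries B κ w * sOp B e := by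
  rw [sOp_eq, mul_assoc, (commute_formalEval (constantCoeff_exponentOp B e)
    (commute_exponentOp_iotaSeries B e w) _).eq, ← mul_assoc, Algebra.commutes, mul_assoc]

theorem euler_seriesLift (T : g →ₗ[ℝ] Module.End ℝ (ExteriorAlgebra ℝ g))
    (F : MvPowerSeries κ (Module.End ℝ g)) (v : g) :
    euler (seriesLift κ T (seriesAct e F (1 ⊗ₜ v))) =
      seriesLift κ T (seriesAct e (euler F) (1 ⊗ₜ v)) := by
  ext1 m
  rw [coeff_euler, coeff_seriesLift, coeff_seriesLift, coeff_euler, LinearMap.smul_apply, map_smul]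

theorem seriesAct_smul (r : ℝ) (F : MvPowerSeries κ (Module.End ℝ g))
    (x : MvPowerSeries κ ℝ ⊗[ℝ] g) : seriesAct e (r • F) x = r • seriesAct e F x := by
  have h : matrixSeries e (r • F) = algebraMap ℝ (MvPowerSeries κ ℝ) r • matrixSeries e F := by
    ext a b m
    rw [Matrix.smul_apply, algebraMap_smul, coeff_matrixSeries]
    change LinearMap.toMatrix e e (r • MvPowerSeries.coeff m F) a b =
      r • MvPowerSeries.coeff m (matrixSeries e F a b)
    rw [map_smul, coeff_matrixSeries, Matrix.smul_apply]
  change Matrix.toLinAlgEquiv _ (matrixSeries e (r • F)) x = _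
  rw [h, map_smul, LinearMap.smul_apply, algebraMap_smul]
  rfl

/-- The radial derivative of `f(ad_ξ)`, by the Riccati equation for `f`. -/
theorem seriesAct_euler_fSeries (x : MvPowerSeries κ ℝ ⊗[ℝ] g) :
    seriesAct e (euler (formalEval fSeries (adSeries e))) x =
      (1 / 4 : ℝ) • adAct e x - fAct e (fAct e (adAct e x)) - (2 : ℝ) • fAct e x := by
  have h0 := constantCoeff_adSeries e
  have h : formalEval (PowerSeries.X * PowerSeries.derivative ℝ fSeries) (adSeries e) =
      (1 / 4 : ℝ) • adSeries e - formalEval fSeries (adSeries e) *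
        formalEval fSeries (adSeries e) * adSeries e -
          (2 : ℝ) • formalEval fSeries (adSeries e) := by
    rw [eq_sub_iff_add_eq, eq_sub_iff_add_eq]
    have h1 := congrArg (fun φ => formalEval φ (adSeries e)) (eq_sub_iff_add_eq.mp
      (eq_sub_iff_add_eq.mp fSeries_riccati))
    simpa only [formalEval_add, formalEval_mul h0, formalEval_smul, formalEval_X h0] using h1
  rw [euler_formalEval_adSeries, h, map_sub, map_sub, map_mul, map_mul, LinearMap.sub_apply,
    LinearMap.sub_apply, seriesAct_smul, seriesAct_smul,
    Module.End.mul_apply, Module.End.mul_apply, adAct, fAct]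

theorem euler_exponentOp : euler (exponentOp B e) = -((1 / 2 : ℝ) • ∑ a,
    iotaSeries B κ (constVec κ (B.dual e a)) * iotaSeries B κ
      ((1 / 4 : ℝ) • adAct e (constVec κ (e a)) - fAct e (fAct e (adAct e (constVec κ (e a)))) -
        (2 : ℝ) • fAct e (constVec κ (e a)))) := by
  rw [exponentOp_eq, map_smul, map_sum, ← smul_neg, ← Finset.sum_neg_distrib]
  congr 1
  refine Finset.sum_congr rfl fun a _ => ?_
  rw [← seriesAct_euler_fSeries, ← iotaSeries_anticommute, euler_mul]
  have h : euler (iotaSeries B κ (constVec κ (B.dual e a))) = 0 := by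
    rw [iotaSeries, constVec, seriesLift_one_tmul, euler_C]
  rw [h, mul_zero, add_zero, fAct, iotaSeries, constVec, euler_seriesLift]

theorem commute_exponentOp_euler : Commute (exponentOp B e) (euler (exponentOp B e)) := by
  rw [euler_exponentOp]
  refine (Commute.smul_right (Commute.sum_right _ _ _ fun a _ => ?_) _).neg_right
  exact (commute_exponentOp_iotaSeries B e _).mul_right (commute_exponentOp_iotaSeries B e _)

theorem traceSeries_eq : traceSeries e =
    ∑ a, seriesForm B κ (constVec κ (B.dual e a)) (fAct e (adAct e (constVec κ (e a)))) := by
  rw [traceSeries, Matrix.trace]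
  refine Finset.sum_congr rfl fun a _ => ?_
  rw [fAct, adAct, ← Module.End.mul_apply, ← map_mul, seriesAct_basis, map_sum,
    Finset.sum_eq_single a]
  · rw [map_smul, seriesForm_one_tmul, dual_form]
    simp
  · intro b _ hb
    rw [map_smul, seriesForm_one_tmul, dual_form]
    simp [hb]
  · simp

/-- The radial derivative of `ι(𝒮)`. -/
theorem euler_sOp : euler (sOp B e) = ((1 / 2 : ℝ) • algebraMap (MvPowerSeries κ ℝ) _
      (∑ a, seriesForm B κ (constVec κ (B.dual e a)) (fAct e (adAct e (constVec κ (e a))))) -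
    (1 / 2 : ℝ) • ∑ a, iotaSeries B κ (constVec κ (B.dual e a)) * iotaSeries B κ
      ((1 / 4 : ℝ) • adAct e (constVec κ (e a)) - fAct e (fAct e (adAct e (constVec κ (e a)))) -
        (2 : ℝ) • fAct e (constVec κ (e a)))) * sOp B e := by
  have h0 := constantCoeff_exponentOp B e
  have hJ : euler (algebraMap (MvPowerSeries κ ℝ)
      (MvPowerSeries κ (Module.End ℝ (ExteriorAlgebra ℝ g))) (sqrtJSeries e)) =
      (1 / 2 : ℝ) • (algebraMap (MvPowerSeries κ ℝ) _ (traceSeries e) *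
        algebraMap (MvPowerSeries κ ℝ) _ (sqrtJSeries e)) := by
    refine (euler_map (Algebra.ofId ℝ (Module.End ℝ (ExteriorAlgebra ℝ g)))
      (sqrtJSeries e)).trans ?_
    rw [euler_sqrtJSeries]
    change algebraMap (MvPowerSeries κ ℝ) (MvPowerSeries κ (Module.End ℝ (ExteriorAlgebra ℝ g))) _ = _
    rw [← map_mul]
    exact map_smul (IsScalarTower.toAlgHom ℝ (MvPowerSeries κ ℝ)
      (MvPowerSeries κ (Module.End ℝ (ExteriorAlgebra ℝ g)))) _ _
  rw [← traceSeries_eq, sub_eq_add_neg, ← euler_exponentOp, sOp_eq, euler_mul, hJ,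
    euler_formalEval h0 (commute_exponentOp_euler B e), PowerSeries.derivative_exp,
    (commute_formalEval h0 (commute_exponentOp_euler B e) _).eq, add_mul, smul_mul_assoc,
    smul_mul_assoc, mul_assoc, ← mul_assoc _ (euler _)]
  congr 1
  rw [Algebra.commutes (sqrtJSeries e) (euler _), mul_assoc]

end SOperator

/-! ### The recursion for the quantization map -/

section Recursion

variable {g : Type*} [LieRing g] [LieAlgebra ℝ g] (B : InvariantForm g)
  {κ : Type*}

/-- Multiplication by `v` in `Cl(g)`, transported to `∧g` by the quantization map. -/
def clMul : g →ₗ[ℝ] Module.End ℝ (ExteriorAlgebra ℝ g) := extMul + (1 / 2 : ℝ) • extContr B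

theorem seriesLift_clMul (x : MvPowerSeries κ ℝ ⊗[ℝ] g) :
    seriesLift κ (clMul B) x = psiSeries g κ x + (1 / 2 : ℝ) • iotaSeries B κ x := by
  induction x using TensorProduct.induction_on with
  | zero => simp
  | add x y hx hy => simp only [map_add, hx, hy, smul_add]; abel
  | tmul r v =>
    simp only [seriesLift, psiSeries, iotaSeries, clMul, LinearMap.liftBaseChange_tmul,
      LinearMap.comp_apply, LinearMap.add_apply, LinearMap.smul_apply, map_add, map_smul, smul_add]
    rw [smul_comm r]

/-- The operator `sym ⊗ q`. -/
abbrev symQuant : WeilAlgebra g →ₗ[ℝ] NCWeilAlgebra B :=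
  TensorProduct.map (sym g) (cliffordQuantization B)

variable [Fintype κ] (e : Module.Basis κ ℝ g)

theorem seriesOp_sum {ι : Type*} (s : Finset ι)
    (F : ι → MvPowerSeries κ (Module.End ℝ (ExteriorAlgebra ℝ g))) :
    seriesOp e (∑ i ∈ s, F i) = ∑ i ∈ s, seriesOp e (F i) :=
  map_sum (seriesOpHom e) F s

theorem weilPartial_eq (a : κ) :
    weilPartial e a = seriesOp e (MvPowerSeries.monomial (Finsupp.single a 1) 1) := by
  rw [seriesOp_monomial, symPartialPow_single]
  rfl

theorem symQuant_symEuler (y : WeilAlgebra g) :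
    symQuant B (TensorProduct.map (symEuler e) LinearMap.id y) =
      ∑ a, (envelopingι g (e a) ⊗ₜ[ℝ] 1) * symQuant B (weilPartial e a y) := by
  induction y using TensorProduct.induction_on with
  | zero => simp
  | add x y hx hy => simp only [map_add, hx, hy, mul_add, Finset.sum_add_distrib]
  | tmul p ω =>
    simp [symQuant, weilPartial, sym_symEuler, TensorProduct.sum_tmul]

variable [DecidableEq κ]

theorem quantization_eq : quantization B e =
    TensorProduct.map (sym g) (cliffordQuantization B) ∘ₗ seriesOp e (sOp B e) := rfl

theorem seriesLift_adAct (T : g →ₗ[ℝ] Module.End ℝ (ExteriorAlgebra ℝ g)) (v : g) :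
    seriesLift κ T (adAct e (constVec κ v)) =
      ∑ b, MvPowerSeries.monomial (Finsupp.single b 1) (T ⁅e b, v⁆) := by
  classical
  ext1 m
  rw [adAct, coeff_seriesLift, coeff_adSeries, map_sum, LinearMap.sum_apply, map_sum]
  refine Finset.sum_congr rfl fun b _ => ?_
  rw [MvPowerSeries.coeff_monomial]
  split_ifs
  · rfl
  · simp

theorem seriesOp_monomial_single (a : κ) (T : Module.End ℝ (ExteriorAlgebra ℝ g)) :
    seriesOp e (MvPowerSeries.monomial (Finsupp.single a 1) T) =
      TensorProduct.map LinearMap.id T * weilPartial e a := by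
  rw [weilPartial_eq, ← seriesOp_C e T, ← seriesOp_mul, ← MvPowerSeries.monomial_zero_eq_C_apply,
    MvPowerSeries.monomial_mul_monomial, zero_add, mul_one]

theorem weilOddPartial_eq (a : κ) : weilOddPartial B e a =
    seriesOp e (iotaSeries B κ (constVec κ (B.dual e a)) +
      psiSeries g κ (adAct e (constVec κ (B.dual e a)))) := by
  rw [psiSeries, seriesLift_adAct, iotaSeries, constVec, seriesLift_one_tmul, seriesOp_add,
    seriesOp_C, seriesOp_sum]
  simp only [seriesOp_monomial, symPartialPow_single]
  rfl

theorem sum_dual_adAct (T : g →ₗ[ℝ] Module.End ℝ (ExteriorAlgebra ℝ g)) :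
    (-1 / 2 : ℝ) • ∑ b, seriesLift κ T (constVec κ (B.dual e b)) *
        seriesLift κ T (adAct e (constVec κ (e b))) =
      ∑ a, MvPowerSeries.monomial (Finsupp.single a 1)
        ((1 / 2 : ℝ) • ∑ b, T (B.dual e b) * T ⁅e b, e a⁆) := by
  have h : ∀ (m : κ →₀ ℕ) (r : ℝ) (x : Module.End ℝ (ExteriorAlgebra ℝ g)),
      MvPowerSeries.monomial m (r • x) = r • MvPowerSeries.monomial m x := fun m r x =>
    ((MvPowerSeries.monomial m).restrictScalars ℝ).map_smul r x
  simp only [seriesLift_adAct, constVec, seriesLift_one_tmul, Finset.mul_sum,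
    ← MvPowerSeries.monomial_zero_eq_C_apply, MvPowerSeries.monomial_mul_monomial, zero_add, h,
    map_sum, ← Finset.smul_sum]
  rw [Finset.sum_comm, neg_div, neg_smul, ← smul_neg, ← Finset.sum_neg_distrib]
  congr 1
  refine Finset.sum_congr rfl fun a _ => ?_
  rw [← Finset.sum_neg_distrib]
  refine Finset.sum_congr rfl fun b _ => ?_
  rw [← lie_skew (e a) (e b), map_neg, show ∀ x y : Module.End ℝ (ExteriorAlgebra ℝ g),
    x * -y = -(x * y) from fun x y => mul_neg x y, map_neg, neg_neg]

/-- The number operator of the Weil algebra as an operator on `S(g) ⊗ ∧g`. -/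
theorem weilNumber_eq_seriesOp : weilNumber B e = TensorProduct.map (symEuler e) LinearMap.id +
    seriesOp e ((-1 / 2 : ℝ) • ∑ a, psiSeries g κ (constVec κ (B.dual e a)) *
        psiSeries g κ (adAct e (constVec κ (e a))) +
      ∑ a, psiSeries g κ (constVec κ (e a)) * (iotaSeries B κ (constVec κ (B.dual e a)) +
        psiSeries g κ (adAct e (constVec κ (B.dual e a))))) := by
  have h1 : ∀ a, seriesOp e (psiSeries g κ (constVec κ (e a))) =
      LinearMap.mulLeft ℝ (weilOdd (e a)) := fun a => by
    rw [psiSeries, constVec, seriesLift_one_tmul, seriesOp_C]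
    refine TensorProduct.ext' fun p ω => ?_
    simp [weilOdd_apply, extMul_apply]
  have h2 : ∀ a, TensorProduct.map LinearMap.id ((1 / 2 : ℝ) • ∑ b, extMul (B.dual e b) *
      extMul ⁅e b, e a⁆) * weilPartial e a =
      LinearMap.mulLeft ℝ ((1 : SymmetricAlgebra ℝ g) ⊗ₜ[ℝ] lambdaMap B e (e a)) *
        weilPartial e a := fun a => by
    congr 1
    refine TensorProduct.ext' fun p ω => ?_
    rw [TensorProduct.map_tmul, LinearMap.mulLeft_apply, lambdaMap_eq,
      Algebra.TensorProduct.tmul_mul_tmul, one_mul, LinearMap.id_apply]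
    simp [extMul_apply, Finset.sum_mul, mul_assoc, LinearMap.sum_apply]
  have h3 : TensorProduct.map (symEuler e) LinearMap.id = ∑ a, LinearMap.mulLeft ℝ
      (SymmetricAlgebra.ι ℝ g (e a) ⊗ₜ[ℝ] (1 : ExteriorAlgebra ℝ g)) * weilPartial e a := by
    refine TensorProduct.ext' fun p ω => ?_
    rw [LinearMap.sum_apply, TensorProduct.map_tmul, symEuler_apply, TensorProduct.sum_tmul]
    simp [weilPartial]
  have h4 := sum_dual_adAct B e extMul
  rw [← psiSeries] at h4
  rw [h4, seriesOp_add, seriesOp_sum, seriesOp_sum]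
  simp only [seriesOp_mul, ← weilOddPartial_eq, h1, seriesOp_monomial_single, h2]
  rw [h3, ← add_assoc, ← Finset.sum_add_distrib]
  simp only [← add_mul]
  refine LinearMap.ext fun x => ?_
  rw [weilNumber_apply]
  simp [LinearMap.sum_apply, weilEven_apply, add_mul]

theorem coeff_zero_sOp : MvPowerSeries.coeff 0 (sOp B e) = 1 := by
  rw [MvPowerSeries.coeff_zero_eq_constantCoeff_apply, sOp_eq, map_mul, constantCoeff_formalEval,
    algebraMap_seriesAlgebra, MvPowerSeries.constantCoeff_map, constantCoeff_sqrtJSeries]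
  simp

/-- Contraction of `1` only sees the coefficient of `𝒮` in degree zero, which is `J^{1/2}`. -/
theorem coeff_sOp_one (m : κ →₀ ℕ) : MvPowerSeries.coeff m (sOp B e) 1 =
    MvPowerSeries.coeff m (sqrtJSeries e) • (1 : ExteriorAlgebra ℝ g) := by
  have h1 : ∀ x : ExteriorAlgebra ℝ g,
      extContrHom B x 1 = algebraMap ℝ _ (ExteriorAlgebra.algebraMapInv x) := fun x => by
    induction x using ExteriorAlgebra.induction with
    | algebraMap r => simp [Algebra.algebraMap_eq_smul_one]
    | ι v => simp [extContrHom_ι, extContr_one, ExteriorAlgebra.algebraMapInv]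
    | mul a b ha hb =>
      rw [map_mul, Module.End.mul_apply, hb, Algebra.algebraMap_eq_smul_one, map_smul, ha, map_mul,
        Algebra.algebraMap_eq_smul_one, Algebra.algebraMap_eq_smul_one, smul_smul, mul_comm]
    | add a b ha hb => rw [map_add, LinearMap.add_apply, ha, hb, map_add, map_add]
  let ε : ExteriorAlgebra ℝ g →ₐ[ℝ] ℝ := ExteriorAlgebra.algebraMapInv
  have h2 : MvPowerSeries.map (ε : ExteriorAlgebra ℝ g →+* ℝ)
      (exponentSeries B e) = 0 := by
    ext m
    rw [MvPowerSeries.coeff_map, coeff_exponentSeries]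
    simp [ε, ExteriorAlgebra.algebraMapInv]
  have h3 : formalEval (PowerSeries.exp ℝ) (0 : MvPowerSeries κ ℝ) = 1 := by
    ext m
    rw [coeff_formalEval_def, Finset.sum_eq_single 0]
    · simp
    · intro n _ hn; simp [hn]
    · simp
  have h4 : MvPowerSeries.map (ε : ExteriorAlgebra ℝ g →+* ℝ)
      (SSeries B e) = sqrtJSeries e := by
    rw [SSeries, map_mul, map_formalEval, h2, h3, mul_one, ← RingHom.comp_apply,
      ← MvPowerSeries.map_comp, AlgHom.comp_algebraMap]
    exact congrArg (fun T => T (sqrtJSeries e)) (MvPowerSeries.map_id (R := ℝ))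
  rw [sOp, MvPowerSeries.coeff_map, RingHom.coe_coe, h1, ← h4, MvPowerSeries.coeff_map,
    Algebra.algebraMap_eq_smul_one]
  rfl

variable [FiniteDimensional ℝ g]

theorem symQuant_clMul (v : g) (y : WeilAlgebra g) :
    symQuant B (TensorProduct.map LinearMap.id (clMul B v) y) = ncOdd B v * symQuant B y := by
  induction y using TensorProduct.induction_on with
  | zero => simp
  | add x y hx hy => simp only [map_add, hx, hy, mul_add]
  | tmul p ω =>
    rw [symQuant, TensorProduct.map_tmul, TensorProduct.map_tmul, TensorProduct.map_tmul,
      ncOdd_apply, Algebra.TensorProduct.tmul_mul_tmul, one_mul, ι_mul_cliffordQuantization]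
    rfl

theorem symQuant_spinAd (ξ : g) (y : WeilAlgebra g) :
    symQuant B (TensorProduct.map LinearMap.id
      ((1 / 2 : ℝ) • ∑ b, clMul B (B.dual e b) * clMul B ⁅e b, ξ⁆) y) =
      (1 ⊗ₜ[ℝ] spinAd B e ξ) * symQuant B y := by
  have h : ∀ b, symQuant B (TensorProduct.map LinearMap.id
      (clMul B (B.dual e b) * clMul B ⁅e b, ξ⁆) y) =
      (1 ⊗ₜ[ℝ] (CliffordAlgebra.ι B.quadraticForm (B.dual e b) *
        CliffordAlgebra.ι B.quadraticForm ⁅e b, ξ⁆)) * symQuant B y := fun b => by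
    rw [← LinearMap.id_comp (LinearMap.id : SymmetricAlgebra ℝ g →ₗ[ℝ] _), Module.End.mul_eq_comp,
      TensorProduct.map_comp, LinearMap.comp_apply, symQuant_clMul, symQuant_clMul, ← mul_assoc,
      ncOdd_apply, ncOdd_apply, Algebra.TensorProduct.tmul_mul_tmul, one_mul]
  have h2 : (TensorProduct.map LinearMap.id
      ((1 / 2 : ℝ) • ∑ b, clMul B (B.dual e b) * clMul B ⁅e b, ξ⁆) :
        WeilAlgebra g →ₗ[ℝ] WeilAlgebra g) = (1 / 2 : ℝ) • ∑ b, TensorProduct.map LinearMap.id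
      (clMul B (B.dual e b) * clMul B ⁅e b, ξ⁆) := by
    refine TensorProduct.ext' fun p ω => ?_
    simp [LinearMap.sum_apply, TensorProduct.tmul_sum]
  rw [h2, LinearMap.smul_apply, LinearMap.sum_apply, map_smul, map_sum, spinAd_apply,
    TensorProduct.tmul_smul, smul_mul_assoc, TensorProduct.tmul_sum, Finset.sum_mul]
  simp only [h]

set_option maxRecDepth 4000 in
/-- The quantization map is determined by this recursion: it is the supersymmetrization map for
the generators `ξ ⊗ 1 + 1 ⊗ λ(ξ)` and `1 ⊗ ξ` of the Weil algebra. -/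
theorem quantization_weilNumber (x : WeilAlgebra g) :
    quantization B e (weilNumber B e x) =
      ∑ a, ncEven B e (e a) * quantization B e (weilPartial e a x) +
        ∑ a, ncOdd B (e a) * quantization B e (weilOddPartial B e a x) := by
  set H := sOp B e with hH
  have hq : ∀ y, quantization B e y = symQuant B (seriesOp e H y) := fun y =>
    LinearMap.congr_fun (quantization_eq B e) y
  have hid := anticommutation_identity (seriesForm_comm B) (sum_seriesForm_dual_smul B e)
    (sum_seriesForm_smul_dual B e) (psiSeries g κ) (iotaSeries B κ) (iotaSeries_anticommute B)
    (iotaSeries_psiSeries B)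
    (adAct e) (fAct e) (adAct_skew B e) (fAct_skew B e) (adAct_fAct e)
    (sOp B e) (euler (sOp B e)) (sOp_psiSeries B e) (sOp_iotaSeries B e) (euler_sOp B e)
  rw [← hH] at hid
  simp only [← seriesLift_clMul] at hid
  rw [sum_dual_adAct B e (clMul B)] at hid
  have hN : seriesOp e H * weilNumber B e =
      TensorProduct.map (symEuler e) LinearMap.id * seriesOp e H +
        seriesOp e ((∑ a, MvPowerSeries.monomial (Finsupp.single a 1)
          ((1 / 2 : ℝ) • ∑ b, clMul B (B.dual e b) * clMul B ⁅e b, e a⁆)) * H +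
        ∑ a, seriesLift κ (clMul B) (constVec κ (e a)) * (H *
          (iotaSeries B κ (constVec κ (B.dual e a)) +
            psiSeries g κ (adAct e (constVec κ (B.dual e a)))))) := by
    rw [weilNumber_eq_seriesOp, mul_add, seriesOp_symEuler, ← seriesOp_mul, add_assoc, ← seriesOp_add,
      add_comm (euler H), hid]
  have hcomm : ∀ a, weilPartial e a * seriesOp e H = seriesOp e H * weilPartial e a := fun a => by
    rw [weilPartial_eq, ← seriesOp_mul, ← seriesOp_mul]
    congr 1
    have h1 : MvPowerSeries.monomial (Finsupp.single a 1)
        (1 : Module.End ℝ (ExteriorAlgebra ℝ g)) = MvPowerSeries.X a := rfl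
    rw [h1]
    exact (MvPowerSeries.commute_X H a).symm
  have hC : ∀ a, seriesOp e (seriesLift κ (clMul B) (constVec κ (e a))) =
      TensorProduct.map LinearMap.id (clMul B (e a)) := fun a => by
    rw [constVec, seriesLift_one_tmul, seriesOp_C]
  have h := congrArg (symQuant B) (LinearMap.congr_fun hN x)
  rw [Module.End.mul_apply] at h
  rw [hq, h, seriesOp_add, seriesOp_sum, seriesOp_mul, seriesOp_sum]
  simp only [seriesOp_monomial_single, seriesOp_mul, hC, ← weilOddPartial_eq, LinearMap.add_apply,
    LinearMap.sum_apply, Module.End.mul_apply, map_add, map_sum, symQuant_symEuler, symQuant_clMul,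
    symQuant_spinAd]
  have hcomm' : ∀ a, weilPartial e a (seriesOp e H x) = seriesOp e H (weilPartial e a x) :=
    fun a => LinearMap.congr_fun (hcomm a) x
  simp only [hcomm', ← hq, ← add_assoc, ← Finset.sum_add_distrib, ← add_mul, ncEven_apply]

/-- Contractions commute with `ι(𝒮)`, as `𝒮` is even. -/
theorem quantization_weilContr (ξ : g) :
    quantization B e ∘ₗ weilContr B ξ = ncContr B ξ ∘ₗ quantization B e := by
  have h1 : weilContr B ξ = seriesOp e (iotaSeries B κ (constVec κ ξ)) := by
    rw [iotaSeries, constVec, seriesLift_one_tmul, seriesOp_C]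
    rfl
  have h2 : seriesOp e (sOp B e) * weilContr B ξ = weilContr B ξ * seriesOp e (sOp B e) := by
    rw [h1, ← seriesOp_mul, ← seriesOp_mul, sOp_iotaSeries]
  have h3 : symQuant B ∘ₗ weilContr B ξ = ncContr B ξ ∘ₗ symQuant B := by
    refine TensorProduct.ext' fun p ω => ?_
    rw [LinearMap.comp_apply, LinearMap.comp_apply, weilContr, symQuant, TensorProduct.map_tmul,
      TensorProduct.map_tmul, TensorProduct.map_tmul, ncContr_tmul,
      ι_commutator_cliffordQuantization]
    rfl
  rw [quantization_eq, LinearMap.comp_assoc, ← Module.End.mul_eq_comp, h2, Module.End.mul_eq_comp,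
    ← LinearMap.comp_assoc, h3, LinearMap.comp_assoc]

theorem quantization_one_tmul (ω : ExteriorAlgebra ℝ g) :
    quantization B e ((1 : SymmetricAlgebra ℝ g) ⊗ₜ[ℝ] ω) =
      (1 : UniversalEnvelopingAlgebra ℝ g) ⊗ₜ[ℝ] cliffordQuantization B ω := by
  have h1 : SymDegreeLT e 1 (1 : SymmetricAlgebra ℝ g) := fun a => by simp [SymDegreeLT]
  rw [quantization_eq, LinearMap.comp_apply, seriesOp_tmul e _ h1, Finset.sum_eq_single 0]
  · rw [coeff_zero_sOp, symPartialPow_zero, TensorProduct.map_tmul, Module.End.one_apply,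
      Module.End.one_apply, sym_one]
  · intro m _ hm
    rw [symPartialPow_apply_eq_zero e h1 m, TensorProduct.zero_tmul]
    exact Nat.one_le_iff_ne_zero.mpr fun h => hm ((Finsupp.degree_eq_zero_iff m).mp h)
  · intro h
    exact absurd (by simp) h

theorem quantization_one : quantization B e 1 = 1 := by
  rw [Algebra.TensorProduct.one_def, quantization_one_tmul, cliffordQuantization_one]
  rfl

theorem quantization_tmul_one (p : SymmetricAlgebra ℝ g) :
    quantization B e (p ⊗ₜ[ℝ] (1 : ExteriorAlgebra ℝ g)) = duflo e p ⊗ₜ[ℝ] (1 : Cl B) := by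
  obtain ⟨n, hn⟩ := exists_symDegreeLT e p
  have h : sqrtJHat e p = ∑ m ∈ (Finsupp.finite_of_degree_lt (σ := κ) n).toFinset,
      MvPowerSeries.coeff m (sqrtJSeries e) • symPartialPow e m p := by
    refine finsum_eq_sum_of_support_subset (fun m => MvPowerSeries.coeff m (sqrtJSeries e) •
      symPartialPow e m p) fun m hm => ?_
    rw [Set.Finite.coe_toFinset]
    by_contra hlt
    refine hm ?_
    change _ • symPartialPow e m p = 0
    rw [symPartialPow_apply_eq_zero e hn m (not_lt.mp hlt), smul_zero]
  rw [quantization_eq, LinearMap.comp_apply, seriesOp_tmul e _ hn, duflo, LinearMap.comp_apply, h]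
  simp only [coeff_sOp_one, map_sum, TensorProduct.map_tmul, map_smul, cliffordQuantization_one,
    TensorProduct.sum_tmul, TensorProduct.tmul_smul, TensorProduct.smul_tmul']

theorem quantization_weilLie (ξ : g) :
    quantization B e ∘ₗ weilLie ξ = ncLie B ξ ∘ₗ quantization B e :=
  intertwines_weilLie B e (quantization_weilNumber B e) ξ (ncLie B ξ)
    (by rw [quantization_one, ncLie_one])
    (fun η y => by rw [ncLie_mul, ncLie_ncEven]) (fun η y => by rw [ncLie_mul, ncLie_ncOdd])

theorem quantization_weilDiff :
    quantization B e ∘ₗ weilDiff B e = ncDiff B e ∘ₗ quantization B e :=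
  intertwines_weilDiff B e (quantization_weilNumber B e) (ncDiff B e)
    (by rw [quantization_one, ncDiff_one]) (ncDiff_ncEven_mul B e) (ncDiff_ncOdd_mul B e)

end Recursion

end QuadraticLie

end

open scoped TensorProduct in
theorem mainTheorem1 {g : Type*} [LieRing g] [LieAlgebra ℝ g] (B : QuadraticLie.InvariantForm g)
    {κ : Type*} [Fintype κ] [DecidableEq κ] (e : Module.Basis κ ℝ g) :
    (∀ ξ : g, QuadraticLie.quantization B e ∘ₗ QuadraticLie.weilContr B ξ =
      QuadraticLie.ncContr B ξ ∘ₗ QuadraticLie.quantization B e) ∧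
    (∀ ξ : g, QuadraticLie.quantization B e ∘ₗ QuadraticLie.weilLie ξ =
      QuadraticLie.ncLie B ξ ∘ₗ QuadraticLie.quantization B e) ∧
    QuadraticLie.quantization B e ∘ₗ QuadraticLie.weilDiff B e =
      QuadraticLie.ncDiff B e ∘ₗ QuadraticLie.quantization B e ∧
    (∀ p : SymmetricAlgebra ℝ g,
      QuadraticLie.quantization B e (p ⊗ₜ[ℝ] (1 : ExteriorAlgebra ℝ g)) =
        QuadraticLie.duflo e p ⊗ₜ[ℝ] (1 : QuadraticLie.Cl B)) ∧
    (∀ ω : ExteriorAlgebra ℝ g,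
      QuadraticLie.quantization B e ((1 : SymmetricAlgebra ℝ g) ⊗ₜ[ℝ] ω) =
        (1 : UniversalEnvelopingAlgebra ℝ g) ⊗ₜ[ℝ] QuadraticLie.cliffordQuantization B ω) := by
  have : FiniteDimensional ℝ g := Module.Finite.of_basis e
  exact ⟨QuadraticLie.quantization_weilContr B e, QuadraticLie.quantization_weilLie B e,
    QuadraticLie.quantization_weilDiff B e, QuadraticLie.quantization_tmul_one B e,
    QuadraticLie.quantization_one_tmul B e⟩
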